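/- Let $D\ge 1$, $m>0$, $d=D+1$, and write $kx=-k^0x^0+\mathbf k\cdot\mathbf x$, $\tilde f(k)=\int f(x)e^{-ikx}\,d^dx$, $\omega_{\mathbf p}=\sqrt{m^2+\mathbf p^2}$, $p=(\omega_{\mathbf p},\mathbf p)$ and $d\mu(\mathbf p)=\frac{d^D\mathbf p}{(2\pi)^D\,2\omega_{\mathbf p}}$. Let $\mathcal H=L^2(\mathbb R^D,\mu)$; a real Schwartz function $f\in\mathcal S_{\mathbb R}(\mathbb R^d)$ defines the vector $[f]=\tilde f(\omega_{\mathbf p},\mathbf p)\in\mathcal H$. Let $\mathcal F$ be the symmetric Fock space over $\mathcal H$, with vacuum $\Omega$ and finite-particle subspace $\mathcal F_0$. For $F\in\mathcal H$ let $\Phi(F)=a(F)+a^\dagger(F)$ on $\mathcal F_0$ (so that $\langle\Omega,\Phi([f])\Phi([g])\Omega\rangle=\int\overline{\tilde f(p)}\,\tilde g(p)\,d\mu(\mathbf p)=:\omega_2(f,g)$ for real $f,g$), and for $h\in\mathcal S_{\mathbb R}(\mathbb R^d)$ let, on $\mathcal F_0$, $$:\!\Phi^2\!:(h)=\iint\Bigl[\tilde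 h(-p-q)\,a(\mathbf p)a(\mathbf q)+2\,\tilde h(p-q)\,a^\dagger(\mathbf p)a(\mathbf q)+\tilde h(p+q)\,a^\dagger(\mathbf p)a^\dagger(\mathbf q)\Bigr]d\mu(\mathbf p)\,d\mu(\mathbf q).$$ Let $\Delta$ be the Pauli--Jordan commutator function, $\int f\,(\Delta*g)\,d^dx=2\,\mathrm{Im}\,\omega_2(f,g)$ for real $f,g$. Theorem. Let $h\in\mathcal S_{\mathbb R}(\mathbb R^d)$. (i) The vectors $[f]$, $f\in\mathcal S_{\mathbb R}(\mathbb R^d)$, are dense in $\mathcal H$, and $t_h g=h\cdot(\Delta*g)$ maps $\mathcal S_{\mathbb R}(\mathbb R^d)$ to itself and extends to a bounded real-linear operator $t_h$ on $\mathcal H$. Put $T_h=\exp(t_h)$. (ii) For all $F\in\mathcal H$, $\Phi(F)$ and $:\!\Phi^2\!:(h)$ are well defined on $\mathcal F_0$ and have self-adjoint closures, so that $W_1(F)=\exp\bigl[i\,\overline{\Phi(F)}\bigr]$ and $W_2(h)=\exp\bigl[\tfrac i2\,\overline{:\!\Phi^2\!:(h)}\bigr]$ are unitaries on $\mathcal F$.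 (iii) For all $F\in\mathcal H$, in particular for $F=[f]$ with $f\in\mathcal S_{\mathbb R}(\mathbb R^d)$, $$W_2(h)^\dagger\,W_1(F)\,W_2(h)=W_1(T_hF).$$ (iv) Let $\mathcal A=\{W_1([f]):f\in\mathcal S_{\mathbb R}(\mathbb R^d)\}''$ be the Weyl algebra and $\omega=\langle\Omega,\cdot\,\Omega\rangle$. There is exactly one *-automorphism $\alpha_{T_h}$ of $\mathcal A$ that is continuous in the weak operator topology and satisfies $\alpha_{T_h}(W_1([f]))=W_1(T_h[f])$ for all $f\in\mathcal S_{\mathbb R}(\mathbb R^d)$. It is implemented by $W_2(h)$: $\alpha_{T_h}(a)=W_2(h)^\dagger\,a\,W_2(h)$ for all $a\in\mathcal A$. (v) Consequently $\omega\circ\alpha_{T_h}$ is the vector state of $W_2(h)\Omega$, $\omega(\alpha_{T_h}(a))=\langle W_2(h)\Omega,a\,W_2(h)\Omega\rangle$ for all $a\in\mathcal A$, and $\omega$ and $\omega\circ\alpha_{T_h}$ both lie in the folium of the vacuum Fock representation, i.e. among the states $a\mapsto\sum_i\langle\psi_i,a\psi_i\rangle$ with $\psi_i\in\mathcal F$,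 $\sum_i\|\psi_i\|^2=1$. -/

import Mathlib

open MeasureTheory Filter Topology
open scoped SchwartzMap ENNReal

noncomputable section

namespace LocalSqueezing

/-! ### Minkowski space, Fourier transform and mass shell -/

/-- Momentum space `ℝ^D`. -/
abbrev Momentum (D : ℕ) : Type := EuclideanSpace ℝ (Fin D)

/-- Minkowski space `ℝ^{D+1}`; coordinate `0` is time, the others are space. -/
abbrev Spacetime (D : ℕ) : Type := EuclideanSpace ℝ (Fin (D + 1))

/-- The Minkowski product `k x = -k⁰ x⁰ + 𝐤 · 𝐱`. -/
def minkowski {D : ℕ} (k x : Spacetime D) : ℝ :=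
  -(k 0 * x 0) + ∑ i : Fin D, k i.succ * x i.succ

/-- The Fourier transform `f̃(k) = ∫ f(x) e^{-i k x} dx` (Minkowski product in the exponent). -/
def fourier {D : ℕ} (f : Spacetime D → ℝ) (k : Spacetime D) : ℂ :=
  ∫ x, (f x : ℂ) * Complex.exp (-(Complex.I * (minkowski k x : ℂ)))

/-- The energy `ω_𝐩 = √(m² + 𝐩²)`. -/
def energy {D : ℕ} (m : ℝ) (p : Momentum D) : ℝ := √(m ^ 2 + ‖p‖ ^ 2)

/-- The point `(ω_𝐩, 𝐩)` of the mass shell. -/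
def shell {D : ℕ} (m : ℝ) (p : Momentum D) : Spacetime D :=
  WithLp.toLp 2 (Fin.cons (energy m p) (fun i => p i))

/-- The measure `dμ(𝐩) = d^D𝐩 / ((2π)^D 2ω_𝐩)`. -/
def shellMeasure (D : ℕ) (m : ℝ) : Measure (Momentum D) :=
  volume.withDensity fun p => ENNReal.ofReal (1 / ((2 * Real.pi) ^ D * (2 * energy m p)))

instance (D : ℕ) (m : ℝ) : SigmaFinite (shellMeasure D m) :=
  SigmaFinite.withDensity_ofReal _

/-- The restriction `𝐩 ↦ f̃(ω_𝐩, 𝐩)` of the Fourier transform to the mass shell. -/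
def onShell {D : ℕ} (m : ℝ) (f : Spacetime D → ℝ) (p : Momentum D) : ℂ :=
  fourier f (shell m p)

/-- The one-particle space `L²(ℝ^D, μ)`. It is the completion of the real Schwartz functions
modulo `ker Δ` in the norm `‖f‖² = ω₂(f, f)`, the class of `f` being its restriction to the
mass shell. -/
abbrev OneParticle (D : ℕ) (m : ℝ) : Type := Lp ℂ 2 (shellMeasure D m)

theorem fourier_eq {D : ℕ} (f : 𝓢(Spacetime D, ℝ)) (k : Spacetime D) :
    fourier f k = FourierTransform.fourier (f.postcompCLM Complex.ofRealCLM)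
      ((2 * Real.pi)⁻¹ • WithLp.toLp 2 (Fin.cons (-k 0) (fun i : Fin D => k i.succ)) :
        Spacetime D) := by
  rw [SchwartzMap.fourier_coe, Real.fourier_eq']
  unfold fourier minkowski
  congr 1
  ext x
  rw [smul_eq_mul, mul_comm]
  congr 2
  have : (inner ℝ x ((2 * Real.pi)⁻¹ • WithLp.toLp 2
      (Fin.cons (-k 0) (fun i : Fin D => k i.succ)) : Spacetime D) : ℝ)
      = (2 * Real.pi)⁻¹ * (-(k 0 * x 0) + ∑ i : Fin D, k i.succ * x i.succ) := by
    rw [inner_smul_right, PiLp.inner_apply, Fin.sum_univ_succ]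
    simp
  rw [this]
  have hp : (Real.pi : ℂ) ≠ 0 := by exact_mod_cast Real.pi_ne_zero
  push_cast
  field_simp

theorem norm_le_norm_cons {D : ℕ} (a : ℝ) (p : Momentum D) :
    ‖p‖ ≤ ‖(WithLp.toLp 2 (Fin.cons a (fun i => p i)) : Spacetime D)‖ := by
  rw [EuclideanSpace.norm_eq, EuclideanSpace.norm_eq]
  apply Real.sqrt_le_sqrt
  rw [Fin.sum_univ_succ]
  simp
  positivity

theorem energy_pos {D : ℕ} {m : ℝ} (hm : 0 < m) (p : Momentum D) : 0 < energy m p :=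
  Real.sqrt_pos.2 (by positivity)

theorem le_energy {D : ℕ} {m : ℝ} (p : Momentum D) : m ≤ energy m p :=
  Real.le_sqrt_of_sq_le (by nlinarith [sq_nonneg ‖p‖])

theorem continuous_energy {D : ℕ} (m : ℝ) : Continuous (energy m : Momentum D → ℝ) := by
  unfold energy; fun_prop

theorem memLp_onShell {D : ℕ} {m : ℝ} (hm : 0 < m) (f : 𝓢(Spacetime D, ℝ)) :
    MemLp (onShell m f) 2 (shellMeasure D m) := by
  set g := FourierTransform.fourier (f.postcompCLM Complex.ofRealCLM) with hg
  have hfun : onShell m f = fun p : Momentum D => g ((2 * Real.pi)⁻¹ • WithLp.toLp 2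
      (Fin.cons (-energy m p) (fun i : Fin D => p i)) : Spacetime D) := by
    ext p
    rw [onShell, fourier_eq]
    rfl
  have hcont : Continuous (onShell m f : Momentum D → ℂ) := by
    rw [hfun]
    refine g.continuous.comp ?_
    refine Continuous.fun_const_smul ?_ _
    refine (PiLp.continuous_toLp 2 _).comp ?_
    refine continuous_pi fun i => ?_
    refine Fin.cases ?_ (fun i => ?_) i
    · simp only [Fin.cons_zero]
      exact (continuous_energy m).neg
    · simp only [Fin.cons_succ]
      fun_prop
  have hac : shellMeasure D m ≪ volume := withDensity_absolutelyContinuous _ _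
  rw [memLp_two_iff_integrable_sq_norm hcont.aestronglyMeasurable]
  have hle : shellMeasure D m ≤
      ENNReal.ofReal (1 / ((2 * Real.pi) ^ D * (2 * m))) • (volume : Measure (Momentum D)) := by
    rw [← withDensity_const]
    refine withDensity_mono (ae_of_all _ fun p => ENNReal.ofReal_le_ofReal ?_)
    have := le_energy (m := m) p
    gcongr
  refine Integrable.mono_measure (Integrable.smul_measure ?_ ENNReal.ofReal_ne_top) hle
  set C := 2 ^ (D + 1) * (Finset.Iic ((D + 1, 0) : ℕ × ℕ)).sup
    (fun k => SchwartzMap.seminorm ℝ k.1 k.2) g with hC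
  have hdec : ∀ x : Spacetime D, (1 + ‖x‖) ^ (D + 1) * ‖g x‖ ≤ C := fun x => by
    simpa using SchwartzMap.one_add_le_sup_seminorm_apply (𝕜 := ℝ) (m := (D + 1, 0))
      (k := D + 1) (n := 0) le_rfl le_rfl g x
  have hp1 : (1 : ℝ) ≤ 2 * Real.pi := by linarith [Real.pi_gt_three]
  have hbd : ∀ p : Momentum D, ‖onShell m f p‖ ^ 2 ≤
      (C * (2 * Real.pi) ^ (D + 1)) ^ 2 * (1 + ‖p‖) ^ (-((D : ℝ) + 1)) := fun p => by
    have h1 := hdec ((2 * Real.pi)⁻¹ • WithLp.toLp 2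
      (Fin.cons (-energy m p) (fun i : Fin D => p i)) : Spacetime D)
    have h2 : onShell m f p = g _ := congrFun hfun p
    rw [← h2] at h1
    have h3 : (2 * Real.pi)⁻¹ * (1 + ‖p‖) ≤ 1 + ‖((2 * Real.pi)⁻¹ • WithLp.toLp 2
      (Fin.cons (-energy m p) (fun i : Fin D => p i)) : Spacetime D)‖ := by
      rw [norm_smul, mul_add, mul_one, Real.norm_of_nonneg (by positivity)]
      have := inv_le_one_of_one_le₀ hp1
      gcongr
      exact norm_le_norm_cons _ _
    have h4 : (1 + ‖p‖) ^ (D + 1) * ‖onShell m f p‖ ≤ C * (2 * Real.pi) ^ (D + 1) := by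
      have h5 : ((2 * Real.pi)⁻¹ * (1 + ‖p‖)) ^ (D + 1) * ‖onShell m f p‖ ≤ C :=
        le_trans (by gcongr) h1
      rw [mul_pow, inv_pow, mul_assoc, inv_mul_le_iff₀ (by positivity)] at h5
      linarith
    have hq : (1 : ℝ) ≤ (1 + ‖p‖) ^ (D + 1) := one_le_pow₀ (by linarith [norm_nonneg p])
    have hr : (1 + ‖p‖) ^ (-((D : ℝ) + 1)) = ((1 + ‖p‖) ^ (D + 1))⁻¹ := by
      rw [Real.rpow_neg (by positivity)]
      congr 1
      exact_mod_cast Real.rpow_natCast (1 + ‖p‖) (D + 1)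
    rw [hr, ← div_eq_mul_inv, le_div_iff₀ (by positivity)]
    calc ‖onShell m f p‖ ^ 2 * (1 + ‖p‖) ^ (D + 1)
        ≤ ‖onShell m f p‖ ^ 2 * ((1 + ‖p‖) ^ (D + 1)) ^ 2 := by
          gcongr
          exact le_self_pow₀ hq (by norm_num)
      _ = ((1 + ‖p‖) ^ (D + 1) * ‖onShell m f p‖) ^ 2 := by ring
      _ ≤ _ := by gcongr
  refine Integrable.mono' ((integrable_one_add_norm (E := Momentum D) (μ := volume)
    (r := (D : ℝ) + 1) (by simp)).const_mul ((C * (2 * Real.pi) ^ (D + 1)) ^ 2)) ?_ ?_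
  · exact (hcont.norm.pow 2).aestronglyMeasurable
  · refine ae_of_all _ fun p => ?_
    simpa using hbd p

/-- The one-particle vector of a real Schwartz function. -/
def oneParticle {D : ℕ} {m : ℝ} (hm : 0 < m) (f : 𝓢(Spacetime D, ℝ)) : OneParticle D m :=
  (memLp_onShell hm f).toLp

/-! ### The phase space transformation -/

/-- `(Δ ∗ g)(x)` for the Pauli–Jordan commutator function `Δ`, whose Fourier transform is
`Δ̃(k) = -i (π/ω_𝐤) [δ(k⁰ - ω_𝐤) - δ(k⁰ + ω_𝐤)]`; the contribution of the lower shell has been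
written in the variable `-𝐤`. -/
def pauliJordan {D : ℕ} (m : ℝ) (g : Spacetime D → ℝ) (x : Spacetime D) : ℂ :=
  ∫ k, -Complex.I *
    (fourier g (shell m k) * Complex.exp (Complex.I * (minkowski (shell m k) x : ℂ))
      - fourier g (-shell m k) * Complex.exp (Complex.I * (minkowski (-shell m k) x : ℂ)))
    ∂shellMeasure D m

/-- `t` is the bounded extension to the (real) one-particle space of the map
`t_h g = h · (Δ ∗ g)` on real Schwartz functions. -/
def IsSqueezingGenerator {D : ℕ} {m : ℝ} (hm : 0 < m) (h : 𝓢(Spacetime D, ℝ))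
    (t : OneParticle D m →L[ℝ] OneParticle D m) : Prop :=
  ∀ g : 𝓢(Spacetime D, ℝ), ∃ k : 𝓢(Spacetime D, ℝ),
    (∀ x, (k x : ℂ) = h x * pauliJordan m g x) ∧ t (oneParticle hm g) = oneParticle hm k

open Classical in
/-- The operator `t_h` on the one-particle space. -/
def squeezingGenerator {D : ℕ} {m : ℝ} (hm : 0 < m) (h : 𝓢(Spacetime D, ℝ)) :
    OneParticle D m →L[ℝ] OneParticle D m :=
  if ht : ∃ t, IsSqueezingGenerator hm h t then ht.choose else 0

/-- `T_h = exp(t_h)`. -/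
def squeezing {D : ℕ} {m : ℝ} (hm : 0 < m) (h : 𝓢(Spacetime D, ℝ)) :
    OneParticle D m →L[ℝ] OneParticle D m :=
  NormedSpace.exp (squeezingGenerator hm h)

/-! ### Symmetric Fock space -/

/-- The `n`-fold product of the one-particle measure. -/
abbrev nMeasure (D : ℕ) (m : ℝ) (n : ℕ) : Measure (Fin n → Momentum D) :=
  Measure.pi fun _ => shellMeasure D m

theorem measurePreserving_perm (D : ℕ) (m : ℝ) (n : ℕ) (σ : Equiv.Perm (Fin n)) :
    MeasurePreserving (fun p : Fin n → Momentum D => p ∘ σ) (nMeasure D m n) (nMeasure D m n) := by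
  have := measurePreserving_piCongrLeft
    (fun _ : Fin n => shellMeasure D m) σ.symm
  convert this using 1
  ext p i
  simp [MeasurableEquiv.piCongrLeft, Equiv.piCongrLeft, Equiv.piCongrLeft']

/-- The bosonic `n`-particle space: the permutation invariant elements of `L²((ℝ^D)^n, μ^n)`. -/
def nParticle (D : ℕ) (m : ℝ) (n : ℕ) : Submodule ℂ (Lp ℂ 2 (nMeasure D m n)) :=
  ⨅ σ : Equiv.Perm (Fin n), LinearMap.eqLocus
    (Lp.compMeasurePreservingₗᵢ ℂ _ (measurePreserving_perm D m n σ)).toLinearMap LinearMap.id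

theorem isClosed_nParticle (D : ℕ) (m : ℝ) (n : ℕ) :
    IsClosed (nParticle D m n : Set (Lp ℂ 2 (nMeasure D m n))) := by
  rw [nParticle, Submodule.coe_iInf]
  refine isClosed_iInter fun σ => ?_
  exact isClosed_eq (Lp.compMeasurePreservingₗᵢ ℂ _
    (measurePreserving_perm D m n σ)).continuous continuous_id

instance (D : ℕ) (m : ℝ) (n : ℕ) : CompleteSpace (nParticle D m n) :=
  (isClosed_nParticle D m n).completeSpace_coe

/-- The symmetric Fock space over the one-particle space. -/
def Fock (D : ℕ) (m : ℝ) : Type := lp (fun n => nParticle D m n) 2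

instance (D : ℕ) (m : ℝ) : NormedAddCommGroup (Fock D m) :=
  inferInstanceAs (NormedAddCommGroup (lp (fun n => nParticle D m n) 2))

instance (D : ℕ) (m : ℝ) : InnerProductSpace ℂ (Fock D m) :=
  inferInstanceAs (InnerProductSpace ℂ (lp (fun n => nParticle D m n) 2))

instance (D : ℕ) (m : ℝ) : CompleteSpace (Fock D m) :=
  inferInstanceAs (CompleteSpace (lp (fun n => nParticle D m n) 2))

/-- The `n`-particle component of a Fock space vector. -/
def component {D : ℕ} {m : ℝ} (ψ : Fock D m) (n : ℕ) : nParticle D m n :=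
  (show lp (fun n => nParticle D m n) 2 from ψ) n

/-- The `n`-particle wave function of a Fock space vector. -/
def wave {D : ℕ} {m : ℝ} (ψ : Fock D m) (n : ℕ) : (Fin n → Momentum D) → ℂ :=
  ((component ψ n : Lp ℂ 2 (nMeasure D m n)) : (Fin n → Momentum D) → ℂ)

instance (D : ℕ) (m : ℝ) : IsFiniteMeasure (nMeasure D m 0) := by
  rw [nMeasure, Measure.pi_of_empty]
  infer_instance

/-- The constant function `1` as a zero-particle vector. -/
def zeroParticleOne (D : ℕ) (m : ℝ) : nParticle D m 0 :=
  ⟨(memLp_const (1 : ℂ)).toLp _, by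
    refine Submodule.mem_iInf _ |>.2 fun σ => ?_
    rfl⟩

/-- The vacuum vector `Ω`. -/
def vacuum (D : ℕ) (m : ℝ) : Fock D m :=
  (lp.single 2 0 (zeroParticleOne D m) : lp (fun n => nParticle D m n) 2)

/-- The finite-particle subspace. -/
def finiteParticle (D : ℕ) (m : ℝ) : Submodule ℂ (Fock D m) where
  carrier := {ψ | ∃ N, ∀ n, N < n → component ψ n = 0}
  zero_mem' := ⟨0, fun _ _ => rfl⟩
  add_mem' := by
    rintro ψ φ ⟨N, hN⟩ ⟨M, hM⟩
    refine ⟨max N M, fun n hn => ?_⟩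
    have h : component (ψ + φ) n = component ψ n + component φ n := rfl
    rw [h, hN n (lt_of_le_of_lt (le_max_left _ _) hn),
      hM n (lt_of_le_of_lt (le_max_right _ _) hn), add_zero]
  smul_mem' := by
    rintro c ψ ⟨N, hN⟩
    refine ⟨N, fun n hn => ?_⟩
    have h : component (c • ψ) n = c • component ψ n := rfl
    rw [h, hN n hn, smul_zero]

/-! ### Field and Wick square -/

/-- `a†(F)ψ`. -/
def creation {D : ℕ} {m : ℝ} (F : OneParticle D m) (ψ : Fock D m) :
    (n : ℕ) → (Fin n → Momentum D) → ℂ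
  | 0, _ => 0
  | n + 1, p => (√(n + 1 : ℝ) : ℂ)⁻¹ * ∑ j : Fin (n + 1), F (p j) * wave ψ n (j.removeNth p)

/-- `a(F)ψ`. -/
def annihilation {D : ℕ} {m : ℝ} (F : OneParticle D m) (ψ : Fock D m)
    (n : ℕ) (p : Fin n → Momentum D) : ℂ :=
  (√(n + 1 : ℝ) : ℂ) * ∫ q, star (F q) * wave ψ (n + 1) (Fin.cons q p) ∂shellMeasure D m

/-- `T` is the field `Φ(F) = a(F) + a†(F)` on finite-particle vectors. -/
def IsField {D : ℕ} {m : ℝ} (F : OneParticle D m)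
    (T : finiteParticle D m →ₗ[ℂ] Fock D m) : Prop :=
  ∀ (ψ : finiteParticle D m) (n : ℕ),
    wave (T ψ) n =ᵐ[nMeasure D m n] fun p => 
      annihilation F (ψ : Fock D m) n p + creation F (ψ : Fock D m) n p

open Classical in
/-- The field operator `Φ(F)`, with domain the finite-particle vectors. -/
def field {D : ℕ} {m : ℝ} (F : OneParticle D m) : Fock D m →ₗ.[ℂ] Fock D m where
  domain := finiteParticle D m
  toFun := if hT : ∃ T, IsField F T then hT.choose else 0

/-- `∬ h̃(p + q) a†(𝐩) a†(𝐪) ψ dμ(𝐩) dμ(𝐪)`, where `p`, `q` are the points of the mass shell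
over `𝐩`, `𝐪`. -/
def pairCreation {D : ℕ} {m : ℝ} (h : Spacetime D → ℝ) (ψ : Fock D m) :
    (n : ℕ) → (Fin n → Momentum D) → ℂ
  | 0, _ => 0
  | 1, _ => 0
  | n + 2, p => (√((n + 1 : ℝ) * (n + 2)) : ℂ)⁻¹ *
      ∑ i : Fin (n + 2), ∑ j : Fin (n + 1),
        fourier h (shell m (p i) + shell m (i.removeNth p j)) *
          wave ψ n (j.removeNth (i.removeNth p))

/-- `∬ h̃(-p - q) a(𝐩) a(𝐪) ψ dμ(𝐩) dμ(𝐪)`. -/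
def pairAnnihilation {D : ℕ} {m : ℝ} (h : Spacetime D → ℝ) (ψ : Fock D m)
    (n : ℕ) (p : Fin n → Momentum D) : ℂ :=
  (√((n + 1 : ℝ) * (n + 2)) : ℂ) *
    ∫ q : Momentum D × Momentum D, fourier h (-shell m q.1 - shell m q.2) *
      wave ψ (n + 2) (Fin.cons q.1 (Fin.cons q.2 p))
      ∂(shellMeasure D m).prod (shellMeasure D m)

/-- `∬ h̃(p - q) a†(𝐩) a(𝐪) ψ dμ(𝐩) dμ(𝐪)`. -/
def scattering {D : ℕ} {m : ℝ} (h : Spacetime D → ℝ) (ψ : Fock D m)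
    (n : ℕ) (p : Fin n → Momentum D) : ℂ :=
  ∑ j : Fin n, ∫ q, fourier h (shell m (p j) - shell m q) *
    wave ψ n (Function.update p j q) ∂shellMeasure D m

/-- `T` is the Wick square on finite-particle vectors,
`:Φ²:(h) = ∬ [h̃(-p-q) a(𝐩)a(𝐪) + 2 h̃(p-q) a†(𝐩)a(𝐪) + h̃(p+q) a†(𝐩)a†(𝐪)] dμ(𝐩)dμ(𝐪)`. -/
def IsWickSquare {D : ℕ} {m : ℝ} (h : Spacetime D → ℝ)
    (T : finiteParticle D m →ₗ[ℂ] Fock D m) : Prop :=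
  ∀ (ψ : finiteParticle D m) (n : ℕ),
    wave (T ψ) n =ᵐ[nMeasure D m n] fun p =>
      pairAnnihilation h (ψ : Fock D m) n p + 2 * scattering h (ψ : Fock D m) n p +
        pairCreation h (ψ : Fock D m) n p

open Classical in
/-- The smeared Wick square `:Φ²:(h)`, with domain the finite-particle vectors. -/
def wickSquare {D : ℕ} (m : ℝ) (h : Spacetime D → ℝ) : Fock D m →ₗ.[ℂ] Fock D m where
  domain := finiteParticle D m
  toFun := if hT : ∃ T, IsWickSquare h T then hT.choose else 0

/-! ### Exponentials of self-adjoint operators -/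

/-- `U` is the strongly continuous one-parameter unitary group `s ↦ e^{isA}`: the vectors on
which `U` is differentiable at `0` are those in the domain of `A`, with derivative `iA`. -/
structure IsUnitaryGroup {E : Type*} [NormedAddCommGroup E] [InnerProductSpace ℂ E]
    [CompleteSpace E] (A : E →ₗ.[ℂ] E) (U : ℝ → E →L[ℂ] E) : Prop where
  unitary : ∀ s, U s ∈ unitary (E →L[ℂ] E)
  add : ∀ s t, U (s + t) = U s * U t
  continuous : ∀ ψ, Continuous fun s => U s ψ
  generator : ∀ ψ φ, (ψ, φ) ∈ A.graph ↔
    Tendsto (fun s : ℝ => (s : ℂ)⁻¹ • (U s ψ - ψ)) (𝓝[≠] 0) (𝓝 (Complex.I • φ))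

open Classical in
/-- `e^{iA}` for a self-adjoint operator `A`: the value at `1` of the one-parameter unitary group
with generator `iA` (and `0`, which is not unitary on a nonzero space, if there is none). -/
def expI {E : Type*} [NormedAddCommGroup E] [InnerProductSpace ℂ E]
    [CompleteSpace E] (A : E →ₗ.[ℂ] E) : E →L[ℂ] E :=
  if hU : ∃ U, IsUnitaryGroup A U then hU.choose 1 else 0

/-- The Weyl operator `W₁(F) = exp(i closure(Φ(F)))`. -/
def weyl {D : ℕ} {m : ℝ} (F : OneParticle D m) : Fock D m →L[ℂ] Fock D m :=
  expI (field F).closure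

/-- `W₂(h) = exp((i/2) closure(:Φ²:(h)))`. -/
def weylTwo {D : ℕ} (m : ℝ) (h : Spacetime D → ℝ) : Fock D m →L[ℂ] Fock D m :=
  expI ((1 / 2 : ℂ) • (wickSquare m h).closure)

/-! ### Weyl algebra, Bogoliubov transformation and states -/

/-- The Weyl operators of the real Schwartz functions. -/
def weylSet {D : ℕ} {m : ℝ} (hm : 0 < m) : Set (Fock D m →L[ℂ] Fock D m) :=
  Set.range fun f : 𝓢(Spacetime D, ℝ) => weyl (oneParticle hm f)

/-- The Weyl algebra, the double commutant of the Weyl operators. -/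
def weylAlgebra {D : ℕ} {m : ℝ} (hm : 0 < m) : StarSubalgebra ℂ (Fock D m →L[ℂ] Fock D m) :=
  StarSubalgebra.centralizer ℂ
    (StarSubalgebra.centralizer ℂ (weylSet (D := D) hm) : Set (Fock D m →L[ℂ] Fock D m))

theorem weyl_mem {D : ℕ} {m : ℝ} (hm : 0 < m) (f : 𝓢(Spacetime D, ℝ)) :
    weyl (oneParticle hm f) ∈ weylAlgebra (D := D) hm := by
  rw [weylAlgebra, StarSubalgebra.mem_centralizer_iff]
  intro g hg
  have hf : weyl (oneParticle hm f) ∈ weylSet hm := ⟨f, rfl⟩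
  have h1 := (StarSubalgebra.mem_centralizer_iff ℂ).1 hg _ hf
  have h2 := (StarSubalgebra.mem_centralizer_iff ℂ).1 (star_mem hg) _ hf
  exact ⟨h1.1.symm, h2.1.symm⟩

/-- The weak operator topology on the Weyl algebra. -/
@[reducible]
def weakTopology {D : ℕ} {m : ℝ} (hm : 0 < m) : TopologicalSpace (weylAlgebra (D := D) hm) :=
  TopologicalSpace.induced (fun a => ContinuousLinearMapWOT.ofCLM (a : Fock D m →L[ℂ] Fock D m))
    inferInstance

/-- `α` is the Bogoliubov transformation `α_{T_h}`: a weakly continuous *-automorphism of the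
Weyl algebra with `α(W₁(f)) = W₁(T_h f)` for all real Schwartz functions `f`. -/
def IsBogoliubov {D : ℕ} {m : ℝ} (hm : 0 < m) (h : 𝓢(Spacetime D, ℝ))
    (α : weylAlgebra (D := D) hm ≃⋆ₐ[ℂ] weylAlgebra (D := D) hm) : Prop :=
  Continuous[weakTopology hm, weakTopology hm] α ∧
    ∀ f : 𝓢(Spacetime D, ℝ),
      (α ⟨weyl (oneParticle hm f), weyl_mem hm f⟩ : Fock D m →L[ℂ] Fock D m) =
        weyl (squeezing hm h (oneParticle hm f))

/-- The functional `a ↦ ⟨ψ, a ψ⟩` on the Weyl algebra. -/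
def vectorState {D : ℕ} {m : ℝ} (hm : 0 < m) (ψ : Fock D m) (a : weylAlgebra (D := D) hm) : ℂ :=
  inner ℂ ψ ((a : Fock D m →L[ℂ] Fock D m) ψ)

/-- The vacuum state `ω`. -/
def vacuumState {D : ℕ} {m : ℝ} (hm : 0 < m) : weylAlgebra (D := D) hm → ℂ :=
  vectorState hm (vacuum D m)

/-- The folium of the vacuum Fock representation: the states `a ↦ tr(ρ a)` given by density
matrices `ρ = ∑ᵢ |ψᵢ⟩⟨ψᵢ|` on Fock space. -/
def vacuumFolium {D : ℕ} {m : ℝ} (hm : 0 < m) : Set (weylAlgebra (D := D) hm → ℂ) :=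
  {φ | ∃ ψ : ℕ → Fock D m, HasSum (fun i => ‖ψ i‖ ^ 2) 1 ∧
    ∀ a, HasSum (fun i => vectorState hm (ψ i) a) (φ a)}

end LocalSqueezing

end

noncomputable section

namespace LocalSqueezing

open Finset.HasAntidiagonal (antidiagonal)
open scoped Nat

/-! ### Double series -/

/-! Write A for half the Wick square on finite-particle vectors. The theorem is the exponentiated
form of the commutator [A, Φ(F)] = i Φ(t_h F): a quadratic A moves the fields by a linear flow.
Formally e^{-iA} Φ(F) e^{iA} = Φ(exp(t_h) F), and exponentiating Φ gives the statement for Weyl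
operators. The analysis makes this rigorous for unbounded operators.

The tool is a form of Nelson's analytic vector theorem with a uniform radius. An operator that
raises the particle number by at most two and has norm O(N) on vectors with at most N particles
satisfies ‖A^k x‖ ≤ C R^k k! with R independent of x (`norm_pow_apply_le`). Hence the series of
e^{isA} converges on the whole domain for |s| < 1/R, is isometric there and obeys a local group law;
repeated halving gives a unitary group for all s (`IsUniformlyAnalytic.group`). Every vector in the
domain of the adjoint is differentiable along this group
(`IsUniformlyAnalytic.generates_of_adjoint`), so closure, adjoint and generator coincide. This gives
self-adjointness and identifies the exponentials.

For covariance, expanding Φ(F) A^n by the commutator turns Φ(F), applied to partial sums of e^{isA}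
x, into a double series for e^{isA} Φ(exp(s t_h) F) x, and the closed field passes to the limit
(`IsUniformlyAnalytic.mem_closure_graph_exp`). A unitary group is determined by the values of its
generator on finite-particle vectors, so the conjugated Weyl operator is known for small s, and n
equal steps reach s = 1 (`IsUniformlyAnalytic.star_group_mul_group_mul_group`).

The operators exist because of the decay of h̃: h̃(p+q) decays in both momenta, since energies add,
and is square integrable, while h̃(p-q) decays only in the difference and is handled by Schur's
test. The commutator, computed sector by sector (`wickEnd_fieldEnd`), gives the real-linear operator
`oneGenerator`, and Fubini shows that it extends g ↦ h · (Δ ∗ g) (`onShell_squeezeSchwartz`). The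
extension is unique because test functions are dense in the one-particle space
(`denseRange_oneParticle`).

Operators commuting with the Weyl operators of test functions commute with all W₁(F)
(`commute_weyl`), so conjugation by W₂(h) and its inverse preserve the Weyl algebra. Von Neumann's
density theorem (`mem_closure_adjoin_wot`) makes the automorphism unique, and the claim on states
only moves W₂(h) across an inner product. -/

theorem hasSum_sum_antidiagonal {E : Type*} [NormedAddCommGroup E] [CompleteSpace E]
    {f : ℕ × ℕ → E} (hf : Summable f) :
    HasSum (fun n => ∑ p ∈ antidiagonal n, f p) (∑' j, ∑' k, f (j, k)) := by
  rw [← hf.tsum_prod]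
  have h := (Finset.HasAntidiagonal.sigmaAntidiagonalEquivProd (A := ℕ)).hasSum_iff.2 hf.hasSum
  refine h.sigma fun n => ?_
  have := hasSum_fintype (fun c : antidiagonal n => f c.1)
  rw [Finset.sum_coe_sort (antidiagonal n) f] at this
  exact this

/-- The binomial theorem in exponential form. It is used with opposite arguments, where only n = 0
survives, and with it and is for the group law. -/
theorem sum_antidiagonal_pow_div_factorial (a b : ℂ) (n : ℕ) :
    ∑ p ∈ antidiagonal n, (a ^ p.1 / (p.1)! * (b ^ p.2 / (p.2)!)) = (a + b) ^ n / n ! := by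
  rw [(Commute.all a b).add_pow', Finset.sum_div]
  refine Finset.sum_congr rfl fun p hp => ?_
  rw [Finset.HasAntidiagonal.mem_antidiagonal] at hp
  have h := Nat.add_choose_mul_factorial_mul_factorial p.1 p.2
  rw [← Nat.choose_symm_add, hp] at h
  have h' : ((n.choose p.1 : ℂ)) * (p.1)! * (p.2)! = n ! := by exact_mod_cast h
  have h1 : ((p.1)! : ℂ) ≠ 0 := by exact_mod_cast Nat.factorial_ne_zero _
  have h2 : ((p.2)! : ℂ) ≠ 0 := by exact_mod_cast Nat.factorial_ne_zero _
  have h3 : (n ! : ℂ) ≠ 0 := by exact_mod_cast Nat.factorial_ne_zero _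
  rw [nsmul_eq_mul]
  field_simp
  rw [← h']; ring

/-- The n-th antidiagonal sums to (a + b)^n. The binomial coefficient is what a bound by (j + k)!
leaves after division by j! k!, so the group law will need a condition on |s| + |t|. -/
theorem summable_choose_mul_pow {a b : ℝ} (ha : 0 ≤ a) (hb : 0 ≤ b) (hab : a + b < 1) :
    Summable fun p : ℕ × ℕ => ((p.1 + p.2).choose p.1 : ℝ) * (a ^ p.1 * b ^ p.2) := by
  rw [← (Finset.HasAntidiagonal.sigmaAntidiagonalEquivProd (A := ℕ)).summable_iff]
  refine (summable_sigma_of_nonneg fun x => ?_).2 ⟨fun n => Summable.of_finite, ?_⟩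
  · simp only [Function.comp]; positivity
  · have : (fun n : ℕ => ∑' y : antidiagonal n,
        (((fun p : ℕ × ℕ => ((p.1 + p.2).choose p.1 : ℝ) * (a ^ p.1 * b ^ p.2)) ∘
          Finset.HasAntidiagonal.sigmaAntidiagonalEquivProd) ⟨n, y⟩)) = fun n => (a + b) ^ n := by
      ext n
      rw [tsum_fintype, (Commute.all a b).add_pow']
      refine (Finset.sum_coe_sort (antidiagonal n)
        (fun p : ℕ × ℕ => ((p.1 + p.2).choose p.1 : ℝ) * (a ^ p.1 * b ^ p.2))).trans ?_
      refine Finset.sum_congr rfl fun p hp => ?_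
      rw [Finset.HasAntidiagonal.mem_antidiagonal] at hp
      rw [hp, nsmul_eq_mul]
    rw [this]
    exact summable_geometric_of_lt_one (by positivity) hab

/-! ### Symmetric operators with uniformly analytic vectors -/

variable {E : Type*} [NormedAddCommGroup E] [InnerProductSpace ℂ E]

/-- The difference quotients of `U` on `ψ` converge to `iχ`. -/
def Generates (U : ℝ → E →L[ℂ] E) (ψ χ : E) : Prop :=
  Tendsto (fun s : ℝ => (s : ℂ)⁻¹ • (U s ψ - ψ)) (𝓝[≠] 0) (𝓝 (Complex.I • χ))

/-- A symmetric operator on a dense domain, all of whose domain vectors are analytic with radius of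
convergence at least `1 / R`. -/
structure IsUniformlyAnalytic {D : Submodule ℂ E} (A : Module.End ℂ D) (R : ℝ) : Prop where
  dense : Dense (D : Set E)
  symm : ∀ x y : D, inner ℂ (A x : E) (y : E) = inner ℂ (x : E) (A y : E)
  pos : 0 < R
  bound : ∀ x : D, ∃ C : ℝ, ∀ k : ℕ, ‖((A ^ k) x : E)‖ ≤ C * R ^ k * k !

/-- An endomorphism of a subspace as a partially defined operator. -/
def endPMap {D : Submodule ℂ E} (A : Module.End ℂ D) : E →ₗ.[ℂ] E where
  domain := D
  toFun := D.subtype ∘ₗ A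

/-- The terms of the exponential series of `isA`. -/
def expTerm {D : Submodule ℂ E} (A : Module.End ℂ D) (s : ℝ) (k : ℕ) (x : D) : E :=
  ((Complex.I * s) ^ k / (k ! : ℂ)) • ((A ^ k) x : E)

namespace IsUniformlyAnalytic

variable {D : Submodule ℂ E} {A : Module.End ℂ D} {R : ℝ}

theorem pow_symm (hA : IsUniformlyAnalytic A R) (k : ℕ) (x y : D) :
    inner ℂ ((A ^ k) x : E) (y : E) = inner ℂ (x : E) ((A ^ k) y : E) := by
  induction k generalizing x y with
  | zero => rfl
  | succ k ih =>
    rw [pow_succ, Module.End.mul_apply, ih, hA.symm, ← Module.End.mul_apply, ← pow_succ',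
      ← pow_succ]

theorem norm_expTerm_le {x : D} {C : ℝ} (hC : ∀ k : ℕ, ‖((A ^ k) x : E)‖ ≤ C * R ^ k * k !) (s : ℝ)
    (k : ℕ) : ‖expTerm A s k x‖ ≤ C * (R * |s|) ^ k := by
  rw [expTerm, norm_smul, norm_div, norm_pow, norm_mul, Complex.norm_I, one_mul, Complex.norm_real,
    Complex.norm_natCast, Real.norm_eq_abs, div_mul_eq_mul_div,
    div_le_iff₀ (by positivity)]
  calc |s| ^ k * ‖((A ^ k) x : E)‖ ≤ |s| ^ k * (C * R ^ k * k !) := by gcongr; exact hC k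
    _ = _ := by rw [mul_pow]; ring

theorem nonneg_of_bound {x : D} {C : ℝ}
    (hC : ∀ k : ℕ, ‖((A ^ k) x : E)‖ ≤ C * R ^ k * k !) : 0 ≤ C := by
  have := hC 0
  simp only [pow_zero, mul_one, Nat.factorial_zero, Nat.cast_one] at this
  exact (norm_nonneg _).trans this

theorem summable_norm_expTerm (hA : IsUniformlyAnalytic A R) {s : ℝ} (hs : R * |s| < 1) (x : D) :
    Summable fun k => ‖expTerm A s k x‖ := by
  obtain ⟨C, hC⟩ := hA.bound x
  have hR := hA.pos
  exact Summable.of_nonneg_of_le (fun _ => norm_nonneg _) (norm_expTerm_le hC s)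
    ((summable_geometric_of_lt_one (by positivity) hs).mul_left C)

theorem ext_of_dense (hD : Dense (D : Set E)) {S T : E →L[ℂ] E} (h : ∀ x : D, S x = T x) :
    S = T := by
  ext x
  exact congrFun (Continuous.ext_on hD S.continuous T.continuous fun x hx => h ⟨x, hx⟩) x

variable [CompleteSpace E]

theorem summable_expTerm (hA : IsUniformlyAnalytic A R) {s : ℝ} (hs : R * |s| < 1) (x : D) :
    Summable fun k => expTerm A s k x :=
  (hA.summable_norm_expTerm hs x).of_norm

/-- Symmetry moves all powers of A to the right-hand vector, so the terms with j + k = n carry the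
coefficient (-is + is)^n / n!, which vanishes unless n = 0. -/
theorem inner_tsum_expTerm (hA : IsUniformlyAnalytic A R) {s : ℝ} (hs : R * |s| < 1) (x y : D) :
    inner ℂ (∑' k, expTerm A s k x) (∑' k, expTerm A s k y) = inner ℂ (x : E) (y : E) := by
  have hx := hA.summable_norm_expTerm hs x
  have hy := hA.summable_norm_expTerm hs y
  have hsum : Summable fun p : ℕ × ℕ => inner ℂ (expTerm A s p.1 x) (expTerm A s p.2 y) := by
    refine Summable.of_norm_bounded (hx.mul_of_nonneg hy (fun _ => norm_nonneg _)
      fun _ => norm_nonneg _) fun p => ?_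
    exact norm_inner_le_norm _ _
  have h1 : inner ℂ (∑' k, expTerm A s k x) (∑' k, expTerm A s k y)
      = ∑' j, ∑' k, inner ℂ (expTerm A s j x) (expTerm A s k y) := by
    have := ((innerSLFlip ℂ (∑' k, expTerm A s k y)).hasSum hx.of_norm.hasSum).tsum_eq
    simp only [innerSLFlip_apply_apply] at this
    rw [← this]
    congr 1; ext j
    exact ((innerSL ℂ (expTerm A s j x)).hasSum hy.of_norm.hasSum).tsum_eq.symm
  rw [h1, ← (hasSum_sum_antidiagonal hsum).tsum_eq]
  have h2 : ∀ n, ∑ p ∈ antidiagonal n, inner ℂ (expTerm A s p.1 x) (expTerm A s p.2 y)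
      = (0 : ℂ) ^ n / n ! * inner ℂ (x : E) ((A ^ n) y : E) := fun n => by
    have : (0 : ℂ) = -(Complex.I * s) + Complex.I * s := by ring
    rw [this, ← sum_antidiagonal_pow_div_factorial, Finset.sum_mul]
    refine Finset.sum_congr rfl fun p hp => ?_
    rw [Finset.HasAntidiagonal.mem_antidiagonal] at hp
    rw [expTerm, expTerm, inner_smul_left, inner_smul_right, hA.pow_symm, ← Module.End.mul_apply,
      ← pow_add, hp, ← mul_assoc]
    congr 2
    simp
  simp_rw [h2]
  rw [tsum_eq_single 0]
  · simp
  · intro n hn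
    simp [hn]

/-- Both sides are the double series with terms (it)^k (is)^j A^(j+k) x / (k! j!), summed by rows
and by antidiagonals. -/
theorem hasSum_add_expTerm (hA : IsUniformlyAnalytic A R) {s t : ℝ} (hst : R * (|s| + |t|) < 1)
    (x : D) :
    ∑' k, ((Complex.I * t) ^ k / (k ! : ℂ)) • ∑' j, expTerm A s j ((A ^ k) x)
      = ∑' n, expTerm A (s + t) n x := by
  obtain ⟨C, hC⟩ := hA.bound x
  have hR := hA.pos
  have hC0 := nonneg_of_bound hC
  let f : ℕ × ℕ → E := fun p =>
    ((Complex.I * t) ^ p.1 / ((p.1) ! : ℂ) * ((Complex.I * s) ^ p.2 / ((p.2) ! : ℂ))) •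
      ((A ^ (p.1 + p.2)) x : E)
  have hf : Summable f := by
    refine Summable.of_norm_bounded ((summable_choose_mul_pow (a := R * |t|) (b := R * |s|)
      (by positivity) (by positivity) (by linarith)).mul_left C) fun p => ?_
    have h1 := hC (p.1 + p.2)
    have h := Nat.add_choose_mul_factorial_mul_factorial p.1 p.2
    rw [← Nat.choose_symm_add] at h
    have h' : (((p.1 + p.2).choose p.1 : ℝ)) * (p.1)! * (p.2)! = (p.1 + p.2)! := by exact_mod_cast h
    simp only [f, norm_smul, norm_mul, norm_div, norm_pow, Complex.norm_I, one_mul,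
      Complex.norm_real, Complex.norm_natCast, Real.norm_eq_abs]
    calc |t| ^ p.1 / (p.1)! * (|s| ^ p.2 / (p.2)!) * ‖((A ^ (p.1 + p.2)) x : E)‖
        ≤ |t| ^ p.1 / (p.1)! * (|s| ^ p.2 / (p.2)!) * (C * R ^ (p.1 + p.2) * (p.1 + p.2)!) := by
          gcongr
      _ = _ := by
        rw [← h', mul_pow, mul_pow, pow_add]
        field_simp
  have h1 := (hasSum_sum_antidiagonal hf).tsum_eq
  have h2 : ∀ n, ∑ p ∈ antidiagonal n, f p = expTerm A (s + t) n x := fun n => by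
    rw [expTerm]
    have : Complex.I * ((s + t : ℝ) : ℂ) = Complex.I * t + Complex.I * s := by push_cast; ring
    rw [this, ← sum_antidiagonal_pow_div_factorial, Finset.sum_smul]
    refine Finset.sum_congr rfl fun p hp => ?_
    rw [Finset.HasAntidiagonal.mem_antidiagonal] at hp
    simp only [f, hp]
  simp_rw [h2] at h1
  rw [h1]
  congr 1; ext k
  rw [← tsum_const_smul'']
  congr 1; ext j
  simp only [f, expTerm, smul_smul, ← Module.End.mul_apply, ← pow_add]
  rw [add_comm k j]

/-- The exponential series as a linear map on the domain. -/
def expLinear (hA : IsUniformlyAnalytic A R) {s : ℝ} (hs : R * |s| < 1) : D →ₗ[ℂ] E where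
  toFun x := ∑' k, expTerm A s k x
  map_add' x y := by
    rw [← (hA.summable_expTerm hs x).tsum_add (hA.summable_expTerm hs y)]
    simp [expTerm]
  map_smul' c x := by
    rw [RingHom.id_apply, ← tsum_const_smul'']
    simp only [expTerm, map_smul, Submodule.coe_smul]
    congr 1; ext k
    rw [smul_comm]

theorem norm_expLinear (hA : IsUniformlyAnalytic A R) {s : ℝ} (hs : R * |s| < 1) (x : D) :
    ‖hA.expLinear hs x‖ = ‖x‖ := by
  have := hA.inner_tsum_expTerm hs x x
  rw [inner_self_eq_norm_sq_to_K, inner_self_eq_norm_sq_to_K] at this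
  have h : ‖∑' k, expTerm A s k x‖ ^ 2 = ‖(x : E)‖ ^ 2 := by exact_mod_cast this
  exact (sq_eq_sq₀ (norm_nonneg _) (norm_nonneg _)).1 h

open Classical in
/-- `e^{isA}` for small `s`, and `0` otherwise. -/
def localExp (hA : IsUniformlyAnalytic A R) (s : ℝ) : E →L[ℂ] E :=
  if hs : R * |s| < 1 then
    ((hA.expLinear hs).mkContinuous 1 fun x => by rw [hA.norm_expLinear, one_mul]).extend D.subtypeL
  else 0

theorem localExp_apply (hA : IsUniformlyAnalytic A R) {s : ℝ} (hs : R * |s| < 1) (x : D) :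
    hA.localExp s x = ∑' k, expTerm A s k x := by
  rw [localExp, dif_pos hs]
  have h := ContinuousLinearMap.extend_eq
    ((hA.expLinear hs).mkContinuous 1 fun x => by rw [hA.norm_expLinear, one_mul])
    (e := D.subtypeL) hA.dense.denseRange_val
    isUniformEmbedding_subtype_val.isUniformInducing x
  exact h

theorem hasSum_localExp (hA : IsUniformlyAnalytic A R) {s : ℝ} (hs : R * |s| < 1) (x : D) :
    HasSum (fun k => expTerm A s k x) (hA.localExp s x) := by
  rw [hA.localExp_apply hs]
  exact (hA.summable_expTerm hs x).hasSum

theorem localExp_zero (hA : IsUniformlyAnalytic A R) : hA.localExp 0 = 1 := by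
  refine ext_of_dense hA.dense fun x => ?_
  rw [hA.localExp_apply (by simp), tsum_eq_single 0]
  · simp [expTerm]
  · intro k hk
    simp [expTerm, hk]

/-- Continuity lets `localExp s` act term by term on the series of `localExp t x`, although the sum
of that series may lie outside the domain. -/
theorem localExp_add (hA : IsUniformlyAnalytic A R) {s t : ℝ} (hst : R * (|s| + |t|) < 1) :
    hA.localExp (s + t) = hA.localExp s * hA.localExp t := by
  have hR := hA.pos
  have hs : R * |s| < 1 := lt_of_le_of_lt (by gcongr; linarith [abs_nonneg t]) hst
  have ht : R * |t| < 1 := lt_of_le_of_lt (by gcongr; linarith [abs_nonneg s]) hst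
  refine ext_of_dense hA.dense fun x => ?_
  rw [hA.localExp_apply (lt_of_le_of_lt (by gcongr; exact abs_add_le s t) hst),
    ← hA.hasSum_add_expTerm hst x, mul_apply_eq_comp,
    ← ((hA.localExp s).hasSum (hA.hasSum_localExp ht x)).tsum_eq]
  congr 1; ext k
  rw [expTerm, map_smul, hA.localExp_apply hs]

theorem inner_localExp (hA : IsUniformlyAnalytic A R) {s : ℝ} (hs : R * |s| < 1) (x y : E) :
    inner ℂ (hA.localExp s x) (hA.localExp s y) = inner ℂ x y := by
  have h1 : ∀ x : D, ∀ y : E, inner ℂ (hA.localExp s x) (hA.localExp s y) = inner ℂ (x : E) y := by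
    intro x y
    refine congrFun (Continuous.ext_on hA.dense
      (f := fun y => inner ℂ (hA.localExp s x) (hA.localExp s y))
      (g := fun y => inner ℂ (x : E) y) (by fun_prop) (by fun_prop) fun y hy => ?_) y
    simp only
    rw [hA.localExp_apply hs x, hA.localExp_apply hs ⟨y, hy⟩, hA.inner_tsum_expTerm hs]
  refine congrFun (Continuous.ext_on hA.dense
    (f := fun x => inner ℂ (hA.localExp s x) (hA.localExp s y))
    (g := fun x => inner ℂ x y) (by fun_prop) (by fun_prop) fun x hx => h1 ⟨x, hx⟩ y) x

/-- An isometry with a right inverse is unitary; the right inverse is `localExp (-s)`. The doubled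
`|s|` in the hypothesis comes from applying the group law to `s` and `-s`. -/
theorem localExp_mem_unitary (hA : IsUniformlyAnalytic A R) {s : ℝ} (hs : R * (|s| + |s|) < 1) :
    hA.localExp s ∈ unitary (E →L[ℂ] E) := by
  have hR := hA.pos
  have hs' : R * |s| < 1 := lt_of_le_of_lt (by gcongr; linarith [abs_nonneg s]) hs
  have h1 : star (hA.localExp s) * hA.localExp s = 1 := by
    ext x
    refine ext_inner_left ℂ fun y => ?_
    rw [mul_apply_eq_comp, ContinuousLinearMap.star_eq_adjoint,
      ContinuousLinearMap.adjoint_inner_right, hA.inner_localExp hs']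
    rfl
  have h2 : hA.localExp s * hA.localExp (-s) = 1 := by
    rw [← hA.localExp_add (by rwa [abs_neg]), add_neg_cancel, hA.localExp_zero]
  refine ⟨h1, ?_⟩
  have : star (hA.localExp s) = hA.localExp (-s) := by
    calc star (hA.localExp s) = star (hA.localExp s) * (hA.localExp s * hA.localExp (-s)) := by
          rw [h2, mul_one]
      _ = _ := by rw [← mul_assoc, h1, one_mul]
  rw [this, h2]

theorem norm_localExp (hA : IsUniformlyAnalytic A R) {s : ℝ} (hs : R * |s| < 1) (x : E) :
    ‖hA.localExp s x‖ = ‖x‖ := by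
  have := hA.inner_localExp hs x x
  rw [inner_self_eq_norm_sq_to_K, inner_self_eq_norm_sq_to_K] at this
  exact (sq_eq_sq₀ (norm_nonneg _) (norm_nonneg _)).1 (by exact_mod_cast this)

theorem norm_localExp_sub_sub_le (hA : IsUniformlyAnalytic A R) (x : D) :
    ∃ C, ∀ s : ℝ, R * |s| ≤ 1 / 2 →
      ‖hA.localExp s x - x - (Complex.I * s) • (A x : E)‖ ≤ C * |s| ^ 2 := by
  obtain ⟨C, hC⟩ := hA.bound x
  have hR := hA.pos
  have hC0 := nonneg_of_bound hC
  -- The tail from k = 2 is dominated by C (R|s|)² times a geometric series of ratio at most 1/2,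
  -- whose sum is at most 2.
  refine ⟨2 * C * R ^ 2, fun s hs => ?_⟩
  have hs1 : R * |s| < 1 := by linarith
  have h := hA.summable_norm_expTerm hs1 x
  have h2 := h.of_norm.sum_add_tsum_nat_add 2
  rw [← hA.localExp_apply hs1] at h2
  have h3 : hA.localExp s x - x - (Complex.I * s) • (A x : E) = ∑' i, expTerm A s (i + 2) x := by
    rw [← h2]
    simp only [Finset.sum_range_succ, Finset.sum_range_zero, expTerm]
    simp
    abel
  have hg := summable_geometric_of_lt_one (r := R * |s|) (by positivity) hs1
  rw [h3]
  refine (tsum_of_norm_bounded (g := fun i => C * (R * |s|) ^ 2 * (R * |s|) ^ i)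
    ((hg.hasSum).mul_left _) fun i => ?_).trans ?_
  · refine (norm_expTerm_le hC s (i + 2)).trans (le_of_eq ?_)
    ring
  · rw [tsum_geometric_of_lt_one (by positivity) hs1]
    have : (1 - R * |s|)⁻¹ ≤ 2 := by
      rw [inv_le_comm₀ (by linarith) (by norm_num)]; linarith
    calc C * (R * |s|) ^ 2 * (1 - R * |s|)⁻¹ ≤ C * (R * |s|) ^ 2 * 2 := by gcongr
      _ = _ := by ring

theorem hasDerivAt_localExp_zero (hA : IsUniformlyAnalytic A R) (x : D) :
    HasDerivAt (fun s => hA.localExp s x) (Complex.I • (A x : E)) 0 := by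
  obtain ⟨C, hC⟩ := hA.norm_localExp_sub_sub_le x
  have hR := hA.pos
  rw [hasDerivAt_iff_isLittleO]
  simp only [hA.localExp_zero, sub_zero]
  refine Asymptotics.IsBigO.trans_isLittleO (g := fun s : ℝ => s ^ 2) ?_ ?_
  · refine Asymptotics.IsBigO.of_bound C ?_
    have h1 : Tendsto (fun s : ℝ => R * |s|) (𝓝 0) (𝓝 (R * |0|)) :=
      (continuous_const.mul continuous_abs).tendsto 0
    rw [abs_zero, mul_zero] at h1
    filter_upwards [h1.eventually (gt_mem_nhds (show (0 : ℝ) < 1 / 2 by norm_num))] with s hs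
    have h2 := hC s hs.le
    rw [norm_pow, Real.norm_eq_abs]
    refine le_trans (le_of_eq ?_) h2
    congr 2
    rw [← Complex.coe_smul (x := s), smul_smul, mul_comm]
  · have := (Asymptotics.isLittleO_pow_pow (𝕜 := ℝ) (m := 1) (n := 2) (by norm_num))
    simpa using this

theorem continuousAt_localExp_zero (hA : IsUniformlyAnalytic A R) (x : E) :
    ContinuousAt (fun s => hA.localExp s x) 0 := by
  have hR := hA.pos
  rw [Metric.continuousAt_iff']
  intro ε hε
  obtain ⟨y, hy, hxy⟩ := hA.dense.exists_dist_lt x (show 0 < ε / 3 by positivity)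
  have h1 := (Metric.continuousAt_iff'.1 (hA.hasDerivAt_localExp_zero ⟨y, hy⟩).continuousAt)
    (ε / 3) (by positivity)
  have h2 : Tendsto (fun s : ℝ => R * |s|) (𝓝 0) (𝓝 (R * |0|)) :=
      (continuous_const.mul continuous_abs).tendsto 0
  rw [abs_zero, mul_zero] at h2
  filter_upwards [h1, h2.eventually (gt_mem_nhds (show (0 : ℝ) < 1 by norm_num))] with s hs hs1
  rw [hA.localExp_zero, one_apply_eq_self] at hs ⊢
  -- Isometry bounds the first distance by that of x to the nearby domain vector, uniformly in s.
  calc dist (hA.localExp s x) x ≤ dist (hA.localExp s x) (hA.localExp s y) +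
        dist (hA.localExp s y) y + dist y x := dist_triangle4 _ _ _ _
    _ < ε / 3 + ε / 3 + ε / 3 := by
        rw [dist_eq_norm (hA.localExp s x), ← map_sub, hA.norm_localExp hs1, ← dist_eq_norm,
          dist_comm y x]
        exact add_lt_add (add_lt_add hxy hs) hxy
    _ = ε := by ring

/-! ### Continuation of the local exponential to the whole line -/

set_option linter.unusedSectionVars false in
/-- The number of halvings that bring `s` into the domain of the local exponential. -/
theorem exists_halving (_ : IsUniformlyAnalytic A R) (s : ℝ) :
    ∃ n : ℕ, ∀ k, n ≤ k → R * (|s / 2 ^ k| + |s / 2 ^ k|) < 1 := by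
  have h : Tendsto (fun k : ℕ => R * (|s / 2 ^ k| + |s / 2 ^ k|)) atTop (𝓝 0) := by
    have h1 : Tendsto (fun k : ℕ => s / 2 ^ k) atTop (𝓝 0) :=
      tendsto_const_nhds.div_atTop (tendsto_pow_atTop_atTop_of_one_lt (by norm_num))
    have := ((h1.abs.add h1.abs).const_mul R)
    simpa using this
  obtain ⟨n, hn⟩ := eventually_atTop.1 (h.eventually (gt_mem_nhds (show (0 : ℝ) < 1 by norm_num)))
  exact ⟨n, hn⟩

/-- The one-parameter unitary group generated by a uniformly analytic symmetric operator. -/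
def group (hA : IsUniformlyAnalytic A R) (s : ℝ) : E →L[ℂ] E :=
  hA.localExp (s / 2 ^ (hA.exists_halving s).choose) ^ 2 ^ (hA.exists_halving s).choose

/-- A further halving replaces the local exponential by the square of its value at half the
argument, as the local group law permits. So the number of halvings chosen in `group` does not
affect its value. -/
theorem localExp_halving (hA : IsUniformlyAnalytic A R) {s : ℝ} (n k : ℕ)
    (hn : R * (|s / 2 ^ n| + |s / 2 ^ n|) < 1) :
    hA.localExp (s / 2 ^ (n + k)) ^ 2 ^ (n + k) = hA.localExp (s / 2 ^ n) ^ 2 ^ n := by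
  have hR := hA.pos
  induction k with
  | zero => rfl
  | succ k ih =>
    have h1 : s / 2 ^ (n + k) = s / 2 ^ (n + (k + 1)) + s / 2 ^ (n + (k + 1)) := by
      field_simp; ring
    rw [← ih, h1, hA.localExp_add, ← pow_two, ← pow_mul, ← pow_succ']
    · rfl
    · refine lt_of_le_of_lt ?_ hn
      have h2 : |s / 2 ^ (n + (k + 1))| ≤ |s / 2 ^ n| := by
        rw [abs_div, abs_div, abs_of_pos (by positivity : (0 : ℝ) < 2 ^ n),
          abs_of_pos (by positivity : (0 : ℝ) < 2 ^ (n + (k + 1)))]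
        exact div_le_div_of_nonneg_left (abs_nonneg s) (by positivity)
          (pow_le_pow_right₀ (by norm_num) (by omega))
      gcongr

theorem group_eq (hA : IsUniformlyAnalytic A R) {s : ℝ} {n : ℕ}
    (hn : (hA.exists_halving s).choose ≤ n) :
    hA.group s = hA.localExp (s / 2 ^ n) ^ 2 ^ n := by
  obtain ⟨k, rfl⟩ := Nat.exists_eq_add_of_le hn
  exact (hA.localExp_halving _ k ((hA.exists_halving s).choose_spec _ le_rfl)).symm

theorem group_of_small (hA : IsUniformlyAnalytic A R) {s : ℝ} (hs : R * (|s| + |s|) < 1) :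
    hA.group s = hA.localExp s := by
  have := hA.localExp_halving (s := s) 0 (hA.exists_halving s).choose (by simpa using hs)
  simp only [zero_add, pow_zero, pow_one, div_one] at this
  exact this

theorem group_add (hA : IsUniformlyAnalytic A R) (s t : ℝ) :
    hA.group (s + t) = hA.group s * hA.group t := by
  have hR := hA.pos
  -- A common number of halvings, fine enough for s, t and s + t.
  set n := max (hA.exists_halving (s + t)).choose
    (max (hA.exists_halving s).choose (hA.exists_halving t).choose) with hn
  have h1 := (hA.exists_halving s).choose_spec n (by simp [hn])
  have h2 := (hA.exists_halving t).choose_spec n (by simp [hn])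
  rw [hA.group_eq (n := n) (by simp [hn]), hA.group_eq (s := s) (n := n) (by simp [hn]),
    hA.group_eq (s := t) (n := n) (by simp [hn]), add_div, hA.localExp_add (by linarith)]
  refine Commute.mul_pow ?_ _
  rw [Commute, SemiconjBy, ← hA.localExp_add (by linarith), ← hA.localExp_add (by linarith),
    add_comm]

theorem group_mem_unitary (hA : IsUniformlyAnalytic A R) (s : ℝ) :
    hA.group s ∈ unitary (E →L[ℂ] E) :=
  pow_mem (hA.localExp_mem_unitary ((hA.exists_halving s).choose_spec _ le_rfl)) _

theorem eventually_small (R : ℝ) : ∀ᶠ s : ℝ in 𝓝 0, R * (|s| + |s|) < 1 := by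
  have h2 : Tendsto (fun s : ℝ => R * (|s| + |s|)) (𝓝 0) (𝓝 (R * (|0| + |0|))) :=
      (continuous_const.mul (continuous_abs.add continuous_abs)).tendsto 0
  rw [abs_zero, add_zero, mul_zero] at h2
  exact h2.eventually (gt_mem_nhds (show (0 : ℝ) < 1 by norm_num))

theorem group_zero (hA : IsUniformlyAnalytic A R) : hA.group 0 = 1 := by
  rw [hA.group_of_small (by simp), hA.localExp_zero]

theorem continuous_group (hA : IsUniformlyAnalytic A R) (x : E) :
    Continuous fun s => hA.group s x := by
  rw [continuous_iff_continuousAt]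
  intro s
  have h0 : ContinuousAt (fun s => hA.group s x) 0 := by
    refine (hA.continuousAt_localExp_zero x).congr ?_
    filter_upwards [eventually_small R] with s hs
    rw [hA.group_of_small hs]
  -- Continuity is transported from 0 by U_t = U_s U_(t-s).
  have h1 : (fun t => hA.group t x) = fun t => hA.group s (hA.group (t - s) x) := by
    ext t
    rw [← mul_apply_eq_comp, ← hA.group_add]
    congr 2; ring
  rw [h1]
  refine (hA.group s).continuous.continuousAt.comp ?_
  refine ContinuousAt.comp (f := fun t => t - s) (g := fun s => hA.group s x) ?_ (by fun_prop)
  simpa using h0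

theorem hasDerivAt_group (hA : IsUniformlyAnalytic A R) (x : D) (s : ℝ) :
    HasDerivAt (fun s => hA.group s x) (Complex.I • hA.group s (A x)) s := by
  have h0 : HasDerivAt (fun s => hA.group s x) (Complex.I • (A x : E)) 0 := by
    refine (hA.hasDerivAt_localExp_zero x).congr_of_eventuallyEq ?_
    filter_upwards [eventually_small R] with s hs
    rw [hA.group_of_small hs]
  have h1 : (fun t => hA.group t x) = fun t => hA.group s (hA.group (t - s) x) := by
    ext t
    rw [← mul_apply_eq_comp, ← hA.group_add]
    congr 2; ring
  rw [h1, ← map_smul]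
  have h2 : HasDerivAt (fun t => hA.group (t - s) x) (Complex.I • (A x : E)) s := by
    have h0' : HasDerivAt (fun s => hA.group s x) (Complex.I • (A x : E)) (s - s) := by
      simpa using h0
    simpa using h0'.comp_sub_const s s
  exact ((hA.group s).restrictScalars ℝ).hasFDerivAt.comp_hasDerivAt s h2

end IsUniformlyAnalytic

/-! ### Generators of unitary groups -/

section Generator

variable {U V : ℝ → E →L[ℂ] E} {ψ ψ' χ χ' : E}

theorem generates_iff_hasDerivAt (h0 : U 0 = 1) :
    Generates U ψ χ ↔ HasDerivAt (fun s => U s ψ) (Complex.I • χ) 0 := by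
  rw [hasDerivAt_iff_tendsto_slope_zero, Generates]
  simp only [zero_add, h0, one_apply_eq_self]
  refine tendsto_congr fun s => ?_
  rw [← Complex.coe_smul (x := s⁻¹), Complex.ofReal_inv]

theorem Generates.hasDerivAt (h0 : U 0 = 1) (hadd : ∀ s t, U (s + t) = U s * U t)
    (h : Generates U ψ χ) (s : ℝ) :
    HasDerivAt (fun s => U s ψ) (Complex.I • U s χ) s := by
  rw [generates_iff_hasDerivAt h0] at h
  have h1 : (fun t => U t ψ) = fun t => U s (U (t - s) ψ) := by
    ext t
    rw [← mul_apply_eq_comp, ← hadd]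
    congr 2; ring
  rw [h1, ← map_smul]
  have h2 : HasDerivAt (fun t => U (t - s) ψ) (Complex.I • χ) s := by
    have h0' : HasDerivAt (fun s => U s ψ) (Complex.I • χ) (s - s) := by simpa using h
    simpa using h0'.comp_sub_const s s
  exact ((U s).restrictScalars ℝ).hasFDerivAt.comp_hasDerivAt s h2

theorem Generates.apply (hadd : ∀ s t, U (s + t) = U s * U t) (h : Generates U ψ χ) (s : ℝ) :
    Generates U (U s ψ) (U s χ) := by
  have := ((U s).continuous.tendsto _).comp h
  rw [map_smul] at this
  refine this.congr fun t => ?_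
  simp only [Function.comp, map_smul, map_sub]
  rw [← mul_apply_eq_comp, ← hadd, add_comm, hadd, mul_apply_eq_comp]

variable [CompleteSpace E]

theorem inner_apply_of_mem_unitary {W : E →L[ℂ] E} (hW : W ∈ unitary (E →L[ℂ] E)) (x y : E) :
    inner ℂ (W x) (W y) = inner ℂ x y := by
  rw [← ContinuousLinearMap.adjoint_inner_right, ← ContinuousLinearMap.star_eq_adjoint,
    ← mul_apply_eq_comp, Unitary.star_mul_self_of_mem hW, one_apply_eq_self]

theorem map_zero_of_unitary (hu : ∀ s, U s ∈ unitary (E →L[ℂ] E))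
    (hadd : ∀ s t, U (s + t) = U s * U t) : U 0 = 1 := by
  have h := hadd 0 0
  rw [add_zero] at h
  calc U 0 = star (U 0) * U 0 * U 0 := by rw [Unitary.star_mul_self_of_mem (hu 0), one_mul]
    _ = 1 := by rw [mul_assoc, ← h, Unitary.star_mul_self_of_mem (hu 0)]

theorem map_neg_of_unitary (hu : ∀ s, U s ∈ unitary (E →L[ℂ] E))
    (hadd : ∀ s t, U (s + t) = U s * U t) (s : ℝ) : U (-s) = star (U s) := by
  have h : U s * U (-s) = 1 := by rw [← hadd, add_neg_cancel, map_zero_of_unitary hu hadd]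
  calc U (-s) = star (U s) * U s * U (-s) := by
        rw [Unitary.star_mul_self_of_mem (hu s), one_mul]
    _ = _ := by rw [mul_assoc, h, mul_one]

/-- The inner product ⟨U_s ψ, U_s ψ'⟩ is constant in s; the claim is the vanishing of its derivative
at 0. -/
theorem Generates.symm (hu : ∀ s, U s ∈ unitary (E →L[ℂ] E))
    (hadd : ∀ s t, U (s + t) = U s * U t) (h : Generates U ψ χ) (h' : Generates U ψ' χ') :
    inner ℂ χ ψ' = inner ℂ ψ χ' := by
  have h0 := map_zero_of_unitary hu hadd
  rw [generates_iff_hasDerivAt h0] at h h'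
  have h1 := HasDerivAt.inner ℂ h h'
  simp only [inner_apply_of_mem_unitary (hu _), h0, one_apply_eq_self] at h1
  have h2 := h1.unique (hasDerivAt_const _ _)
  rw [inner_smul_right, inner_smul_left, Complex.conj_I, neg_mul, ← sub_eq_add_neg, ← mul_sub,
    mul_eq_zero, sub_eq_zero] at h2
  exact (h2.resolve_left Complex.I_ne_zero).symm

/-- A unitary group whose generator extends that of another one, densely defined, equals it. -/
theorem eq_of_generates (hu : ∀ s, U s ∈ unitary (E →L[ℂ] E))
    (haddu : ∀ s t, U (s + t) = U s * U t) (hv : ∀ s, V s ∈ unitary (E →L[ℂ] E))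
    (haddv : ∀ s t, V (s + t) = V s * V t) (hle : ∀ ψ χ, Generates V ψ χ → Generates U ψ χ)
    (hd : Dense {ψ | ∃ χ, Generates V ψ χ}) (s : ℝ) : U s = V s := by
  have hu0 := map_zero_of_unitary hu haddu
  have hv0 := map_zero_of_unitary hv haddv
  have h1 : ∀ ψ χ ψ' χ', Generates V ψ χ → Generates V ψ' χ' →
      inner ℂ (U s ψ) (V s ψ') = inner ℂ ψ ψ' := by
    intro ψ χ ψ' χ' h h'
    -- The two contributions cancel because both vectors lie in the domain of the larger generator,
    -- which is symmetric.
    have hder : ∀ t : ℝ, HasDerivAt (fun t => inner ℂ (U t ψ) (V t ψ')) 0 t := fun t => by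
      have h2 := HasDerivAt.inner ℂ ((hle _ _ h).hasDerivAt hu0 haddu t) (h'.hasDerivAt hv0 haddv t)
      have h3 := ((hle _ _ h).apply haddu t).symm hu haddu (hle _ _ (h'.apply haddv t))
      have h5 : inner ℂ (U t ψ) (Complex.I • V t χ') + inner ℂ (Complex.I • U t χ) (V t ψ') = 0 := by
        rw [inner_smul_left, inner_smul_right, h3, Complex.conj_I]
        ring
      rwa [h5] at h2
    have h4 := is_const_of_deriv_eq_zero (fun t => (hder t).differentiableAt)
      (fun t => (hder t).deriv) s 0
    simpa [hu0, hv0] using h4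
  have h2 : ∀ ψ χ, Generates V ψ χ → ∀ ψ', inner ℂ (U s ψ) (V s ψ') = inner ℂ ψ ψ' := by
    intro ψ χ h ψ'
    refine congrFun (Continuous.ext_on hd
      (f := fun ψ' => inner ℂ (U s ψ) (V s ψ')) (g := fun ψ' => inner ℂ ψ ψ')
      (by fun_prop) (by fun_prop) ?_) ψ'
    rintro ψ' ⟨χ', h'⟩
    exact h1 ψ χ ψ' χ' h h'
  have h3 : ∀ ψ, U s ψ = V s ψ := by
    intro ψ
    refine congrFun (Continuous.ext_on hd (U s).continuous (V s).continuous ?_) ψ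
    rintro ψ ⟨χ, h⟩
    refine ext_inner_right ℂ fun y => ?_
    -- The choice ψ' = V_s* y turns the identity into one tested against an arbitrary y.
    have h4 := h2 ψ χ h (star (V s) y)
    rw [← mul_apply_eq_comp (V s), Unitary.mul_star_self_of_mem (hv s), one_apply_eq_self] at h4
    rw [h4, ContinuousLinearMap.star_eq_adjoint, ContinuousLinearMap.adjoint_inner_right]
  ext ψ
  exact h3 ψ

end Generator

/-! ### Generator, adjoint and closure coincide -/

namespace IsUniformlyAnalytic

variable {D : Submodule ℂ E} {A : Module.End ℂ D} {R : ℝ} [CompleteSpace E]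

theorem generates_group (hA : IsUniformlyAnalytic A R) (x : D) :
    Generates hA.group x (A x) := by
  rw [generates_iff_hasDerivAt hA.group_zero]
  simpa [hA.group_zero] using hA.hasDerivAt_group x 0

/-- Termwise on the exponential series: A^k (A x) = A (A^k x), and the hypothesis moves the outer A
to ψ. Convergence of the series is why s must be small. -/
theorem inner_group_of_adjoint (hA : IsUniformlyAnalytic A R) {ψ χ : E}
    (h : ∀ x : D, inner ℂ ψ (A x : E) = inner ℂ χ (x : E)) {s : ℝ} (hs : R * (|s| + |s|) < 1)
    (x : D) : inner ℂ ψ (hA.group s (A x)) = inner ℂ χ (hA.group s x) := by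
  have hR := hA.pos
  have hs' : R * |s| < 1 := lt_of_le_of_lt (by gcongr; linarith [abs_nonneg s]) hs
  rw [hA.group_of_small hs, hA.localExp_apply hs', hA.localExp_apply hs',
    ← innerSL_apply_apply, ← innerSL_apply_apply,
    ← ((innerSL ℂ ψ).hasSum (hA.summable_expTerm hs' (A x)).hasSum).tsum_eq,
    ← ((innerSL ℂ χ).hasSum (hA.summable_expTerm hs' x).hasSum).tsum_eq]
  congr 1; ext k
  simp only [innerSL_apply_apply, expTerm, inner_smul_right]
  rw [← h, ← Module.End.mul_apply, ← pow_succ, ← Module.End.mul_apply, ← pow_succ']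

/-- The heart of essential self-adjointness: pairs in the graph of the adjoint are differentiable
along the group. Tested against a domain vector x, the remainder of U_r ψ has derivative -i⟨U_r χ -
χ, x⟩, at most ε‖x‖ near 0 by strong continuity. The mean value inequality and density of the domain
then bound the norm of the remainder. -/
theorem generates_of_adjoint (hA : IsUniformlyAnalytic A R) {ψ χ : E}
    (h : ∀ x : D, inner ℂ ψ (A x : E) = inner ℂ χ (x : E)) : Generates hA.group ψ χ := by
  have hR := hA.pos
  rw [generates_iff_hasDerivAt hA.group_zero, hasDerivAt_iff_isLittleO,
    Asymptotics.isLittleO_iff]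
  intro ε hε
  have hc := Metric.continuousAt_iff'.1 ((hA.continuous_group χ).continuousAt (x := 0)) ε hε
  obtain ⟨δ, hδ, hball⟩ := Metric.eventually_nhds_iff_ball.1 (hc.and (eventually_small R))
  filter_upwards [Metric.ball_mem_nhds _ hδ] with s hs
  simp only [sub_zero, hA.group_zero, one_apply_eq_self]
  have key : ∀ x : D, ‖inner ℂ (hA.group s ψ - ψ - s • Complex.I • χ) (x : E)‖ ≤
      ε * |s| * ‖(x : E)‖ := by
    intro x
    -- With the group moved to x the function is differentiable, although nothing is known yet about
    -- U_r ψ.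
    let w : ℝ → ℂ := fun r => inner ℂ ψ (hA.group (-r) x) + Complex.I * r * inner ℂ χ (x : E)
    have hw : ∀ r, w r = inner ℂ (hA.group r ψ - r • Complex.I • χ) (x : E) := fun r => by
      simp only [w]
      rw [map_neg_of_unitary hA.group_mem_unitary hA.group_add, inner_sub_left,
        ContinuousLinearMap.star_eq_adjoint, ContinuousLinearMap.adjoint_inner_right,
        ← Complex.coe_smul, smul_smul, inner_smul_left, map_mul, Complex.conj_I,
        Complex.conj_ofReal]
      ring
    have hd : ∀ r ∈ Metric.ball (0 : ℝ) δ, HasDerivWithinAt w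
        (-(Complex.I * inner ℂ (hA.group r χ - χ) (x : E))) (Metric.ball 0 δ) r := fun r hr => by
      refine HasDerivAt.hasDerivWithinAt ?_
      have hr2 : R * (|-r| + |-r|) < 1 := by rw [abs_neg]; exact (hball r hr).2
      have h1 := (hA.hasDerivAt_group x (-r)).scomp r (hasDerivAt_neg r)
      have h2 := ((innerSL ℂ ψ).restrictScalars ℝ).hasFDerivAt.comp_hasDerivAt r h1
      have h3 := (((hasDerivAt_id r).ofReal_comp.const_mul Complex.I).mul_const
        (inner ℂ χ (x : E)))
      refine (h2.add h3).congr_deriv ?_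
      change inner ℂ ψ ((-1 : ℝ) • Complex.I • hA.group (-r) (A x)) + _ = _
      rw [neg_smul, one_smul, inner_neg_right, inner_smul_right, hA.inner_group_of_adjoint h hr2,
        inner_sub_left, map_neg_of_unitary hA.group_mem_unitary hA.group_add,
        ContinuousLinearMap.star_eq_adjoint, ContinuousLinearMap.adjoint_inner_right,
        Complex.ofReal_one]
      ring
    have hb : ∀ r ∈ Metric.ball (0 : ℝ) δ,
        ‖-(Complex.I * inner ℂ (hA.group r χ - χ) (x : E))‖ ≤ ε * ‖(x : E)‖ := fun r hr => by
      rw [norm_neg, norm_mul, Complex.norm_I, one_mul]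
      refine (norm_inner_le_norm _ _).trans ?_
      gcongr
      have := (hball r hr).1
      rw [hA.group_zero, one_apply_eq_self, dist_eq_norm] at this
      exact this.le
    have h5 := (convex_ball (0 : ℝ) δ).norm_image_sub_le_of_norm_hasDerivWithin_le hd hb
      (Metric.mem_ball_self hδ) hs
    rw [hw, hw, ← inner_sub_left] at h5
    simp only [hA.group_zero, one_apply_eq_self, zero_smul, sub_zero, Real.norm_eq_abs] at h5
    calc _ = _ := by congr 2; abel
      _ ≤ _ := h5
      _ = _ := by ring
  have key2 : ∀ y : E, ‖inner ℂ (hA.group s ψ - ψ - s • Complex.I • χ) y‖ ≤ ε * |s| * ‖y‖ := by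
    intro y
    have hcl : IsClosed {y : E | ‖inner ℂ (hA.group s ψ - ψ - s • Complex.I • χ) y‖ ≤
        ε * |s| * ‖y‖} := isClosed_le (by fun_prop) (by fun_prop)
    exact hcl.closure_subset_iff.2 (fun x hx => key ⟨x, hx⟩) (hA.dense y)
  -- Pairing the remainder with itself yields its norm.
  have key3 := key2 (hA.group s ψ - ψ - s • Complex.I • χ)
  rw [← inner_self_re_eq_norm, ← norm_sq_eq_re_inner, pow_two] at key3
  rcases (norm_nonneg (hA.group s ψ - ψ - s • Complex.I • χ)).eq_or_lt with h6 | h6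
  · rw [← h6]; positivity
  · rw [Real.norm_eq_abs]; exact le_of_mul_le_mul_right key3 h6

theorem mem_adjoint_graph_iff (hA : IsUniformlyAnalytic A R) (ψ χ : E) :
    (ψ, χ) ∈ (endPMap A).adjoint.graph ↔ Generates hA.group ψ χ := by
  rw [LinearPMap.adjoint_graph_eq_graph_adjoint (T := endPMap A) hA.dense,
    Submodule.mem_adjoint_iff]
  constructor
  · intro h
    refine hA.generates_of_adjoint fun x => ?_
    have := h x (A x) (LinearPMap.mem_graph (endPMap A) x)
    rw [sub_eq_zero] at this
    rw [← inner_conj_symm, this, inner_conj_symm]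
  · intro h a b hab
    obtain ⟨y, rfl, rfl⟩ := (LinearPMap.mem_graph_iff _).1 hab
    rw [sub_eq_zero]
    exact (hA.generates_group y).symm hA.group_mem_unitary hA.group_add h

theorem isClosable (hA : IsUniformlyAnalytic A R) : (endPMap A).IsClosable := by
  refine LinearPMap.isClosable_iff_exists_closed_extension.2
    ⟨(endPMap A).adjoint, LinearPMap.adjoint_isClosed (T := endPMap A) hA.dense, ?_⟩
  exact LinearPMap.IsFormalAdjoint.le_adjoint (T := endPMap A) hA.dense
    fun x y => hA.symm x y

/-- That the closure is no smaller than the generator follows from double orthogonality. If (a, b)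
is orthogonal to the graph of A, then (b, -a) lies in the graph of the adjoint, hence in the
generator, whose symmetry makes (a, b) orthogonal to every pair of the generator. -/
theorem mem_closure_graph_iff (hA : IsUniformlyAnalytic A R) (ψ χ : E) :
    (ψ, χ) ∈ (endPMap A).closure.graph ↔ Generates hA.group ψ χ := by
  constructor
  · intro h
    rw [← hA.mem_adjoint_graph_iff]
    have h1 := LinearPMap.IsFormalAdjoint.le_adjoint (T := endPMap A) (S := endPMap A) hA.dense
      fun x y => hA.symm x y
    have hcl := LinearPMap.adjoint_isClosed (T := endPMap A) hA.dense
    rw [← hA.isClosable.graph_closure_eq_closure_graph] at h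
    exact (endPMap A).graph.topologicalClosure_minimal (LinearPMap.le_graph_of_le h1) hcl h
  · intro h
    rw [← hA.isClosable.graph_closure_eq_closure_graph]
    -- The product carries its Hilbert norm here, so that the closure is the double orthogonal
    -- complement.
    let G : Submodule ℂ (WithLp 2 (E × E)) :=
      (endPMap A).graph.map (WithLp.linearEquiv 2 ℂ (E × E)).symm.toLinearMap
    have hmem : WithLp.toLp 2 (ψ, χ) ∈ Gᗮᗮ := by
      rw [Submodule.mem_orthogonal]
      intro z hz
      rw [Submodule.mem_orthogonal] at hz
      have h1 : Generates hA.group z.snd (-z.fst) := by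
        refine hA.generates_of_adjoint fun x => ?_
        have h2 := hz (WithLp.toLp 2 ((x : E), (A x : E)))
          ⟨_, LinearPMap.mem_graph (endPMap A) x, rfl⟩
        rw [WithLp.prod_inner_apply] at h2
        change inner ℂ (x : E) z.fst + inner ℂ (A x : E) z.snd = 0 at h2
        rw [inner_neg_left, ← inner_conj_symm, ← inner_conj_symm z.fst, ← add_eq_zero_iff_eq_neg,
          ← map_add, add_comm, h2, map_zero]
      have h3 := h1.symm hA.group_mem_unitary hA.group_add h
      rw [WithLp.prod_inner_apply]
      simp only
      rw [inner_neg_left] at h3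
      change inner ℂ z.fst ψ + inner ℂ z.snd χ = 0
      rw [← h3]; ring
    rw [Submodule.orthogonal_orthogonal_eq_closure] at hmem
    have hmem' : WithLp.toLp 2 (ψ, χ) ∈ closure (G : Set (WithLp 2 (E × E))) := hmem
    have h4 := map_mem_closure (f := WithLp.ofLp) (WithLp.prod_continuous_ofLp 2 E E) hmem'
      (t := ((endPMap A).graph : Set (E × E))) (by
        rintro z ⟨y, hy, rfl⟩
        exact hy)
    exact h4

/-- The closure and the adjoint of A both have the generator as their graph, and the adjoint of the
closure is contained in the adjoint of A. -/
theorem isSelfAdjoint_closure (hA : IsUniformlyAnalytic A R) :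
    IsSelfAdjoint (endPMap A).closure := by
  rw [LinearPMap.isSelfAdjoint_def]
  have hd : Dense ((endPMap A).closure.domain : Set E) :=
    hA.dense.mono (LinearPMap.le_closure (endPMap A)).1
  apply LinearPMap.eq_of_eq_graph
  rw [LinearPMap.adjoint_graph_eq_graph_adjoint hd]
  ext ⟨ψ, χ⟩
  rw [Submodule.mem_adjoint_iff]
  constructor
  · intro h
    rw [hA.mem_closure_graph_iff, ← hA.mem_adjoint_graph_iff,
      LinearPMap.adjoint_graph_eq_graph_adjoint (T := endPMap A) hA.dense,
      Submodule.mem_adjoint_iff]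
    exact fun a b hab => h a b (LinearPMap.le_graph_of_le (LinearPMap.le_closure _) hab)
  · intro h a b hab
    rw [hA.mem_closure_graph_iff] at h hab
    rw [sub_eq_zero]
    exact hab.symm hA.group_mem_unitary hA.group_add h

theorem isUnitaryGroup (hA : IsUniformlyAnalytic A R) :
    IsUnitaryGroup (endPMap A).closure hA.group where
  unitary := hA.group_mem_unitary
  add := hA.group_add
  continuous := hA.continuous_group
  generator := hA.mem_closure_graph_iff

end IsUniformlyAnalytic

end LocalSqueezing
end

noncomputable section

namespace LocalSqueezing

/-! ### The double commutant theorem -/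

section Bicommutant

variable {E : Type*} [NormedAddCommGroup E] [InnerProductSpace ℂ E] [CompleteSpace E]

/-- Von Neumann's argument on finitely many copies of E. The closure Z of the vectors (b v_i)_i,
with b in the generated *-algebra, is invariant under that algebra; so its projection P commutes
with the diagonal action, and the matrix entries of P lie in the commutant of S. Then a commutes
with these entries, its diagonal action preserves Z, and it maps v into Z. -/
theorem exists_adjoin_approx (S : Set (E →L[ℂ] E)) {a : E →L[ℂ] E}
    (ha : a ∈ StarSubalgebra.centralizer ℂ (StarSubalgebra.centralizer ℂ S : Set (E →L[ℂ] E)))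
    {ι : Type*} [Fintype ι] (v : ι → E) {ε : ℝ} (hε : 0 < ε) :
    ∃ b ∈ StarAlgebra.adjoin ℂ S, ∀ i, ‖b (v i) - a (v i)‖ < ε := by
  classical
  let diag : (E →L[ℂ] E) →ₗ[ℂ] ((PiLp 2 fun _ : ι => E) →ₗ[ℂ] (PiLp 2 fun _ : ι => E)) :=
    { toFun := fun b =>
        { toFun := fun x => WithLp.toLp 2 fun i => b (x i)
          map_add' := fun x y => by ext i; simp
          map_smul' := fun c x => by ext i; simp }
      map_add' := fun b c => by ext; simp
      map_smul' := fun r b => by ext; simp }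
  have hdiag : ∀ b (x : (PiLp 2 fun _ : ι => E)) i, diag b x i = b (x i) := fun b x i => rfl
  have hcont : ∀ b, Continuous (diag b) := fun b => by
    refine (PiLp.continuous_toLp 2 _).comp (continuous_pi fun i => ?_)
    exact b.continuous.comp (PiLp.continuous_apply 2 _ i)
  have hadj : ∀ b (x y : (PiLp 2 fun _ : ι => E)), inner ℂ (diag b x) y = inner ℂ x (diag (star b) y) := fun b x y => by
    simp only [PiLp.inner_apply, hdiag, ContinuousLinearMap.star_eq_adjoint,
      ContinuousLinearMap.adjoint_inner_right]
  let N := StarAlgebra.adjoin ℂ S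
  let Z₀ : Submodule ℂ (PiLp 2 fun _ : ι => E) := (N.toSubalgebra.toSubmodule).map
    ((LinearMap.applyₗ (WithLp.toLp 2 v : (PiLp 2 fun _ : ι => E))).comp diag)
  let Z := Z₀.topologicalClosure
  have hZ : IsClosed (Z : Set (PiLp 2 fun _ : ι => E)) := Z₀.isClosed_topologicalClosure
  have : CompleteSpace Z := hZ.completeSpace_coe
  have hinv : ∀ b ∈ N, ∀ z ∈ Z, diag b z ∈ Z := fun b hb z hz => by
    refine map_mem_closure (hcont b) hz ?_
    rintro _ ⟨c, hc, rfl⟩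
    exact ⟨b * c, mul_mem (S := StarSubalgebra ℂ (E →L[ℂ] E)) (s := N) hb hc, rfl⟩
  let P := Z.starProjection
  -- Invariance of Z under both b and b* makes b P x the orthogonal projection of b x.
  have hcomm : ∀ b ∈ N, ∀ x, P (diag b x) = diag b (P x) := fun b hb x => by
    refine Submodule.eq_starProjection_of_mem_orthogonal (hinv b hb _ (Z.starProjection_apply_mem x))
      ?_ |>.symm ▸ rfl
    rw [← map_sub, Submodule.mem_orthogonal]
    intro z hz
    have h1 := hadj (star b) z (x - P x)
    rw [star_star] at h1
    rw [← h1]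
    exact (Submodule.mem_orthogonal _ _).1 (Z.sub_starProjection_mem_orthogonal x) _
      (hinv _ (star_mem hb) z hz)
  let e : ι → E →L[ℂ] (PiLp 2 fun _ : ι => E) := fun j =>
    (PiLp.continuousLinearEquiv 2 ℂ (fun _ : ι => E)).symm.toContinuousLinearMap ∘L
      ContinuousLinearMap.single ℂ (fun _ : ι => E) j
  have he : ∀ j x i, e j x i = if i = j then x else 0 := fun j x i => by
    simp only [e]
    change (Pi.single j x : ι → E) i = _
    rw [Pi.single_apply]
  have hsum : ∀ x : (PiLp 2 fun _ : ι => E), x = ∑ j, e j (x j) := fun x => by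
    ext i
    rw [WithLp.ofLp_sum, Finset.sum_apply]
    simp [he]
  have hde : ∀ b j x, diag b (e j x) = e j (b x) := fun b j x => by
    ext i
    rw [hdiag, he, he]
    split_ifs <;> simp
  let entry : ι → ι → E →L[ℂ] E := fun i j => (PiLp.proj 2 (fun _ : ι => E) i) ∘L P ∘L e j
  have hentry : ∀ i j, entry i j ∈ StarSubalgebra.centralizer ℂ S := fun i j => by
    rw [StarSubalgebra.mem_centralizer_iff]
    have : ∀ b ∈ N, b * entry i j = entry i j * b := fun b hb => by
      ext x
      change b (P (e j x) i) = P (e j (b x)) i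
      rw [← hde, hcomm b hb, hdiag]
    exact fun g hg => ⟨this g (StarAlgebra.subset_adjoin ℂ S hg),
      this _ (star_mem (StarAlgebra.subset_adjoin ℂ S hg))⟩
  have hPa : ∀ x, P (diag a x) = diag a (P x) := fun x => by
    ext i
    rw [hdiag, hsum x, map_sum, map_sum, map_sum, WithLp.ofLp_sum, Finset.sum_apply,
      WithLp.ofLp_sum, Finset.sum_apply, map_sum]
    refine Finset.sum_congr rfl fun j _ => ?_
    have h1 := ((StarSubalgebra.mem_centralizer_iff ℂ).1 ha _ (hentry i j)).1
    have h2 := congrArg (fun T : E →L[ℂ] E => T (x j)) h1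
    rw [hde]
    exact h2
  -- The vector v itself lies in Z because the algebra is unital.
  have hv : (WithLp.toLp 2 v : (PiLp 2 fun _ : ι => E)) ∈ Z := by
    refine Z₀.le_topologicalClosure ⟨1, one_mem N, ?_⟩
    ext i
    rfl
  have hav : diag a (WithLp.toLp 2 v) ∈ Z := by
    have h1 : P (WithLp.toLp 2 v) = WithLp.toLp 2 v := Submodule.starProjection_eq_self_iff.2 hv
    rw [← h1, ← hPa]
    exact Z.starProjection_apply_mem _
  obtain ⟨z, ⟨b, hb, rfl⟩, hz⟩ := Metric.mem_closure_iff.1 hav ε hε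
  refine ⟨b, hb, fun i => ?_⟩
  rw [dist_comm, dist_eq_norm] at hz
  exact (PiLp.norm_apply_le (_ : (PiLp 2 fun _ : ι => E)) i).trans_lt hz

/-- A weak neighbourhood tests finitely many vectors against finitely many functionals, so strong
approximation on these vectors suffices. -/
theorem mem_closure_adjoin_wot (S : Set (E →L[ℂ] E)) {a : E →L[ℂ] E}
    (ha : a ∈ StarSubalgebra.centralizer ℂ (StarSubalgebra.centralizer ℂ S : Set (E →L[ℂ] E))) :
    (ContinuousLinearMapWOT.ofCLM a : E →WOT[ℂ] E) ∈
      closure (ContinuousLinearMapWOT.ofCLM '' (StarAlgebra.adjoin ℂ S : Set (E →L[ℂ] E))) := by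
  rw [mem_closure_iff_nhds]
  intro U hU
  obtain ⟨s, r, hr, hsub⟩ :=
    ((ContinuousLinearMapWOT.withSeminorms (σ := RingHom.id ℂ) (E := E) (F := E)).mem_nhds_iff
      _ _).1 hU
  obtain ⟨M, hM0, hM⟩ : ∃ M : ℝ, 0 < M ∧ ∀ i ∈ s, ‖i.2‖ ≤ M := by
    -- The `+ 1` keeps the bound positive when there are no functionals or all of them vanish.
    refine ⟨∑ i ∈ s, ‖i.2‖ + 1, by positivity, fun i hi => ?_⟩
    have := Finset.single_le_sum (f := fun i : E × StrongDual ℂ E => ‖i.2‖)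
      (fun i _ => norm_nonneg _) hi
    linarith
  obtain ⟨b, hb, hba⟩ := exists_adjoin_approx S ha (fun i : s => i.1.1)
    (show 0 < r / M by positivity)
  refine ⟨_, hsub ?_, b, hb, rfl⟩
  rw [Seminorm.mem_ball]
  refine Seminorm.finset_sup_apply_lt hr fun i hi => ?_
  change ‖i.2 (b i.1 - a i.1)‖ < r
  calc ‖i.2 (b i.1 - a i.1)‖ ≤ ‖i.2‖ * ‖b i.1 - a i.1‖ := i.2.le_opNorm _
    _ ≤ M * ‖b i.1 - a i.1‖ := by gcongr; exact hM i hi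
    _ < M * (r / M) := by gcongr; exact hba ⟨i, hi⟩
    _ = r := by field_simp

end Bicommutant

/-! ### Unitary groups, conjugation and commutants -/

section Groups

variable {E : Type*} [NormedAddCommGroup E] [InnerProductSpace ℂ E] [CompleteSpace E]

theorem IsUnitaryGroup.eq_apply {A : E →ₗ.[ℂ] E} {U V : ℝ → E →L[ℂ] E} (hU : IsUnitaryGroup A U)
    (hV : IsUnitaryGroup A V) (hd : Dense (A.domain : Set E)) (s : ℝ) : U s = V s := by
  refine eq_of_generates hU.unitary hU.add hV.unitary hV.add (fun ψ χ h => ?_) ?_ s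
  · exact (hU.generator ψ χ).1 ((hV.generator ψ χ).2 h)
  · refine hd.mono fun ψ hψ => ?_
    exact ⟨A ⟨ψ, hψ⟩, (hV.generator _ _).1 (A.mem_graph ⟨ψ, hψ⟩)⟩

/-- A densely defined generator determines its group, so the choice inside `expI` is immaterial. -/
theorem IsUnitaryGroup.expI_eq {A : E →ₗ.[ℂ] E} {U : ℝ → E →L[ℂ] E} (hU : IsUnitaryGroup A U)
    (hd : Dense (A.domain : Set E)) : expI A = U 1 := by
  have h : ∃ U, IsUnitaryGroup A U := ⟨U, hU⟩
  rw [expI, dif_pos h]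
  exact h.choose_spec.eq_apply hU hd 1

/-- Rescaling time by c multiplies the generator by c, and c⁻¹ undoes it. The factor 1/2 in front of
the Wick square is treated in this way. -/
theorem IsUnitaryGroup.real_smul {A : E →ₗ.[ℂ] E} {U : ℝ → E →L[ℂ] E} (hU : IsUnitaryGroup A U)
    {c : ℝ} (hc : c ≠ 0) : IsUnitaryGroup ((c : ℂ) • A) fun s => U (c * s) where
  unitary s := hU.unitary _
  add s t := by rw [mul_add, hU.add]
  continuous ψ := (hU.continuous ψ).comp (by fun_prop)
  generator ψ χ := by
    have hc' : (c : ℂ) ≠ 0 := by exact_mod_cast hc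
    have h1 : (ψ, χ) ∈ ((c : ℂ) • A).graph ↔ (ψ, (c : ℂ)⁻¹ • χ) ∈ A.graph := by
      simp only [LinearPMap.mem_graph_iff]
      constructor
      · rintro ⟨y, hy, hy'⟩
        refine ⟨⟨y, y.2⟩, hy, ?_⟩
        rw [← hy', LinearPMap.smul_apply, smul_smul, inv_mul_cancel₀ hc', one_smul]
        rfl
      · rintro ⟨y, hy, hy'⟩
        refine ⟨⟨y, y.2⟩, hy, ?_⟩
        change (c : ℂ) • A y = χ
        rw [hy', smul_smul, mul_inv_cancel₀ hc', one_smul]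
    have h0 : U 0 = 1 := map_zero_of_unitary hU.unitary hU.add
    rw [h1, hU.generator]
    change Generates U _ _ ↔ Generates (fun s => U (c * s)) _ _
    rw [generates_iff_hasDerivAt h0,
      generates_iff_hasDerivAt (U := fun s => U (c * s)) (by simpa using h0)]
    constructor
    · intro h
      have h2 : HasDerivAt (fun s => U s ψ) (Complex.I • (c : ℂ)⁻¹ • χ) (c * 0) := by simpa using h
      have h3 := h2.scomp (0 : ℝ) ((hasDerivAt_id (0 : ℝ)).const_mul c)
      refine h3.congr_deriv ?_
      rw [mul_one, ← Complex.coe_smul, smul_smul, smul_smul]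
      congr 1
      field_simp
    · intro h
      have h2 : HasDerivAt (fun s => U (c * s) ψ) (Complex.I • χ) (c⁻¹ * 0) := by simpa using h
      have h3 := h2.scomp (0 : ℝ) ((hasDerivAt_id (0 : ℝ)).const_mul c⁻¹)
      have h4 : ((fun s => U (c * s) ψ) ∘ (c⁻¹ * ·)) = fun s => U s ψ := by
        ext s
        simp only [Function.comp]
        rw [← mul_assoc, mul_inv_cancel₀ hc, one_mul]
      rw [h4] at h3
      refine h3.congr_deriv ?_
      rw [mul_one, ← Complex.coe_smul, smul_smul, smul_smul, Complex.ofReal_inv, mul_comm]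

/-! ### Conjugated groups and operators commuting with a group -/

namespace IsUniformlyAnalytic

variable {D : Submodule ℂ E} {A B : Module.End ℂ D} {R R' : ℝ}

theorem expI_closure (hA : IsUniformlyAnalytic A R) : expI (endPMap A).closure = hA.group 1 :=
  hA.isUnitaryGroup.expI_eq (hA.dense.mono (LinearPMap.le_closure (endPMap A)).1)

/-- The conjugated group has a generator extending B. By symmetry that generator is contained in the
adjoint of B, which is already the generator of the group of B. -/
theorem conj_group (hA : IsUniformlyAnalytic A R) (hB : IsUniformlyAnalytic B R')
    {W : E →L[ℂ] E} (hW : W ∈ unitary (E →L[ℂ] E))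
    (h : ∀ x : D, (W x, W (B x)) ∈ (endPMap A).closure.graph) (s : ℝ) :
    star W * hA.group s * W = hB.group s := by
  have hWs := Unitary.mul_star_self_of_mem hW
  have hsW := Unitary.star_mul_self_of_mem hW
  set V : ℝ → E →L[ℂ] E := fun s => star W * hA.group s * W with hV
  have hVu : ∀ s, V s ∈ unitary (E →L[ℂ] E) := fun s =>
    mul_mem (mul_mem (Unitary.star_mem hW) (hA.group_mem_unitary s)) hW
  have hVadd : ∀ s t, V (s + t) = V s * V t := fun s t => by
    simp only [hV, hA.group_add]
    calc star W * (hA.group s * hA.group t) * W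
        = star W * hA.group s * 1 * hA.group t * W := by noncomm_ring
      _ = _ := by rw [← hWs]; noncomm_ring
  have hgen : ∀ x : D, Generates V x (B x) := fun x => by
    have h1 := (hA.mem_closure_graph_iff _ _).1 (h x)
    have h2 := ((star W).continuous.tendsto _).comp h1
    rw [map_smul, ← mul_apply_eq_comp, hsW, one_apply_eq_self] at h2
    refine h2.congr fun t => ?_
    simp only [Function.comp, map_smul, map_sub, hV]
    rw [← mul_apply_eq_comp (star W) W, hsW]
    rfl
  refine (eq_of_generates hB.group_mem_unitary hB.group_add hVu hVadd (fun ψ χ hψ => ?_) ?_ s).symm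
  · refine hB.generates_of_adjoint fun x => ?_
    exact (hψ.symm hVu hVadd (hgen x)).symm
  · exact hA.dense.mono fun x hx => ⟨_, hgen ⟨x, hx⟩⟩

theorem generates_of_commute (hA : IsUniformlyAnalytic A R) {b : E →L[ℂ] E}
    (hb : ∀ s, b * hA.group s = hA.group s * b) (x : D) : Generates hA.group (b x) (b (A x)) := by
  have h2 := (b.continuous.tendsto _).comp (hA.generates_group x)
  rw [map_smul] at h2
  refine h2.congr fun t => ?_
  simp only [Function.comp, map_smul, map_sub]
  rw [← mul_apply_eq_comp, hb]
  rfl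

/-- The condition passes from domain vectors to the whole generator because its graph is closed.
Then ⟨U_t y, b U_t x⟩ has vanishing derivative, so U_s* b U_s = b. -/
theorem commute_of_generates (hA : IsUniformlyAnalytic A R) {b : E →L[ℂ] E}
    (hb : ∀ x : D, Generates hA.group (b x) (b (A x))) (s : ℝ) :
    b * hA.group s = hA.group s * b := by
  have h1 : ∀ ψ χ, Generates hA.group ψ χ → Generates hA.group (b ψ) (b χ) := by
    intro ψ χ h
    have hcl : IsClosed {z : E × E | (b z.1, b z.2) ∈ (endPMap A).closure.graph} := by
      have : IsClosed ((endPMap A).closure.graph : Set (E × E)) := hA.isClosable.closure_isClosed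
      exact this.preimage (by fun_prop)
    rw [← hA.mem_closure_graph_iff, ← hA.isClosable.graph_closure_eq_closure_graph] at h
    have h2 : (ψ, χ) ∈ {z : E × E | (b z.1, b z.2) ∈ (endPMap A).closure.graph} := by
      refine hcl.closure_subset_iff.2 ?_ h
      rintro ⟨y, z⟩ hyz
      obtain ⟨x, rfl, rfl⟩ := (LinearPMap.mem_graph_iff _).1 hyz
      exact (hA.mem_closure_graph_iff _ _).2 (hb x)
    exact (hA.mem_closure_graph_iff _ _).1 h2
  have h3 : ∀ x y : D, inner ℂ (hA.group s y) (b (hA.group s x)) = inner ℂ (y : E) (b x) := by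
    intro x y
    have hder : ∀ t : ℝ, HasDerivAt (fun t => inner ℂ (hA.group t y) (b (hA.group t x))) 0 t :=
        fun t => by
      have hx := hA.hasDerivAt_group x t
      have hbx := (b.restrictScalars ℝ).hasFDerivAt.comp_hasDerivAt t hx
      have h4 := HasDerivAt.inner ℂ (hA.hasDerivAt_group y t) hbx
      have h5 := ((hA.generates_group y).apply hA.group_add t).symm hA.group_mem_unitary
        hA.group_add (h1 _ _ ((hA.generates_group x).apply hA.group_add t))
      refine h4.congr_deriv ?_
      change inner ℂ (hA.group t y) (b (Complex.I • hA.group t (A x))) +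
        inner ℂ (Complex.I • hA.group t (A y)) (b (hA.group t x)) = 0
      rw [map_smul, inner_smul_left, inner_smul_right, h5, Complex.conj_I]
      ring
    have h6 := is_const_of_deriv_eq_zero (fun t => (hder t).differentiableAt)
      (fun t => (hder t).deriv) s 0
    simpa [hA.group_zero] using h6
  refine ext_of_dense hA.dense fun x => ?_
  have h7 : star (hA.group s) (b (hA.group s x)) = b x := by
    refine hA.dense.eq_of_inner_right ℂ fun y hy => ?_
    rw [ContinuousLinearMap.star_eq_adjoint, ContinuousLinearMap.adjoint_inner_right]
    exact h3 x ⟨y, hy⟩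
  rw [mul_apply_eq_comp, mul_apply_eq_comp, ← h7, ← mul_apply_eq_comp (hA.group s),
    Unitary.mul_star_self_of_mem (hA.group_mem_unitary s), one_apply_eq_self]

end IsUniformlyAnalytic

end Groups

/-! ### Covariance of a linear family under the exponential of a quadratic operator -/

section Covariance

open Finset.HasAntidiagonal (antidiagonal)
open scoped Nat

variable {E : Type*} [NormedAddCommGroup E] [InnerProductSpace ℂ E] [CompleteSpace E]
variable {D : Submodule ℂ E} {A : Module.End ℂ D} {R : ℝ}
variable {X : Type*} [NormedAddCommGroup X] [NormedSpace ℝ X] [CompleteSpace X]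

-- On maps Ψ : X → End D, left multiplication by A commutes with Ψ ↦ -i Ψ ∘ t, and by hypothesis
-- their sum acts on Θ as right multiplication by A. The formula is the binomial theorem for this
-- commuting pair.
set_option linter.unusedSectionVars false in
theorem mul_pow_eq_sum_antidiagonal (Θ : X → Module.End ℂ D) (t : X →L[ℝ] X)
    (hcomm : ∀ F, A * Θ F - Θ F * A = Complex.I • Θ (t F)) (F : X) (n : ℕ) :
    Θ F * A ^ n = ∑ p ∈ antidiagonal n,
      (n.choose p.1 : ℂ) • (-Complex.I) ^ p.1 • (A ^ p.2 * Θ ((t ^ p.1) F)) := by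
  let l : Module.End ℂ (X → Module.End ℂ D) :=
    { toFun := fun Ψ F => A * Ψ F
      map_add' := fun Ψ Ψ' => by ext; simp
      map_smul' := fun c Ψ => by ext; simp }
  let τ : Module.End ℂ (X → Module.End ℂ D) :=
    { toFun := fun Ψ F => (-Complex.I) • Ψ (t F)
      map_add' := fun Ψ Ψ' => by ext; simp
      map_smul' := fun c Ψ => by
        ext F x
        simp only [Pi.smul_apply, RingHom.id_apply, LinearMap.smul_apply]
        rw [smul_comm] }
  have hl : ∀ k Ψ F, (l ^ k) Ψ F = A ^ k * Ψ F := fun k => by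
    induction k with
    | zero => intro Ψ F; simp
    | succ k ih =>
      intro Ψ F
      rw [pow_succ', Module.End.mul_apply]
      change A * (l ^ k) Ψ F = _
      rw [ih, pow_succ', mul_assoc]
  have hτ : ∀ k Ψ F, (τ ^ k) Ψ F = (-Complex.I) ^ k • Ψ ((t ^ k) F) := fun k => by
    induction k with
    | zero => intro Ψ F; simp
    | succ k ih =>
      intro Ψ F
      rw [pow_succ', Module.End.mul_apply]
      change (-Complex.I) • (τ ^ k) Ψ (t F) = _
      rw [ih, smul_smul, ← pow_succ', ← mul_apply_eq_comp, ← pow_succ]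
  have hc : Commute τ l := by
    refine LinearMap.ext fun Ψ => funext fun F => ?_
    change (-Complex.I) • (A * Ψ (t F)) = A * ((-Complex.I) • Ψ (t F))
    rw [mul_smul_comm]
  have hsum : ∀ n F, ((τ + l) ^ n) Θ F = Θ F * A ^ n := fun n => by
    induction n with
    | zero => intro F; simp
    | succ n ih =>
      intro F
      rw [pow_succ', Module.End.mul_apply]
      change (-Complex.I) • ((τ + l) ^ n) Θ (t F) + A * ((τ + l) ^ n) Θ F = _
      have h1 : (-Complex.I) • Θ (t F) + A * Θ F = Θ F * A := by
        rw [sub_eq_iff_eq_add.1 (hcomm F)]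
        module
      rw [ih, ih, ← smul_mul_assoc, ← mul_assoc, ← add_mul, h1, mul_assoc, ← pow_succ']
  rw [← hsum, hc.add_pow', LinearMap.sum_apply, Finset.sum_apply]
  refine Finset.sum_congr rfl fun p _ => ?_
  rw [LinearMap.smul_apply, Pi.smul_apply, Module.End.mul_apply, hτ, hl,
    ← Nat.cast_smul_eq_nsmul ℂ]

/-- Applied to a partial sum of e^{isA} x, Θ F gives antidiagonal sums of the double series of
e^{isA} Θ((st)^j F / j!) x. Linearity of `hbd` in ‖F‖ makes the double series converge, and summing
by rows gives e^{isA} Θ(exp(st) F) x. The closure of Θ F passes to the limit. -/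
theorem IsUniformlyAnalytic.mem_closure_graph_exp (hA : IsUniformlyAnalytic A R)
    (Θ : X → Module.End ℂ D) (hadd : ∀ F G, Θ (F + G) = Θ F + Θ G)
    (hsmul : ∀ (r : ℝ) F, Θ (r • F) = (r : ℂ) • Θ F) (t : X →L[ℝ] X)
    (hcomm : ∀ F, A * Θ F - Θ F * A = Complex.I • Θ (t F))
    (hbd : ∀ x : D, ∃ C : ℝ, ∀ F k, ‖((A ^ k) (Θ F x) : E)‖ ≤ C * ‖F‖ * R ^ k * k !) (F : X)
    (hcl : (endPMap (Θ F)).IsClosable) {s : ℝ} (hs : R * |s| < 1) (x : D) :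
    (hA.localExp s x, hA.localExp s (Θ (NormedSpace.exp (s • t) F) x)) ∈
      (endPMap (Θ F)).closure.graph := by
  obtain ⟨C, hC⟩ := hbd x
  have hR := hA.pos
  have hnorm : ∀ G, ‖(Θ G x : E)‖ ≤ C * ‖G‖ := fun G => by simpa using hC G 0
  let Θx : X →L[ℝ] E := LinearMap.mkContinuous
    { toFun := fun G => (Θ G x : E)
      map_add' := fun G G' => by rw [hadd]; rfl
      map_smul' := fun r G => by
        rw [hsmul, RingHom.id_apply, ← Complex.coe_smul]; rfl } C hnorm
  have hexp : HasSum (fun j : ℕ => (((j ! : ℝ)⁻¹) • (s • t) ^ j) F) (NormedSpace.exp (s • t) F) := by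
    have h1 := NormedSpace.exp_series_hasSum_exp' (𝕂 := ℝ) (s • t)
    have h2 := h1.mapL (ContinuousLinearMap.apply ℝ X F)
    simpa only [ContinuousLinearMap.apply_apply] using h2
  let G : ℕ → X := fun j => ((j ! : ℝ)⁻¹ • (s • t) ^ j) F
  have hGsum : Summable fun j => ‖G j‖ := by
    have h1 := NormedSpace.norm_expSeries_summable' (𝕂 := ℝ) (s • t)
    refine Summable.of_nonneg_of_le (fun _ => norm_nonneg _) (fun j => ?_) (h1.mul_right ‖F‖)
    exact ContinuousLinearMap.le_opNorm _ _
  let f : ℕ × ℕ → E := fun p => expTerm A s p.2 (Θ (G p.1) x)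
  have hf : Summable f := by
    have h1 := (hGsum.mul_left C).mul_of_nonneg
      (summable_geometric_of_lt_one (r := R * |s|) (by positivity) hs)
      (fun j => (norm_nonneg _).trans (hnorm (G j))) (fun k => by positivity)
    refine Summable.of_norm_bounded h1 fun p => ?_
    exact norm_expTerm_le (fun k => hC (G p.1) k) s p.2
  have h1 := hasSum_sum_antidiagonal hf
  have h2 : ∑' j, ∑' k, f (j, k) = hA.localExp s (Θ (NormedSpace.exp (s • t) F) x) := by
    have h3 := (hA.localExp s).hasSum (Θx.hasSum hexp)
    change _ = hA.localExp s (Θx _)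
    rw [← h3.tsum_eq]
    congr 1; ext j
    exact (hA.hasSum_localExp hs (Θ (G j) x)).tsum_eq
  rw [h2] at h1
  have h4 : ∀ n, ∑ p ∈ antidiagonal n, f p =
      ((Θ F (((Complex.I * s) ^ n / (n ! : ℂ)) • (A ^ n) x) : D) : E) := fun n => by
    rw [map_smul, ← Module.End.mul_apply, mul_pow_eq_sum_antidiagonal Θ t hcomm,
      LinearMap.sum_apply, Finset.smul_sum, Submodule.coe_sum]
    refine Finset.sum_congr rfl fun p hp => ?_
    rw [Finset.HasAntidiagonal.mem_antidiagonal] at hp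
    have hG : G p.1 = ((p.1 ! : ℝ)⁻¹ * s ^ p.1) • (t ^ p.1) F := by
      simp only [G, smul_pow, _root_.smul_apply, smul_smul]
    simp only [f, expTerm, hG, hsmul, LinearMap.smul_apply, Module.End.mul_apply, map_smul,
      Submodule.coe_smul, smul_smul]
    congr 1
    have h := Nat.add_choose_mul_factorial_mul_factorial p.1 p.2
    rw [← Nat.choose_symm_add, hp] at h
    have h' : ((n.choose p.1 : ℂ)) * (p.1)! * (p.2)! = n ! := by exact_mod_cast h
    have h1 : ((p.1)! : ℂ) ≠ 0 := by exact_mod_cast Nat.factorial_ne_zero _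
    have h2 : ((p.2)! : ℂ) ≠ 0 := by exact_mod_cast Nat.factorial_ne_zero _
    have h3 : (n ! : ℂ) ≠ 0 := by exact_mod_cast Nat.factorial_ne_zero _
    -- Each factor t brings -i, and (is)(-i) = s turns it into the real parameter of exp(st).
    have h5 : (Complex.I * s) ^ n * (-Complex.I) ^ p.1 = (Complex.I * s) ^ p.2 * (s : ℂ) ^ p.1 := by
      rw [← hp, pow_add, mul_right_comm, ← mul_pow]
      rw [show Complex.I * s * -Complex.I = (s : ℂ) by
        rw [mul_right_comm, mul_neg, Complex.I_mul_I]; ring]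
      ring
    push_cast
    calc (Complex.I * s) ^ p.2 / ((p.2)! : ℂ) * (((p.1)! : ℂ)⁻¹ * (s : ℂ) ^ p.1)
        = ((Complex.I * s) ^ p.2 * (s : ℂ) ^ p.1) / ((p.2)! * (p.1)!) := by field_simp
      _ = (Complex.I * s) ^ n * (-Complex.I) ^ p.1 * ((n.choose p.1 : ℂ) / n !) := by
          rw [h5, ← h']
          have : (n.choose p.1 : ℂ) ≠ 0 := fun h0 => h3 (by rw [← h', h0]; ring)
          field_simp
      _ = _ := by ring
  rw [← hcl.graph_closure_eq_closure_graph]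
  have h5 := (hA.hasSum_localExp hs x).tendsto_sum_nat
  have h6 := h1.tendsto_sum_nat
  refine mem_closure_of_tendsto (h5.prodMk_nhds h6) (Eventually.of_forall fun N => ?_)
  refine (LinearPMap.mem_graph_iff _).2
    ⟨(∑ k ∈ Finset.range N, ((Complex.I * s) ^ k / (k ! : ℂ)) • (A ^ k) x : D), ?_, ?_⟩
  · rw [Submodule.coe_sum]
    rfl
  · change ((Θ F (∑ k ∈ Finset.range N, ((Complex.I * s) ^ k / (k ! : ℂ)) • (A ^ k) x) : D) : E) = _
    rw [map_sum, Submodule.coe_sum]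
    exact Finset.sum_congr rfl fun n _ => (h4 n).symm

/-- The series argument reaches only small s. Steps of size 1/n with n > 2R are small enough, and n
of them compose to exp(t/n)^n = exp(t). -/
theorem IsUniformlyAnalytic.star_group_mul_group_mul_group (hA : IsUniformlyAnalytic A R)
    (Θ : X → Module.End ℂ D) (hadd : ∀ F G, Θ (F + G) = Θ F + Θ G)
    (hsmul : ∀ (r : ℝ) F, Θ (r • F) = (r : ℂ) • Θ F) (t : X →L[ℝ] X)
    (hcomm : ∀ F, A * Θ F - Θ F * A = Complex.I • Θ (t F))
    (hbd : ∀ x : D, ∃ C : ℝ, ∀ F k, ‖((A ^ k) (Θ F x) : E)‖ ≤ C * ‖F‖ * R ^ k * k !)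
    {r : X → ℝ} (hΘ : ∀ F, IsUniformlyAnalytic (Θ F) (r F)) (F : X) :
    star (hA.group 1) * (hΘ F).group 1 * hA.group 1 = (hΘ (NormedSpace.exp t F)).group 1 := by
  have hR := hA.pos
  have hsmall : ∀ s : ℝ, R * (|s| + |s|) < 1 → ∀ F,
      star (hA.group s) * (hΘ F).group 1 * hA.group s =
        (hΘ (NormedSpace.exp (s • t) F)).group 1 := fun s hs F => by
    have hs' : R * |s| < 1 := lt_of_le_of_lt (by gcongr; linarith [abs_nonneg s]) hs
    refine (hΘ F).conj_group (hΘ _) (hA.group_mem_unitary s) (fun x => ?_) 1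
    rw [hA.group_of_small hs]
    exact hA.mem_closure_graph_exp Θ hadd hsmul t hcomm hbd F (hΘ F).isClosable hs' x
  obtain ⟨n, hn⟩ := exists_nat_gt (2 * R)
  have hn0 : (0 : ℝ) < n := lt_trans (by positivity) hn
  set s : ℝ := (n : ℝ)⁻¹ with hs
  have hs1 : R * (|s| + |s|) < 1 := by
    rw [hs, abs_of_pos (by positivity), ← two_mul, ← mul_assoc, mul_comm R, ← div_eq_mul_inv,
      div_lt_one hn0]
    exact hn
  have hpow : ∀ k : ℕ, hA.group (k * s) = hA.group s ^ k := fun k => by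
    induction k with
    | zero => simp [hA.group_zero]
    | succ k ih => rw [pow_succ, ← ih, ← hA.group_add]; push_cast; ring_nf
  have hiter : ∀ (k : ℕ) (F : X), star (hA.group s ^ k) * (hΘ F).group 1 * hA.group s ^ k =
      (hΘ ((NormedSpace.exp (s • t) ^ k) F)).group 1 := fun k => by
    induction k with
    | zero => intro F; simp
    | succ k ih =>
      intro F
      rw [pow_succ', star_mul]
      calc star (hA.group s ^ k) * star (hA.group s) * (hΘ F).group 1 * (hA.group s * hA.group s ^ k)
          = star (hA.group s ^ k) * (star (hA.group s) * (hΘ F).group 1 * hA.group s) *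
              hA.group s ^ k := by noncomm_ring
        _ = _ := by
          rw [hsmall s hs1, ih, ← mul_apply_eq_comp, ← pow_succ]
  have h1 := hiter n F
  let : NormedAlgebra ℚ (X →L[ℝ] X) := NormedAlgebra.restrictScalars ℚ ℝ _
  rw [← hpow, hs, mul_inv_cancel₀ hn0.ne', ← NormedSpace.exp_nsmul] at h1
  rw [h1, ← Nat.cast_smul_eq_nsmul ℝ, smul_smul, mul_inv_cancel₀ hn0.ne', one_smul]

end Covariance

end LocalSqueezing
end

noncomputable section

namespace LocalSqueezing

/-! ### Tensor products, contractions and kernel operators on `L²` -/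

section ProductSpaces

open scoped NNReal

variable {X Y Z : Type*} [MeasurableSpace X] [MeasurableSpace Y] [MeasurableSpace Z]
variable {μ : Measure X} {ν : Measure Y} {ζ : Measure Z}

theorem memLp_tensor [SFinite ν] [SFinite μ] (G : Lp ℂ 2 μ) (ψ : Lp ℂ 2 ν) :
    MemLp (fun z : X × Y => G z.1 * ψ z.2) 2 (μ.prod ν) := by
  have hG := (memLp_two_iff_integrable_sq_norm (Lp.aestronglyMeasurable G)).1 (Lp.memLp G)
  have hψ := (memLp_two_iff_integrable_sq_norm (Lp.aestronglyMeasurable ψ)).1 (Lp.memLp ψ)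
  have hm : AEStronglyMeasurable (fun z : X × Y => G z.1 * ψ z.2) (μ.prod ν) :=
    ((Lp.stronglyMeasurable G).comp_measurable measurable_fst).mul
      ((Lp.stronglyMeasurable ψ).comp_measurable measurable_snd) |>.aestronglyMeasurable
  rw [memLp_two_iff_integrable_sq_norm hm]
  refine (hG.mul_prod hψ).congr (ae_of_all _ fun z => ?_)
  simp only [norm_mul, mul_pow]

theorem norm_sq_eq_integral (f : Lp ℂ 2 μ) : ‖f‖ ^ 2 = ∫ x, ‖f x‖ ^ 2 ∂μ := by
  have h := L2.inner_def (𝕜 := ℂ) f f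
  rw [inner_self_eq_norm_sq_to_K] at h
  simp only [inner_self_eq_norm_sq_to_K] at h
  have h2 : ((‖f‖ ^ 2 : ℝ) : ℂ) = ((∫ x, ‖f x‖ ^ 2 ∂μ : ℝ) : ℂ) := by
    rw [← integral_complex_ofReal]
    push_cast
    exact h
  exact_mod_cast h2

theorem norm_toLp_tensor [SFinite ν] [SFinite μ] (G : Lp ℂ 2 μ) (ψ : Lp ℂ 2 ν) :
    ‖(memLp_tensor G ψ).toLp‖ = ‖G‖ * ‖ψ‖ := by
  have h1 : ‖(memLp_tensor G ψ).toLp‖ ^ 2 = (‖G‖ * ‖ψ‖) ^ 2 := by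
    rw [mul_pow, norm_sq_eq_integral, norm_sq_eq_integral, norm_sq_eq_integral,
      ← integral_prod_mul]
    refine integral_congr_ae ?_
    filter_upwards [(memLp_tensor G ψ).coeFn_toLp] with z hz
    rw [hz, norm_mul, mul_pow]
  exact (sq_eq_sq₀ (by positivity) (by positivity)).1 h1

theorem ae_fst [SFinite ν] {p : X → Prop} (h : ∀ᵐ x ∂μ, p x) : ∀ᵐ z ∂μ.prod ν, p z.1 :=
  Measure.quasiMeasurePreserving_fst.ae h

theorem ae_snd [SFinite ν] {p : Y → Prop} (h : ∀ᵐ y ∂ν, p y) : ∀ᵐ z ∂μ.prod ν, p z.2 :=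
  Measure.quasiMeasurePreserving_snd.ae h

/-- The tensor product `(G ⊗ ψ)(x, y) = G(x) ψ(y)`. -/
def tensor (μ : Measure X) (ν : Measure Y) [SFinite ν] [SFinite μ] :
    Lp ℂ 2 μ →L[ℂ] Lp ℂ 2 ν →L[ℂ] Lp ℂ 2 (μ.prod ν) :=
  (LinearMap.mk₂ ℂ (fun G ψ => (memLp_tensor G ψ).toLp)
    (fun G G' ψ => by
      rw [← MemLp.toLp_add]
      refine MemLp.toLp_congr _ _ ?_
      filter_upwards [ae_fst (ν := ν) (Lp.coeFn_add G G')] with z hz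
      rw [hz, Pi.add_apply, add_mul]; rfl)
    (fun c G ψ => by
      rw [← MemLp.toLp_const_smul]
      refine MemLp.toLp_congr _ _ ?_
      filter_upwards [ae_fst (ν := ν) (Lp.coeFn_smul c G)] with z hz
      rw [hz, Pi.smul_apply, smul_mul_assoc]; rfl)
    (fun G ψ ψ' => by
      rw [← MemLp.toLp_add]
      refine MemLp.toLp_congr _ _ ?_
      filter_upwards [ae_snd (μ := μ) (Lp.coeFn_add ψ ψ')] with z hz
      rw [hz, Pi.add_apply, mul_add]; rfl)
    (fun c G ψ => by
      rw [← MemLp.toLp_const_smul]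
      refine MemLp.toLp_congr _ _ ?_
      filter_upwards [ae_snd (μ := μ) (Lp.coeFn_smul c ψ)] with z hz
      rw [hz, Pi.smul_apply, mul_smul_comm]; rfl)).mkContinuous₂ 1 fun G ψ => by
        rw [one_mul]; exact (norm_toLp_tensor G ψ).le

theorem tensor_apply [SFinite ν] [SFinite μ] (G : Lp ℂ 2 μ) (ψ : Lp ℂ 2 ν) :
    tensor μ ν G ψ = (memLp_tensor G ψ).toLp := rfl

theorem norm_tensor_le [SFinite ν] [SFinite μ] (G : Lp ℂ 2 μ) : ‖tensor μ ν G‖ ≤ ‖G‖ :=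
  ContinuousLinearMap.opNorm_le_bound _ (norm_nonneg _) fun ψ => by
    rw [tensor_apply, norm_toLp_tensor]

theorem tensor_ae [SFinite ν] [SFinite μ] {G : Lp ℂ 2 μ} {ψ : Lp ℂ 2 ν} {g : X → ℂ} {f : Y → ℂ}
    (hg : G =ᵐ[μ] g) (hf : ψ =ᵐ[ν] f) :
    tensor μ ν G ψ =ᵐ[μ.prod ν] fun z => g z.1 * f z.2 := by
  filter_upwards [(memLp_tensor G ψ).coeFn_toLp, ae_fst (ν := ν) hg, ae_snd (μ := μ) hf]
    with z h1 h2 h3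
  rw [tensor_apply, h1, h2, h3]

/-- The pointwise formula is checked by integrating over sets of finite measure: the adjoint paired
with an indicator is an integral over the product, and Fubini applies. -/
theorem contraction_ae' [SigmaFinite ν] [SFinite μ] (G : Lp ℂ 2 μ) (φ : Lp ℂ 2 (μ.prod ν)) :
    (tensor μ ν G).adjoint φ =ᵐ[ν] fun y => ∫ x, star (G x) * φ (x, y) ∂μ := by
  have key : ∀ s (hs : MeasurableSet s) (hνs : ν s < ∞),
      Integrable (fun z : X × Y => s.indicator (fun _ => (1 : ℂ)) z.2 * (star (G z.1) * φ z))
        (μ.prod ν) ∧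
      inner ℂ (indicatorConstLp 2 hs hνs.ne (1 : ℂ)) ((tensor μ ν G).adjoint φ) =
        ∫ z, s.indicator (fun _ => (1 : ℂ)) z.2 * (star (G z.1) * φ z) ∂μ.prod ν := by
    intro s hs hνs
    have h1 := L2.integrable_inner (𝕜 := ℂ)
      (tensor μ ν G (indicatorConstLp 2 hs hνs.ne (1 : ℂ))) φ
    have h2 : (fun z => inner ℂ (tensor μ ν G (indicatorConstLp 2 hs hνs.ne (1 : ℂ)) z) (φ z))
        =ᵐ[μ.prod ν] fun z => s.indicator (fun _ => (1 : ℂ)) z.2 * (star (G z.1) * φ z) := by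
      filter_upwards [tensor_ae (G := G) (EventuallyEq.refl _ _)
        (indicatorConstLp_coeFn (hs := hs) (hμs := hνs.ne) (c := (1 : ℂ)) (p := 2))] with z hz
      rw [hz, RCLike.inner_apply, map_mul]
      by_cases hz2 : z.2 ∈ s
      · simp [hz2, mul_comm]
      · simp [hz2]
    refine ⟨h1.congr h2, ?_⟩
    rw [ContinuousLinearMap.adjoint_inner_right, L2.inner_def]
    exact integral_congr_ae h2
  have hind : ∀ s : Set Y, (fun y => ∫ x, s.indicator (fun _ => (1 : ℂ)) y *
      (star (G x) * φ (x, y)) ∂μ) = s.indicator fun y => ∫ x, star (G x) * φ (x, y) ∂μ := by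
    intro s
    ext y
    by_cases hy : y ∈ s <;> simp [hy]
  refine ae_eq_of_forall_setIntegral_eq_of_sigmaFinite (fun s hs hνs => ?_) (fun s hs hνs => ?_)
    fun s hs hνs => ?_
  · exact integrableOn_Lp_of_measure_ne_top _ (by norm_num) hνs.ne
  · have := (key s hs hνs).1.integral_prod_right
    simp only at this
    rw [hind] at this
    exact (integrable_indicator_iff hs).1 this
  · rw [← L2.inner_indicatorConstLp_one hs hνs.ne, (key s hs hνs).2,
      integral_prod_symm _ (key s hs hνs).1]
    simp only
    rw [hind, integral_indicator hs]

theorem ae_ae_fst [SFinite ν] [SFinite μ] {p : X × Y → Prop} (h : ∀ᵐ z ∂μ.prod ν, p z) :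
    ∀ᵐ y ∂ν, ∀ᵐ x ∂μ, p (x, y) := by
  have h1 : ∀ᵐ z ∂ν.prod μ, p z.swap :=
    Measure.measurePreserving_swap.quasiMeasurePreserving.ae h
  exact Measure.ae_ae_of_ae_prod h1

theorem contraction_ae [SigmaFinite ν] [SFinite μ] {G : Lp ℂ 2 μ} {φ : Lp ℂ 2 (μ.prod ν)}
    {g : X → ℂ} {f : X × Y → ℂ} (hg : G =ᵐ[μ] g) (hf : φ =ᵐ[μ.prod ν] f) :
    (tensor μ ν G).adjoint φ =ᵐ[ν] fun y => ∫ x, star (g x) * f (x, y) ∂μ := by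
  filter_upwards [contraction_ae' G φ, ae_ae_fst hf] with y h1 h2
  rw [h1]
  refine integral_congr_ae ?_
  filter_upwards [hg, h2] with x h3 h4
  rw [h3, h4]

/-- A measurable kernel satisfying the hypothesis of Schur's test. -/
structure IsSchurKernel (μ : Measure X) (k : X → X → ℂ) (C : ℝ≥0) : Prop where
  measurable : Measurable fun z : X × X => k z.1 z.2
  left : ∀ x, ∫⁻ q, ‖k x q‖ₑ ∂μ ≤ C
  right : ∀ q, ∫⁻ x, ‖k x q‖ₑ ∂μ ≤ C

/-! ### Schur's test -/

section Schur

variable {k : X → X → ℂ} {C : ℝ≥0} [SFinite ν] [SFinite μ]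

/-- The integrand of the form of a kernel operator. -/
def schurIntegrand (k : X → X → ℂ) (v w : X × Y → ℂ) (z : (X × Y) × X) : ℂ :=
  star (k z.1.1 z.2 * v (z.2, z.1.2)) * w z.1

theorem lintegral_enorm_sq {μ : Measure X} (f : Lp ℂ 2 μ) :
    ∫⁻ x, ‖f x‖ₑ ^ 2 ∂μ = ENNReal.ofReal (‖f‖ ^ 2) := by
  rw [norm_sq_eq_integral, ofReal_integral_eq_lintegral_ofReal
    ((memLp_two_iff_integrable_sq_norm (Lp.aestronglyMeasurable f)).1 (Lp.memLp f))
    (ae_of_all _ fun _ => by positivity)]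
  refine lintegral_congr fun x => ?_
  rw [ENNReal.ofReal_pow (norm_nonneg _), ofReal_norm]

/-- With |k| as weight, ab ≤ a² + b² separates v from w; in each part k is integrated over the
variable on which the remaining function does not depend. -/
theorem IsSchurKernel.lintegral_le (hk : IsSchurKernel μ k C) (v w : Lp ℂ 2 (μ.prod ν)) :
    ∫⁻ z, ‖schurIntegrand k v w z‖ₑ ∂(μ.prod ν).prod μ ≤
      C * (ENNReal.ofReal (‖v‖ ^ 2) + ENNReal.ofReal (‖w‖ ^ 2)) := by
  have hkm : Measurable fun z : (X × Y) × X => ‖k z.1.1 z.2‖ₑ :=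
    (hk.measurable.comp (measurable_fst.fst.prodMk measurable_snd)).enorm
  have hvm : Measurable fun z : X × Y => ‖v z‖ₑ ^ 2 :=
    (Lp.stronglyMeasurable v).measurable.enorm.pow_const 2
  have hwm : Measurable fun z : X × Y => ‖w z‖ₑ ^ 2 :=
    (Lp.stronglyMeasurable w).measurable.enorm.pow_const 2
  have h1 : ∀ z, ‖schurIntegrand k v w z‖ₑ ≤
      ‖k z.1.1 z.2‖ₑ * ‖v (z.2, z.1.2)‖ₑ ^ 2 + ‖k z.1.1 z.2‖ₑ * ‖w z.1‖ₑ ^ 2 := by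
    intro z
    rw [schurIntegrand, enorm_mul, ← mul_add, ← ofReal_norm (star _), norm_star, ofReal_norm, enorm_mul, mul_assoc]
    gcongr
    have h2 : ∀ a b : ℝ≥0∞, a * b ≤ a ^ 2 + b ^ 2 := fun a b => by
      rcases le_total a b with hab | hab
      · exact le_add_left (by rw [pow_two]; gcongr)
      · exact le_add_right (by rw [pow_two]; gcongr)
    exact h2 _ _
  refine (lintegral_mono h1).trans ?_
  have hkv : Measurable fun z : (X × Y) × X => ‖k z.1.1 z.2‖ₑ * ‖v (z.2, z.1.2)‖ₑ ^ 2 :=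
    hkm.mul (hvm.comp (measurable_snd.prodMk measurable_fst.snd))
  have hkw : Measurable fun z : (X × Y) × X => ‖k z.1.1 z.2‖ₑ * ‖w z.1‖ₑ ^ 2 :=
    hkm.mul (hwm.comp measurable_fst)
  rw [lintegral_add_right _ hkw, mul_add]
  refine add_le_add ?_ ?_
  · rw [lintegral_prod_symm' _ hkv]
    calc ∫⁻ q, ∫⁻ z : X × Y, ‖k z.1 q‖ₑ * ‖v (q, z.2)‖ₑ ^ 2 ∂μ.prod ν ∂μ
        = ∫⁻ q, (∫⁻ x, ‖k x q‖ₑ ∂μ) * ∫⁻ y, ‖v (q, y)‖ₑ ^ 2 ∂ν ∂μ := by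
          refine lintegral_congr fun q => ?_
          rw [← lintegral_prod_mul]
          · exact (hk.measurable.comp (measurable_id.prodMk measurable_const)).enorm.aemeasurable
          · exact (hvm.comp (measurable_const.prodMk measurable_id)).aemeasurable
      _ ≤ ∫⁻ q, C * ∫⁻ y, ‖v (q, y)‖ₑ ^ 2 ∂ν ∂μ := by
          refine lintegral_mono fun q => ?_
          dsimp only
          gcongr
          exact hk.right q
      _ = C * ∫⁻ z, ‖v z‖ₑ ^ 2 ∂μ.prod ν := by
          rw [lintegral_const_mul _ (hvm.lintegral_prod_right'), lintegral_prod _ hvm.aemeasurable]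
      _ = _ := by rw [lintegral_enorm_sq]
  · rw [lintegral_prod _ hkw.aemeasurable]
    calc ∫⁻ z : X × Y, ∫⁻ q, ‖k z.1 q‖ₑ * ‖w z‖ₑ ^ 2 ∂μ ∂μ.prod ν
        ≤ ∫⁻ z : X × Y, C * ‖w z‖ₑ ^ 2 ∂μ.prod ν := by
          refine lintegral_mono fun z => ?_
          dsimp only
          have hkz : Measurable fun q => ‖k z.1 q‖ₑ :=
            (hk.measurable.comp (measurable_const.prodMk measurable_id)).enorm
          rw [lintegral_mul_const _ hkz]
          gcongr
          exact hk.left z.1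
      _ = C * ∫⁻ z, ‖w z‖ₑ ^ 2 ∂μ.prod ν := lintegral_const_mul _ hwm
      _ = _ := by rw [lintegral_enorm_sq]

theorem IsSchurKernel.integrable (hk : IsSchurKernel μ k C) (v w : Lp ℂ 2 (μ.prod ν)) :
    Integrable (schurIntegrand k v w) ((μ.prod ν).prod μ) := by
  refine ⟨?_, ?_⟩
  · have hkm : Measurable fun z : (X × Y) × X => k z.1.1 z.2 :=
      hk.measurable.comp (measurable_fst.fst.prodMk measurable_snd)
    have hvm := (Lp.stronglyMeasurable v).measurable.comp
      ((measurable_snd.prodMk measurable_fst.snd : Measurable fun z : (X × Y) × X => (z.2, z.1.2)))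
    have hwm := (Lp.stronglyMeasurable w).measurable.comp
      (measurable_fst : Measurable fun z : (X × Y) × X => z.1)
    have : Measurable (schurIntegrand k v w) :=
      (Complex.continuous_conj.measurable.comp (hkm.mul hvm)).mul hwm
    exact this.aestronglyMeasurable
  · refine (hk.lintegral_le v w).trans_lt ?_
    exact ENNReal.mul_lt_top ENNReal.coe_lt_top (by simp)

theorem IsSchurKernel.norm_integral_le (hk : IsSchurKernel μ k C) (v w : Lp ℂ 2 (μ.prod ν)) :
    ‖∫ z, schurIntegrand k v w z ∂(μ.prod ν).prod μ‖ ≤ C * (‖v‖ ^ 2 + ‖w‖ ^ 2) := by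
  have h := (enorm_integral_le_lintegral_enorm (μ := (μ.prod ν).prod μ)
    (schurIntegrand k v w)).trans (hk.lintegral_le v w)
  rw [← ENNReal.ofReal_add (by positivity) (by positivity), ← ENNReal.ofReal_coe_nnreal,
    ← ENNReal.ofReal_mul (by positivity), ← ofReal_norm,
    ENNReal.ofReal_le_ofReal_iff (by positivity)] at h
  exact h

theorem ae_swap_slot {p : X × Y → Prop} (h : ∀ᵐ z ∂μ.prod ν, p z) :
    ∀ᵐ z ∂(μ.prod ν).prod μ, p (z.2, z.1.2) := by
  have h1 : Measure.QuasiMeasurePreserving (fun z : (X × Y) × X => (z.1.2, z.2))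
      ((μ.prod ν).prod μ) (ν.prod μ) :=
    QuasiMeasurePreserving.prodMap Measure.quasiMeasurePreserving_snd
      (Measure.QuasiMeasurePreserving.id μ)
  exact ((Measure.measurePreserving_swap (μ := ν) (ν := μ)).quasiMeasurePreserving.comp h1).ae h


/-- The sesquilinear form of a kernel operator acting on the first variable. -/
def kernelForm (hk : IsSchurKernel μ k C) :
    Lp ℂ 2 (μ.prod ν) →L⋆[ℂ] Lp ℂ 2 (μ.prod ν) →L[ℂ] ℂ :=
  LinearMap.mkContinuous₂ (LinearMap.mk₂'ₛₗ (starRingEnd ℂ) (RingHom.id ℂ)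
    (fun v w => ∫ z, schurIntegrand k v w z ∂(μ.prod ν).prod μ)
    (fun v v' w => by
      rw [← integral_add (hk.integrable v w) (hk.integrable v' w)]
      refine integral_congr_ae ?_
      filter_upwards [ae_swap_slot (Lp.coeFn_add v v')] with z hz
      simp only [schurIntegrand, hz, Pi.add_apply, mul_add, star_add, add_mul])
    (fun c v w => by
      rw [smul_eq_mul, ← integral_const_mul]
      refine integral_congr_ae ?_
      filter_upwards [ae_swap_slot (Lp.coeFn_smul c v)] with z hz
      simp only [schurIntegrand, hz, Pi.smul_apply, smul_eq_mul, star_mul', RCLike.star_def]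
      ring)
    (fun v w w' => by
      rw [← integral_add (hk.integrable v w) (hk.integrable v w')]
      refine integral_congr_ae ?_
      filter_upwards [ae_fst (ν := μ) (Lp.coeFn_add w w')] with z hz
      simp only [schurIntegrand, hz, Pi.add_apply, mul_add])
    (fun c v w => by
      rw [smul_eq_mul, ← integral_const_mul]
      refine integral_congr_ae ?_
      filter_upwards [ae_fst (ν := μ) (Lp.coeFn_smul c w)] with z hz
      simp only [schurIntegrand, hz, Pi.smul_apply, smul_eq_mul, RingHom.id_apply]
      ring)) (2 * C) fun v w => by
    rcases eq_or_ne v 0 with rfl | hv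
    · rw [map_zero]; simp
    rcases eq_or_ne w 0 with rfl | hw
    · rw [map_zero]; simp
    have hv' : ‖v‖ ≠ 0 := norm_ne_zero_iff.2 hv
    have hw' : ‖w‖ ≠ 0 := norm_ne_zero_iff.2 hw
    -- Normalization turns the bound by a sum of squares into 2C ‖v‖ ‖w‖.
    have h1 := hk.norm_integral_le (((‖v‖ : ℂ)⁻¹) • v) (((‖w‖ : ℂ)⁻¹) • w)
    set B := LinearMap.mk₂'ₛₗ (starRingEnd ℂ) (RingHom.id ℂ)
      (fun v w : Lp ℂ 2 (μ.prod ν) => ∫ z, schurIntegrand k v w z ∂(μ.prod ν).prod μ) _ _ _ _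
    change ‖B (((‖v‖ : ℂ)⁻¹) • v) (((‖w‖ : ℂ)⁻¹) • w)‖ ≤ _ at h1
    rw [LinearMap.map_smulₛₗ, LinearMap.map_smulₛₗ B, LinearMap.smul_apply] at h1
    simp only [norm_smul, RingHom.id_apply, norm_inv, Complex.norm_real, norm_norm, RCLike.norm_conj] at h1
    rw [inv_mul_cancel₀ hv', inv_mul_cancel₀ hw', ← mul_assoc, ← mul_inv,
      inv_mul_le_iff₀ (by positivity)] at h1
    linarith

/-- The operator `(Kv)(x, y) = ∫ k(x, q) v(q, y) dμ(q)`. -/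
def kernelOp (hk : IsSchurKernel μ k C) (ν : Measure Y) [SFinite ν] :
    Lp ℂ 2 (μ.prod ν) →L[ℂ] Lp ℂ 2 (μ.prod ν) :=
  InnerProductSpace.continuousLinearMapOfBilin (kernelForm hk)

theorem inner_kernelOp (hk : IsSchurKernel μ k C) (v w : Lp ℂ 2 (μ.prod ν)) :
    inner ℂ (kernelOp hk ν v) w = ∫ z, schurIntegrand k v w z ∂(μ.prod ν).prod μ :=
  InnerProductSpace.continuousLinearMapOfBilin_apply _ _ _

theorem norm_kernelOp_le (hk : IsSchurKernel μ k C) : ‖kernelOp hk ν‖ ≤ 2 * C := by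
  refine ContinuousLinearMap.opNorm_le_bound _ (by positivity) fun v => ?_
  have h1 : ‖kernelForm hk (ν := ν)‖ ≤ 2 * C := LinearMap.mkContinuous₂_norm_le _ (by positivity) _
  have h2 : ‖kernelOp hk ν v‖ = ‖kernelForm hk (ν := ν) v‖ := by
    rw [kernelOp, InnerProductSpace.continuousLinearMapOfBilin]
    simp
  rw [h2]
  exact (ContinuousLinearMap.le_opNorm _ _).trans (by gcongr)

/-- Exchanging x and q in the triple integral preserves the measure and swaps the roles of v and w.
-/
theorem kernelOp_symm (hk : IsSchurKernel μ k C) (hherm : ∀ x q, k q x = star (k x q))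
    (v w : Lp ℂ 2 (μ.prod ν)) : inner ℂ (kernelOp hk ν v) w = inner ℂ v (kernelOp hk ν w) := by
  have hmp : MeasurePreserving (fun z : (X × Y) × X => ((z.2, z.1.2), z.1.1))
      ((μ.prod ν).prod μ) ((μ.prod ν).prod μ) := by
    have h1 := Measure.measurePreserving_swap (μ := μ.prod ν) (ν := μ)
    have h2 := (MeasurePreserving.id μ).prod (Measure.measurePreserving_swap (μ := μ) (ν := ν))
    have h3 := (measurePreserving_prodAssoc μ ν μ).symm
    exact h3.comp (h2.comp h1)
  rw [← inner_conj_symm v, inner_kernelOp, inner_kernelOp, ← integral_conj]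
  have hme : MeasurableEmbedding (fun z : (X × Y) × X => ((z.2, z.1.2), z.1.1)) := by
    have hm : Measurable (fun z : (X × Y) × X => ((z.2, z.1.2), z.1.1)) := hmp.measurable
    exact (MeasurableEquiv.mk (Equiv.mk _ (fun z : (X × Y) × X => ((z.2, z.1.2), z.1.1))
      (fun _ => rfl) fun _ => rfl) hm hm).measurableEmbedding
  rw [← hmp.integral_comp hme]
  refine integral_congr_ae (ae_of_all _ fun z => ?_)
  simp only [schurIntegrand, hherm z.1.1 z.2, map_mul, star_mul', RCLike.star_def,
    RCLike.conj_conj]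
  ring

/-- The operator is known only through its form; pairing with indicators of sets of finite measure
recovers the integral formula. -/
theorem kernelOp_ae' [SigmaFinite ν] [SigmaFinite μ] (hk : IsSchurKernel μ k C)
    (v : Lp ℂ 2 (μ.prod ν)) :
    kernelOp hk ν v =ᵐ[μ.prod ν] fun z => ∫ q, k z.1 q * v (q, z.2) ∂μ := by
  have key : ∀ s (hs : MeasurableSet s) (hνs : (μ.prod ν) s < ∞),
      Integrable (fun z : (X × Y) × X => s.indicator (fun _ => (1 : ℂ)) z.1 *
        (k z.1.1 z.2 * v (z.2, z.1.2))) ((μ.prod ν).prod μ) ∧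
      inner ℂ (indicatorConstLp 2 hs hνs.ne (1 : ℂ)) (kernelOp hk ν v) =
        ∫ z, s.indicator (fun _ => (1 : ℂ)) z.1 * (k z.1.1 z.2 * v (z.2, z.1.2))
          ∂(μ.prod ν).prod μ := by
    intro s hs hνs
    have h1 := hk.integrable v (indicatorConstLp 2 hs hνs.ne (1 : ℂ))
    have h2 : (fun z => star (schurIntegrand k v (indicatorConstLp 2 hs hνs.ne (1 : ℂ)) z))
        =ᵐ[(μ.prod ν).prod μ] fun z => s.indicator (fun _ => (1 : ℂ)) z.1 *
          (k z.1.1 z.2 * v (z.2, z.1.2)) := by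
      filter_upwards [ae_fst (ν := μ) (indicatorConstLp_coeFn (hs := hs) (hμs := hνs.ne)
        (c := (1 : ℂ)) (p := 2))] with z hz
      rw [schurIntegrand, hz, star_mul', star_star]
      by_cases hz2 : z.1 ∈ s
      · simp [hz2]
      · simp [hz2]
    refine ⟨?_, ?_⟩
    · refine Integrable.congr ?_ h2
      exact (Complex.conjLIE : ℂ ≃ₗᵢ[ℝ] ℂ).integrable_comp_iff.2 h1
    · rw [← inner_conj_symm, inner_kernelOp, ← integral_conj]
      exact integral_congr_ae h2
  have hind : ∀ s : Set (X × Y), (fun z : X × Y => ∫ q, s.indicator (fun _ => (1 : ℂ)) z *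
      (k z.1 q * v (q, z.2)) ∂μ) = s.indicator fun z => ∫ q, k z.1 q * v (q, z.2) ∂μ := by
    intro s
    ext y
    by_cases hy : y ∈ s <;> simp [hy]
  refine ae_eq_of_forall_setIntegral_eq_of_sigmaFinite (fun s hs hνs => ?_) (fun s hs hνs => ?_)
    fun s hs hνs => ?_
  · exact integrableOn_Lp_of_measure_ne_top _ (by norm_num) hνs.ne
  · have := (key s hs hνs).1.integral_prod_left
    simp only at this
    rw [hind] at this
    exact (integrable_indicator_iff hs).1 this
  · rw [← L2.inner_indicatorConstLp_one hs hνs.ne, (key s hs hνs).2,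
      integral_prod _ (key s hs hνs).1]
    simp only
    rw [hind, integral_indicator hs]

theorem kernelOp_ae [SigmaFinite ν] [SigmaFinite μ] (hk : IsSchurKernel μ k C)
    {v : Lp ℂ 2 (μ.prod ν)} {f : X × Y → ℂ} (hf : v =ᵐ[μ.prod ν] f) :
    kernelOp hk ν v =ᵐ[μ.prod ν] fun z => ∫ q, k z.1 q * f (q, z.2) ∂μ := by
  filter_upwards [kernelOp_ae' hk v, ae_snd (ae_ae_fst hf)] with z h1 h2
  rw [h1]
  refine integral_congr_ae ?_
  filter_upwards [h2] with q hq
  rw [hq]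

end Schur

/-! ### Splittings of a measure space into two factors -/

/-- A measure preserving identification of `Z` with `X × Y`. -/
structure Splitting (ζ : Measure Z) (μ : Measure X) (ν : Measure Y) where
  /-- The underlying measurable equivalence. -/
  equiv : Z ≃ᵐ X × Y
  measurePreserving : MeasurePreserving equiv ζ (μ.prod ν)

namespace Splitting

variable (e : Splitting ζ μ ν)

/-- Functions on `X × Y` as functions on `Z`. -/
def pull : Lp ℂ 2 (μ.prod ν) →L[ℂ] Lp ℂ 2 ζ :=
  (Lp.compMeasurePreservingₗᵢ ℂ e.equiv e.measurePreserving).toContinuousLinearMap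

/-- Functions on `Z` as functions on `X × Y`. -/
def push : Lp ℂ 2 ζ →L[ℂ] Lp ℂ 2 (μ.prod ν) :=
  (Lp.compMeasurePreservingₗᵢ ℂ e.equiv.symm e.measurePreserving.symm).toContinuousLinearMap

theorem pull_ae {v : Lp ℂ 2 (μ.prod ν)} {f : X × Y → ℂ} (hf : v =ᵐ[μ.prod ν] f) :
    e.pull v =ᵐ[ζ] fun z => f (e.equiv z) := by
  have h := e.measurePreserving.quasiMeasurePreserving.ae_eq hf
  exact (Lp.coeFn_compMeasurePreserving v e.measurePreserving).trans h

theorem push_ae {v : Lp ℂ 2 ζ} {f : Z → ℂ} (hf : v =ᵐ[ζ] f) :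
    e.push v =ᵐ[μ.prod ν] fun z => f (e.equiv.symm z) := by
  have h := e.measurePreserving.symm.quasiMeasurePreserving.ae_eq hf
  exact (Lp.coeFn_compMeasurePreserving v e.measurePreserving.symm).trans h

theorem pull_push (v : Lp ℂ 2 ζ) : e.pull (e.push v) = v := by
  refine Lp.ext ?_
  filter_upwards [e.pull_ae (e.push_ae (EventuallyEq.refl _ v))] with z hz
  rw [hz, MeasurableEquiv.symm_apply_apply]

theorem norm_pull_apply (v : Lp ℂ 2 (μ.prod ν)) : ‖e.pull v‖ = ‖v‖ :=
  (Lp.compMeasurePreservingₗᵢ ℂ e.equiv e.measurePreserving).norm_map v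

theorem norm_push_apply (v : Lp ℂ 2 ζ) : ‖e.push v‖ = ‖v‖ :=
  (Lp.compMeasurePreservingₗᵢ ℂ e.equiv.symm e.measurePreserving.symm).norm_map v

theorem inner_pull (v : Lp ℂ 2 (μ.prod ν)) (w : Lp ℂ 2 ζ) :
    inner ℂ (e.pull v) w = inner ℂ v (e.push w) := by
  rw [← e.pull_push w]
  have h := (Lp.compMeasurePreservingₗᵢ ℂ e.equiv e.measurePreserving).inner_map_map v (e.push w)
  have h2 : e.push (e.pull (e.push w)) = e.push w := by rw [e.pull_push]
  rw [h2]
  exact h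

theorem adjoint_pull : e.pull.adjoint = e.push :=
  ((ContinuousLinearMap.eq_adjoint_iff _ _).2 fun v w => by
    rw [← inner_conj_symm, ← e.inner_pull, inner_conj_symm]).symm

variable [SigmaFinite ν] [SigmaFinite μ]

/-- The operator `ψ ↦ G ⊗ ψ`, in the variables of a splitting. -/
def attach (G : Lp ℂ 2 μ) : Lp ℂ 2 ν →L[ℂ] Lp ℂ 2 ζ := e.pull ∘L tensor μ ν G

theorem attach_add (G G' : Lp ℂ 2 μ) : e.attach (G + G') = e.attach G + e.attach G' := by
  simp [attach]

theorem attach_smul (c : ℂ) (G : Lp ℂ 2 μ) : e.attach (c • G) = c • e.attach G := by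
  simp [attach]

theorem norm_attach_le (G : Lp ℂ 2 μ) : ‖e.attach G‖ ≤ ‖G‖ := by
  refine ContinuousLinearMap.opNorm_le_bound _ (norm_nonneg _) fun v => ?_
  rw [attach, ContinuousLinearMap.comp_apply, norm_pull_apply]
  exact (ContinuousLinearMap.le_opNorm _ _).trans (by gcongr; exact norm_tensor_le G)

theorem attach_ae {G : Lp ℂ 2 μ} {ψ : Lp ℂ 2 ν} {g : X → ℂ} {f : Y → ℂ}
    (hg : G =ᵐ[μ] g) (hf : ψ =ᵐ[ν] f) :
    e.attach G ψ =ᵐ[ζ] fun z => g (e.equiv z).1 * f (e.equiv z).2 :=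
  e.pull_ae (tensor_ae hg hf)

theorem adjoint_attach_ae {G : Lp ℂ 2 μ} {φ : Lp ℂ 2 ζ} {g : X → ℂ} {f : Z → ℂ}
    (hg : G =ᵐ[μ] g) (hf : φ =ᵐ[ζ] f) :
    (e.attach G).adjoint φ =ᵐ[ν] fun y => ∫ x, star (g x) * f (e.equiv.symm (x, y)) ∂μ := by
  rw [attach, ContinuousLinearMap.adjoint_comp, adjoint_pull, ContinuousLinearMap.comp_apply]
  have h1 := contraction_ae hg (e.push_ae hf)
  exact h1

variable {k : X → X → ℂ} {C : NNReal}

/-- A kernel operator acting on the first factor of a splitting. -/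
def kernel (hk : IsSchurKernel μ k C) : Lp ℂ 2 ζ →L[ℂ] Lp ℂ 2 ζ :=
  e.pull ∘L kernelOp hk ν ∘L e.push

theorem norm_kernel_le (hk : IsSchurKernel μ k C) : ‖e.kernel hk‖ ≤ 2 * C := by
  refine ContinuousLinearMap.opNorm_le_bound _ (by positivity) fun v => ?_
  rw [kernel, ContinuousLinearMap.comp_apply, norm_pull_apply, ContinuousLinearMap.comp_apply]
  refine (ContinuousLinearMap.le_opNorm _ _).trans ?_
  rw [norm_push_apply]
  gcongr
  exact norm_kernelOp_le hk

theorem kernel_symm (hk : IsSchurKernel μ k C) (hherm : ∀ x q, k q x = star (k x q))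
    (v w : Lp ℂ 2 ζ) : inner ℂ (e.kernel hk v) w = inner ℂ v (e.kernel hk w) := by
  rw [kernel, ContinuousLinearMap.comp_apply, inner_pull, ContinuousLinearMap.comp_apply,
    kernelOp_symm hk hherm, ContinuousLinearMap.comp_apply, ← inner_conj_symm v, inner_pull,
    inner_conj_symm, ContinuousLinearMap.comp_apply]

theorem kernel_ae (hk : IsSchurKernel μ k C) {v : Lp ℂ 2 ζ}
    {f : Z → ℂ} (hf : v =ᵐ[ζ] f) :
    e.kernel hk v =ᵐ[ζ] fun z =>
      ∫ q, k (e.equiv z).1 q * f (e.equiv.symm (q, (e.equiv z).2)) ∂μ := by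
  rw [kernel, ContinuousLinearMap.comp_apply, ContinuousLinearMap.comp_apply]
  have h1 := kernelOp_ae hk (e.push_ae hf)
  exact e.pull_ae h1

end Splitting

end ProductSpaces

end LocalSqueezing
end

noncomputable section

namespace LocalSqueezing

/-! ### Operators between the `n`-particle spaces -/

section Sectors

open scoped NNReal

variable {D : ℕ} {m : ℝ}

instance (n : ℕ) : SigmaFinite (nMeasure D m n) := by
  unfold nMeasure; infer_instance

/-- The action of a permutation on wave functions. -/
def permOp {n : ℕ} (σ : Equiv.Perm (Fin n)) :
    Lp ℂ 2 (nMeasure D m n) →ₗᵢ[ℂ] Lp ℂ 2 (nMeasure D m n) :=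
  Lp.compMeasurePreservingₗᵢ ℂ _ (measurePreserving_perm D m n σ)

theorem ae_perm {n : ℕ} (σ : Equiv.Perm (Fin n)) {P : (Fin n → Momentum D) → Prop}
    (h : ∀ᵐ p ∂nMeasure D m n, P p) : ∀ᵐ p ∂nMeasure D m n, P (p ∘ σ) :=
  (measurePreserving_perm D m n σ).quasiMeasurePreserving.ae h

theorem permOp_ae {n : ℕ} (σ : Equiv.Perm (Fin n)) {ψ : Lp ℂ 2 (nMeasure D m n)}
    {f : (Fin n → Momentum D) → ℂ} (hf : ψ =ᵐ[nMeasure D m n] f) :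
    permOp σ ψ =ᵐ[nMeasure D m n] fun p => f (p ∘ σ) :=
  (Lp.coeFn_compMeasurePreserving ψ (measurePreserving_perm D m n σ)).trans (ae_perm σ hf)

theorem mem_nParticle_iff {n : ℕ} {ψ : Lp ℂ 2 (nMeasure D m n)} :
    ψ ∈ nParticle D m n ↔ ∀ σ, permOp σ ψ = ψ := by
  rw [nParticle, Submodule.mem_iInf]
  rfl

theorem mem_nParticle_of_ae {n : ℕ} {ψ : Lp ℂ 2 (nMeasure D m n)}
    (h : ∀ σ : Equiv.Perm (Fin n), (fun p => ψ (p ∘ σ)) =ᵐ[nMeasure D m n] ψ) :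
    ψ ∈ nParticle D m n :=
  mem_nParticle_iff.2 fun σ => Lp.ext ((permOp_ae σ (EventuallyEq.refl _ _)).trans (h σ))

theorem ae_comp_perm {n : ℕ} (ψ : nParticle D m n) (σ : Equiv.Perm (Fin n)) :
    (ψ : Lp ℂ 2 (nMeasure D m n)) =ᵐ[nMeasure D m n]
      fun p => (ψ : Lp ℂ 2 (nMeasure D m n)) (p ∘ σ) := by
  have h := permOp_ae σ (EventuallyEq.refl _ (ψ : Lp ℂ 2 (nMeasure D m n)))
  rwa [mem_nParticle_iff.1 ψ.2 σ] at h

/-- Permutations act isometrically and fix χ. Paired with a symmetric vector, all slots are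
therefore equivalent. -/
theorem inner_permOp {n : ℕ} (χ : nParticle D m n) (σ : Equiv.Perm (Fin n))
    (ψ : Lp ℂ 2 (nMeasure D m n)) :
    inner ℂ (χ : Lp ℂ 2 (nMeasure D m n)) (permOp σ ψ) = inner ℂ (χ : Lp ℂ 2 _) ψ := by
  conv_lhs => rw [← mem_nParticle_iff.1 χ.2 σ]
  exact (permOp σ).inner_map_map _ _

/-! #### Permutations of coordinates -/

/-- The extension of a permutation by a fixed point `0`. -/
def extendPerm {n : ℕ} (σ : Equiv.Perm (Fin n)) : Equiv.Perm (Fin (n + 1)) :=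
  Equiv.Perm.decomposeFin.symm (0, σ)

@[simp] theorem extendPerm_zero {n : ℕ} (σ : Equiv.Perm (Fin n)) : extendPerm σ 0 = 0 := by
  simp [extendPerm]

@[simp] theorem extendPerm_succ {n : ℕ} (σ : Equiv.Perm (Fin n)) (j : Fin n) :
    extendPerm σ j.succ = (σ j).succ := by
  simp [extendPerm]

theorem cons_comp_extendPerm {M : Type*} {n : ℕ} (σ : Equiv.Perm (Fin n)) (q : M) (p : Fin n → M) :
    (Fin.cons q p : Fin (n + 1) → M) ∘ extendPerm σ = Fin.cons q (p ∘ σ) := by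
  ext j
  refine Fin.cases ?_ (fun j => ?_) j <;> simp

/-- A permutation maps the complement of i onto that of σ i. Moving both points to 0 by cycles gives
a permutation fixing 0, whose remainder is τ. -/
theorem exists_perm_removeNth {n : ℕ} (σ : Equiv.Perm (Fin (n + 1))) (i : Fin (n + 1)) :
    ∃ τ : Equiv.Perm (Fin n), ∀ j, σ (i.succAbove j) = (σ i).succAbove (τ j) := by
  set g : Equiv.Perm (Fin (n + 1)) := i.cycleRange.symm.trans (σ.trans (σ i).cycleRange) with hg
  have hg0 : g 0 = 0 := by simp [hg]
  have h1 : (Equiv.Perm.decomposeFin g).1 = 0 := by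
    have := Equiv.Perm.decomposeFin_symm_apply_zero (Equiv.Perm.decomposeFin g).1
      (Equiv.Perm.decomposeFin g).2
    rw [Prod.mk.eta, Equiv.symm_apply_apply, hg0] at this
    exact this.symm
  refine ⟨(Equiv.Perm.decomposeFin g).2, fun j => ?_⟩
  have h2 : g = extendPerm (Equiv.Perm.decomposeFin g).2 := by
    rw [extendPerm, ← h1, Prod.mk.eta, Equiv.symm_apply_apply]
  have h3 : g j.succ = ((Equiv.Perm.decomposeFin g).2 j).succ := by
    conv_lhs => rw [h2]
    exact extendPerm_succ _ _
  have h4 : g j.succ = (σ i).cycleRange (σ (i.succAbove j)) := by simp [hg]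
  rw [← Fin.cycleRange_symm_succ (σ i), ← h3, h4, Equiv.symm_apply_apply]

theorem removeNth_comp {M : Type*} {n : ℕ} {σ : Equiv.Perm (Fin (n + 1))} {i : Fin (n + 1)}
    {τ : Equiv.Perm (Fin n)} (h : ∀ j, σ (i.succAbove j) = (σ i).succAbove (τ j))
    (p : Fin (n + 1) → M) : i.removeNth (p ∘ σ) = ((σ i).removeNth p) ∘ τ := by
  ext j
  simp [Fin.removeNth, h]

theorem update_comp_perm {M : Type*} {n : ℕ} (σ : Equiv.Perm (Fin n)) (p : Fin n → M) (j : Fin n)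
    (q : M) : Function.update (p ∘ σ) j q = (Function.update p (σ j) q) ∘ σ := by
  ext i
  simp [Function.update_apply]

theorem removeNth_comp_cycleRange {M : Type*} {n : ℕ} (i : Fin (n + 1)) (p : Fin (n + 1) → M) :
    (0 : Fin (n + 1)).removeNth (p ∘ i.cycleRange.symm) = i.removeNth p := by
  ext j
  simp [Fin.removeNth]

/-! #### Splitting off one or two variables -/

/-- Splitting off the `i`-th variable. -/
def slot (m : ℝ) (n : ℕ) (i : Fin (n + 1)) :
    Splitting (nMeasure D m (n + 1)) (shellMeasure D m) (nMeasure D m n) :=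
  ⟨MeasurableEquiv.piFinSuccAbove (fun _ => Momentum D) i,
    measurePreserving_piFinSuccAbove (fun _ => shellMeasure D m) i⟩

theorem slot_equiv (n : ℕ) (i : Fin (n + 1)) (p : Fin (n + 1) → Momentum D) :
    (slot m n i).equiv p = (p i, i.removeNth p) := rfl

theorem slot_equiv_symm (n : ℕ) (i : Fin (n + 1)) (q : Momentum D) (p : Fin n → Momentum D) :
    (slot m n i).equiv.symm (q, p) = i.insertNth q p := rfl

/-- Splitting off two variables. -/
def pairSlot (m : ℝ) (n : ℕ) (i : Fin (n + 2)) (j : Fin (n + 1)) :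
    Splitting (nMeasure D m (n + 2)) ((shellMeasure D m).prod (shellMeasure D m))
      (nMeasure D m n) :=
  ⟨((slot m (n + 1) i).equiv.trans
      ((MeasurableEquiv.refl _).prodCongr (slot m n j).equiv)).trans MeasurableEquiv.prodAssoc.symm,
    (measurePreserving_prodAssoc _ _ _).symm.comp
      (((MeasurePreserving.id _).prod (slot m n j).measurePreserving).comp
        (slot m (n + 1) i).measurePreserving)⟩

theorem pairSlot_equiv_symm (n : ℕ) (i : Fin (n + 2)) (j : Fin (n + 1))
    (q : Momentum D × Momentum D) (p : Fin n → Momentum D) :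
    (pairSlot m n i j).equiv.symm (q, p) = i.insertNth q.1 (j.insertNth q.2 p) := rfl

theorem attach_slot_ae {n : ℕ} (i : Fin (n + 1)) {F : OneParticle D m}
    {ψ : Lp ℂ 2 (nMeasure D m n)} {g : Momentum D → ℂ} {f : (Fin n → Momentum D) → ℂ}
    (hg : F =ᵐ[shellMeasure D m] g) (hf : ψ =ᵐ[nMeasure D m n] f) :
    (slot m n i).attach F ψ =ᵐ[nMeasure D m (n + 1)] fun p => g (p i) * f (i.removeNth p) :=
  (slot m n i).attach_ae hg hf

theorem adjoint_attach_slot_ae {n : ℕ} {F : OneParticle D m}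
    {χ : Lp ℂ 2 (nMeasure D m (n + 1))} {g : Momentum D → ℂ} {f : (Fin (n + 1) → Momentum D) → ℂ}
    (hg : F =ᵐ[shellMeasure D m] g) (hf : χ =ᵐ[nMeasure D m (n + 1)] f) :
    ((slot m n 0).attach F).adjoint χ =ᵐ[nMeasure D m n]
      fun p => ∫ q, star (g q) * f (Fin.cons q p) ∂shellMeasure D m := by
  have h := (slot m n 0).adjoint_attach_ae hg hf
  simp only [slot_equiv_symm, Fin.insertNth_zero'] at h
  exact h

theorem attach_pairSlot_ae {n : ℕ} (i : Fin (n + 2)) (j : Fin (n + 1))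
    {G : Lp ℂ 2 ((shellMeasure D m).prod (shellMeasure D m))}
    {ψ : Lp ℂ 2 (nMeasure D m n)} {g : Momentum D × Momentum D → ℂ}
    {f : (Fin n → Momentum D) → ℂ}
    (hg : G =ᵐ[(shellMeasure D m).prod (shellMeasure D m)] g) (hf : ψ =ᵐ[nMeasure D m n] f) :
    (pairSlot m n i j).attach G ψ =ᵐ[nMeasure D m (n + 2)]
      fun p => g (p i, i.removeNth p j) * f (j.removeNth (i.removeNth p)) :=
  (pairSlot m n i j).attach_ae hg hf

theorem adjoint_attach_pairSlot_ae {n : ℕ}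
    {G : Lp ℂ 2 ((shellMeasure D m).prod (shellMeasure D m))}
    {χ : Lp ℂ 2 (nMeasure D m (n + 2))} {g : Momentum D × Momentum D → ℂ}
    {f : (Fin (n + 2) → Momentum D) → ℂ}
    (hg : G =ᵐ[(shellMeasure D m).prod (shellMeasure D m)] g)
    (hf : χ =ᵐ[nMeasure D m (n + 2)] f) :
    ((pairSlot m n 0 0).attach G).adjoint χ =ᵐ[nMeasure D m n]
      fun p => ∫ q, star (g q) * f (Fin.cons q.1 (Fin.cons q.2 p))
        ∂(shellMeasure D m).prod (shellMeasure D m) := by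
  have h := (pairSlot m n 0 0).adjoint_attach_ae hg hf
  simp only [pairSlot_equiv_symm, Fin.insertNth_zero'] at h
  exact h

variable {k : Momentum D → Momentum D → ℂ} {C : ℝ≥0}

/-- A kernel operator acting on the `i`-th variable. -/
def kernelAt (hk : IsSchurKernel (shellMeasure D m) k C) :
    (n : ℕ) → Fin n → Lp ℂ 2 (nMeasure D m n) →L[ℂ] Lp ℂ 2 (nMeasure D m n)
  | 0, _ => 0
  | n + 1, i => (slot m n i).kernel hk

variable (hk : IsSchurKernel (shellMeasure D m) k C)

theorem kernelAt_ae {n : ℕ} (i : Fin n) {ψ : Lp ℂ 2 (nMeasure D m n)}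
    {f : (Fin n → Momentum D) → ℂ} (hf : ψ =ᵐ[nMeasure D m n] f) :
    kernelAt hk n i ψ =ᵐ[nMeasure D m n]
      fun p => ∫ q, k (p i) q * f (Function.update p i q) ∂shellMeasure D m := by
  cases n with
  | zero => exact i.elim0
  | succ n =>
    have h := (slot m n i).kernel_ae hk hf
    simp only [slot_equiv_symm, slot_equiv, Fin.insertNth_removeNth] at h
    exact h

theorem norm_kernelAt_le {n : ℕ} (i : Fin n) : ‖kernelAt hk n i‖ ≤ 2 * C := by
  cases n with
  | zero => exact i.elim0
  | succ n => exact (slot m n i).norm_kernel_le hk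

theorem kernelAt_symm (hherm : ∀ x q, k q x = star (k x q)) {n : ℕ} (i : Fin n)
    (v w : Lp ℂ 2 (nMeasure D m n)) :
    inner ℂ (kernelAt hk n i v) w = inner ℂ v (kernelAt hk n i w) := by
  cases n with
  | zero => exact i.elim0
  | succ n => exact (slot m n i).kernel_symm hk hherm v w

/-- The identification of a space with its product with a point. -/
def unitSplitting (μ : Measure (Momentum D)) [SFinite μ] :
    Splitting μ μ (Measure.dirac ()) where
  equiv := 
    { toFun := fun p => (p, ())
      invFun := Prod.fst
      left_inv := fun _ => rfl
      right_inv := fun _ => rfl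
      measurable_toFun := measurable_id.prodMk measurable_const
      measurable_invFun := measurable_fst }
  measurePreserving := by
    refine ⟨measurable_id.prodMk measurable_const, ?_⟩
    rw [Measure.prod_dirac]
    rfl

/-- The kernel operator on the one-particle space. -/
def oneKernel : OneParticle D m →L[ℂ] OneParticle D m :=
  (unitSplitting (shellMeasure D m)).kernel hk

theorem oneKernel_ae {F : OneParticle D m} {g : Momentum D → ℂ} (hg : F =ᵐ[shellMeasure D m] g) :
    oneKernel hk F =ᵐ[shellMeasure D m] fun p => ∫ q, k p q * g q ∂shellMeasure D m := by
  have h := (unitSplitting (shellMeasure D m)).kernel_ae hk hg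
  exact h

/-! #### The operators on bosonic wave functions -/

/-- A permutation of the remaining variables extends to one fixing the integrated variable, and χ is
invariant under the extension. -/
theorem adjoint_attach_slot_mem {n : ℕ} (F : OneParticle D m) (χ : nParticle D m (n + 1)) :
    ((slot m n 0).attach F).adjoint (χ : Lp ℂ 2 _) ∈ nParticle D m n := by
  refine mem_nParticle_of_ae fun σ => ?_
  have h1 := adjoint_attach_slot_ae (EventuallyEq.refl _ F)
    (EventuallyEq.refl _ (χ : Lp ℂ 2 (nMeasure D m (n + 1))))
  have h2 := adjoint_attach_slot_ae (EventuallyEq.refl _ F) (ae_comp_perm χ (extendPerm σ))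
  filter_upwards [ae_perm σ h1, h2] with p h3 h4
  rw [h3, h4]
  simp only [cons_comp_extendPerm]

/-- The annihilation operator `a(F)` on `n + 1` particles. -/
def annSector (F : OneParticle D m) (n : ℕ) : nParticle D m (n + 1) →L[ℂ] nParticle D m n :=
  (√(n + 1 : ℝ) : ℂ) • (((slot m n 0).attach F).adjoint ∘L
    (nParticle D m (n + 1)).subtypeL).codRestrict _ fun χ => adjoint_attach_slot_mem F χ

theorem coe_annSector (F : OneParticle D m) (n : ℕ) (χ : nParticle D m (n + 1)) :
    (annSector F n χ : Lp ℂ 2 (nMeasure D m n)) =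
      (√(n + 1 : ℝ) : ℂ) • ((slot m n 0).attach F).adjoint (χ : Lp ℂ 2 _) := rfl

theorem adjoint_attach_pairSlot_mem {n : ℕ}
    (G : Lp ℂ 2 ((shellMeasure D m).prod (shellMeasure D m))) (χ : nParticle D m (n + 2)) :
    ((pairSlot m n 0 0).attach G).adjoint (χ : Lp ℂ 2 _) ∈ nParticle D m n := by
  refine mem_nParticle_of_ae fun σ => ?_
  have h1 := adjoint_attach_pairSlot_ae (EventuallyEq.refl _ G)
    (EventuallyEq.refl _ (χ : Lp ℂ 2 (nMeasure D m (n + 2))))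
  have h2 := adjoint_attach_pairSlot_ae (EventuallyEq.refl _ G)
    (ae_comp_perm χ (extendPerm (extendPerm σ)))
  filter_upwards [ae_perm σ h1, h2] with p h3 h4
  rw [h3, h4]
  simp only [cons_comp_extendPerm]

/-- The operator annihilating a pair with wave function `G` on `n + 2` particles. -/
def pairAnnSector (G : Lp ℂ 2 ((shellMeasure D m).prod (shellMeasure D m))) (n : ℕ) :
    nParticle D m (n + 2) →L[ℂ] nParticle D m n :=
  (√((n + 1 : ℝ) * (n + 2)) : ℂ) • (((pairSlot m n 0 0).attach G).adjoint ∘L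
    (nParticle D m (n + 2)).subtypeL).codRestrict _ fun χ => adjoint_attach_pairSlot_mem G χ

theorem coe_pairAnnSector (G : Lp ℂ 2 ((shellMeasure D m).prod (shellMeasure D m))) (n : ℕ)
    (χ : nParticle D m (n + 2)) :
    (pairAnnSector G n χ : Lp ℂ 2 (nMeasure D m n)) =
      (√((n + 1 : ℝ) * (n + 2)) : ℂ) • ((pairSlot m n 0 0).attach G).adjoint (χ : Lp ℂ 2 _) := rfl

theorem coeFn_sum_ae {X ι : Type*} [MeasurableSpace X] {μ : Measure X} (s : Finset ι)
    {v : ι → Lp ℂ 2 μ} {f : ι → X → ℂ} (h : ∀ i, v i =ᵐ[μ] f i) :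
    ((∑ i ∈ s, v i : Lp ℂ 2 μ) : X → ℂ) =ᵐ[μ] fun x => ∑ i ∈ s, f i x := by
  classical
  induction s using Finset.induction_on with
  | empty =>
    simp only [Finset.sum_empty]
    exact Lp.coeFn_zero ℂ 2 μ
  | insert a s ha ih =>
    rw [Finset.sum_insert ha]
    filter_upwards [Lp.coeFn_add (v a) (∑ i ∈ s, v i), ih, h a] with x h1 h2 h3
    rw [h1, Pi.add_apply, h2, h3, Finset.sum_insert ha]

/-- A permutation σ carries the operator at variable i to the one at σ i and so only permutes the
summands. -/
theorem sum_kernelAt_mem {n : ℕ} (χ : nParticle D m n) :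
    ∑ i, kernelAt hk n i (χ : Lp ℂ 2 _) ∈ nParticle D m n := by
  refine mem_nParticle_of_ae fun σ => ?_
  have h1 := coeFn_sum_ae Finset.univ fun i =>
    kernelAt_ae hk i (EventuallyEq.refl _ (χ : Lp ℂ 2 (nMeasure D m n)))
  have h2 := coeFn_sum_ae Finset.univ fun i => kernelAt_ae hk i (ae_comp_perm χ σ)
  filter_upwards [ae_perm σ h1, h2] with p h3 h4
  rw [h3, h4]
  simp only [update_comp_perm]
  exact Equiv.sum_comp σ fun i => ∫ q, k (p i) q *
    (χ : Lp ℂ 2 (nMeasure D m n)) (Function.update p i q ∘ σ) ∂shellMeasure D m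

/-- The second quantization of a kernel operator on `n` particles. -/
def scatSector (n : ℕ) : nParticle D m n →L[ℂ] nParticle D m n :=
  ((∑ i, kernelAt hk n i) ∘L (nParticle D m n).subtypeL).codRestrict _ fun χ => by
    have h := sum_kernelAt_mem hk χ
    simpa using h

theorem coe_scatSector (n : ℕ) (χ : nParticle D m n) :
    (scatSector hk n χ : Lp ℂ 2 (nMeasure D m n)) = ∑ i, kernelAt hk n i (χ : Lp ℂ 2 _) := by
  simp [scatSector]

theorem norm_annSector_le (F : OneParticle D m) (n : ℕ) :
    ‖annSector F n‖ ≤ √(n + 1 : ℝ) * ‖F‖ := by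
  refine ContinuousLinearMap.opNorm_le_bound _ (by positivity) fun χ => ?_
  rw [Submodule.coe_norm, coe_annSector, norm_smul, Complex.norm_real,
    Real.norm_of_nonneg (Real.sqrt_nonneg _), mul_assoc]
  gcongr
  refine (ContinuousLinearMap.le_opNorm _ _).trans ?_
  rw [LinearIsometryEquiv.norm_map]
  gcongr
  · exact (slot m n 0).norm_attach_le F
  · exact le_rfl

theorem norm_pairAnnSector_le (G : Lp ℂ 2 ((shellMeasure D m).prod (shellMeasure D m))) (n : ℕ) :
    ‖pairAnnSector G n‖ ≤ √((n + 1 : ℝ) * (n + 2)) * ‖G‖ := by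
  refine ContinuousLinearMap.opNorm_le_bound _ (by positivity) fun χ => ?_
  rw [Submodule.coe_norm, coe_pairAnnSector, norm_smul, Complex.norm_real,
    Real.norm_of_nonneg (Real.sqrt_nonneg _), mul_assoc]
  gcongr
  refine (ContinuousLinearMap.le_opNorm _ _).trans ?_
  rw [LinearIsometryEquiv.norm_map]
  gcongr
  · exact (pairSlot m n 0 0).norm_attach_le G
  · exact le_rfl

theorem norm_scatSector_le (n : ℕ) : ‖scatSector hk n‖ ≤ n * (2 * C) := by
  refine ContinuousLinearMap.opNorm_le_bound _ (by positivity) fun χ => ?_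
  rw [Submodule.coe_norm, coe_scatSector]
  refine (norm_sum_le _ _).trans ?_
  have : ∀ i ∈ Finset.univ, ‖kernelAt hk n i (χ : Lp ℂ 2 _)‖ ≤ 2 * C * ‖χ‖ := fun i _ => by
    refine (ContinuousLinearMap.le_opNorm _ _).trans ?_
    gcongr
    · exact norm_kernelAt_le hk i
    · exact le_rfl
  refine (Finset.sum_le_sum this).trans ?_
  simp [mul_assoc]

theorem scatSector_symm (hherm : ∀ x q, k q x = star (k x q)) (n : ℕ) (v w : nParticle D m n) :
    inner ℂ (scatSector hk n v) w = inner ℂ v (scatSector hk n w) := by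
  rw [Submodule.coe_inner, Submodule.coe_inner, coe_scatSector, coe_scatSector, sum_inner,
    inner_sum]
  exact Finset.sum_congr rfl fun i _ => kernelAt_symm hk hherm i _ _

end Sectors

end LocalSqueezing
end

noncomputable section

namespace LocalSqueezing

section Creation

open scoped NNReal

variable {D : ℕ} {m : ℝ}

/-! ### Creation operators as sums, and commutators -/

theorem attach_slot_eq_permOp {n : ℕ} (i : Fin (n + 1)) (F : OneParticle D m)
    (ψ : Lp ℂ 2 (nMeasure D m n)) :
    (slot m n i).attach F ψ = permOp i.cycleRange.symm ((slot m n 0).attach F ψ) := by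
  refine Lp.ext ?_
  filter_upwards [attach_slot_ae i (EventuallyEq.refl _ F) (EventuallyEq.refl _ ψ),
    permOp_ae i.cycleRange.symm
      (attach_slot_ae 0 (EventuallyEq.refl _ F) (EventuallyEq.refl _ ψ))] with p h1 h2
  rw [h1, h2, removeNth_comp_cycleRange]
  simp

theorem attach_pairSlot_eq_permOp {n : ℕ} (i : Fin (n + 2)) (j : Fin (n + 1))
    (G : Lp ℂ 2 ((shellMeasure D m).prod (shellMeasure D m))) (ψ : Lp ℂ 2 (nMeasure D m n)) :
    (pairSlot m n i j).attach G ψ =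
      permOp ((extendPerm j.cycleRange.symm).trans i.cycleRange.symm)
        ((pairSlot m n 0 0).attach G ψ) := by
  refine Lp.ext ?_
  filter_upwards [attach_pairSlot_ae i j (EventuallyEq.refl _ G) (EventuallyEq.refl _ ψ),
    permOp_ae ((extendPerm j.cycleRange.symm).trans i.cycleRange.symm)
      (attach_pairSlot_ae 0 0 (EventuallyEq.refl _ G) (EventuallyEq.refl _ ψ))] with p h1 h2
  rw [h1, h2]
  have h3 : ∀ l : Fin (n + 1), (0 : Fin (n + 2)).removeNth
      (p ∘ ((extendPerm j.cycleRange.symm).trans i.cycleRange.symm)) l =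
      (i.removeNth p) (j.cycleRange.symm l) := fun l => by simp [Fin.removeNth]
  have h4 : (0 : Fin (n + 1)).removeNth ((0 : Fin (n + 2)).removeNth
      (p ∘ ((extendPerm j.cycleRange.symm).trans i.cycleRange.symm))) =
      j.removeNth (i.removeNth p) := by
    ext1 l
    rw [Fin.removeNth_apply 0, h3]
    simp [Fin.removeNth]
  rw [h4, h3]
  simp

/-- The permutation σ carries the summand with F at i to the one with F at σ i, up to a permutation
of the remaining variables that ψ absorbs. -/
theorem sum_attach_slot_mem {n : ℕ} (F : OneParticle D m) (ψ : nParticle D m n) :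
    ∑ i, (slot m n i).attach F (ψ : Lp ℂ 2 _) ∈ nParticle D m (n + 1) := by
  refine mem_nParticle_iff.2 fun σ => ?_
  rw [map_sum, ← Equiv.sum_comp σ fun i => (slot m n i).attach F (ψ : Lp ℂ 2 _)]
  refine Finset.sum_congr rfl fun i _ => ?_
  obtain ⟨τ, hτ⟩ := exists_perm_removeNth σ i
  refine Lp.ext ?_
  filter_upwards [permOp_ae σ (attach_slot_ae i (EventuallyEq.refl _ F)
    (EventuallyEq.refl _ (ψ : Lp ℂ 2 (nMeasure D m n)))),
    attach_slot_ae (σ i) (EventuallyEq.refl _ F) (ae_comp_perm ψ τ)] with p h1 h2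
  rw [h1, h2, removeNth_comp hτ]
  rfl

theorem sum_attach_pairSlot_mem {n : ℕ}
    (G : Lp ℂ 2 ((shellMeasure D m).prod (shellMeasure D m))) (ψ : nParticle D m n) :
    ∑ i, ∑ j, (pairSlot m n i j).attach G (ψ : Lp ℂ 2 _) ∈ nParticle D m (n + 2) := by
  refine mem_nParticle_iff.2 fun σ => ?_
  rw [map_sum, ← Equiv.sum_comp σ fun i => ∑ j, (pairSlot m n i j).attach G (ψ : Lp ℂ 2 _)]
  refine Finset.sum_congr rfl fun i _ => ?_
  obtain ⟨τ, hτ⟩ := exists_perm_removeNth σ i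
  rw [map_sum, ← Equiv.sum_comp τ fun j => (pairSlot m n (σ i) j).attach G (ψ : Lp ℂ 2 _)]
  refine Finset.sum_congr rfl fun j _ => ?_
  obtain ⟨τ', hτ'⟩ := exists_perm_removeNth τ j
  refine Lp.ext ?_
  filter_upwards [permOp_ae σ (attach_pairSlot_ae i j (EventuallyEq.refl _ G)
    (EventuallyEq.refl _ (ψ : Lp ℂ 2 (nMeasure D m n)))),
    attach_pairSlot_ae (σ i) (τ j) (EventuallyEq.refl _ G) (ae_comp_perm ψ τ')] with p h1 h2
  rw [h1, h2, removeNth_comp hτ, removeNth_comp hτ']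
  rfl

/-- Paired with a symmetric vector all n + 1 slots contribute equally, and (n + 1)/√(n + 1) = √(n +
1). -/
theorem coe_adjoint_annSector (F : OneParticle D m) (n : ℕ) (ψ : nParticle D m n) :
    ((annSector F n).adjoint ψ : Lp ℂ 2 (nMeasure D m (n + 1))) =
      (√(n + 1 : ℝ) : ℂ)⁻¹ • ∑ i, (slot m n i).attach F (ψ : Lp ℂ 2 _) := by
  have hmem : (√(n + 1 : ℝ) : ℂ)⁻¹ • ∑ i, (slot m n i).attach F (ψ : Lp ℂ 2 _) ∈
      nParticle D m (n + 1) := Submodule.smul_mem _ _ (sum_attach_slot_mem F ψ)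
  have h : (annSector F n).adjoint ψ = ⟨_, hmem⟩ := by
    refine ext_inner_left ℂ fun χ => ?_
    rw [ContinuousLinearMap.adjoint_inner_right, Submodule.coe_inner, Submodule.coe_inner,
      coe_annSector, inner_smul_left, ContinuousLinearMap.adjoint_inner_left, inner_smul_right,
      inner_sum]
    have h1 : ∀ i ∈ Finset.univ, inner ℂ (χ : Lp ℂ 2 (nMeasure D m (n + 1)))
        ((slot m n i).attach F (ψ : Lp ℂ 2 _)) =
        inner ℂ (χ : Lp ℂ 2 _) ((slot m n 0).attach F (ψ : Lp ℂ 2 _)) := fun i _ => by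
      rw [attach_slot_eq_permOp, inner_permOp]
    rw [Finset.sum_congr rfl h1, Finset.sum_const, Finset.card_univ, Fintype.card_fin,
      nsmul_eq_mul, Complex.conj_ofReal, ← mul_assoc]
    congr 1
    have h2 : (√(n + 1 : ℝ) : ℂ) * (√(n + 1 : ℝ) : ℂ) = n + 1 := by
      rw [← Complex.ofReal_mul, Real.mul_self_sqrt (by positivity)]
      push_cast; rfl
    have h3 : (√(n + 1 : ℝ) : ℂ) ≠ 0 := by
      exact_mod_cast (Real.sqrt_pos.2 (by positivity)).ne'
    push_cast
    rw [← h2]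
    field_simp
  rw [h]

/-- The same count, with (n + 2)(n + 1) ordered pairs of slots. -/
theorem coe_adjoint_pairAnnSector (G : Lp ℂ 2 ((shellMeasure D m).prod (shellMeasure D m)))
    (n : ℕ) (ψ : nParticle D m n) :
    ((pairAnnSector G n).adjoint ψ : Lp ℂ 2 (nMeasure D m (n + 2))) =
      (√((n + 1 : ℝ) * (n + 2)) : ℂ)⁻¹ •
        ∑ i, ∑ j, (pairSlot m n i j).attach G (ψ : Lp ℂ 2 _) := by
  have hmem : (√((n + 1 : ℝ) * (n + 2)) : ℂ)⁻¹ •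
      ∑ i, ∑ j, (pairSlot m n i j).attach G (ψ : Lp ℂ 2 _) ∈
      nParticle D m (n + 2) := Submodule.smul_mem _ _ (sum_attach_pairSlot_mem G ψ)
  have h : (pairAnnSector G n).adjoint ψ = ⟨_, hmem⟩ := by
    refine ext_inner_left ℂ fun χ => ?_
    rw [ContinuousLinearMap.adjoint_inner_right, Submodule.coe_inner, Submodule.coe_inner,
      coe_pairAnnSector, inner_smul_left, ContinuousLinearMap.adjoint_inner_left,
      inner_smul_right]
    simp only [inner_sum]
    have h1 : ∀ i j, inner ℂ (χ : Lp ℂ 2 (nMeasure D m (n + 2)))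
        ((pairSlot m n i j).attach G (ψ : Lp ℂ 2 _)) =
        inner ℂ (χ : Lp ℂ 2 _) ((pairSlot m n 0 0).attach G (ψ : Lp ℂ 2 _)) := fun i j => by
      rw [attach_pairSlot_eq_permOp, inner_permOp]
    simp only [h1, Finset.sum_const, Finset.card_univ, Fintype.card_fin]
    rw [nsmul_eq_mul, nsmul_eq_mul, Complex.conj_ofReal, ← mul_assoc, ← mul_assoc]
    congr 1
    have h2 : (√((n + 1 : ℝ) * (n + 2)) : ℂ) * (√((n + 1 : ℝ) * (n + 2)) : ℂ) =
        (n + 1) * (n + 2) := by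
      rw [← Complex.ofReal_mul, Real.mul_self_sqrt (by positivity)]
      push_cast; rfl
    have h3 : (√((n + 1 : ℝ) * (n + 2)) : ℂ) ≠ 0 := by
      exact_mod_cast (Real.sqrt_pos.2 (by positivity)).ne'
    push_cast
    rw [mul_assoc, mul_comm ((n : ℂ) + 2), ← h2]
    field_simp
  rw [h]

/-! ### Commutators of quadratic and linear operators between sectors -/

variable {k : Momentum D → Momentum D → ℂ} {C : ℝ≥0}
variable (hk : IsSchurKernel (shellMeasure D m) k C)

theorem kernelAt_attach_self {n : ℕ} (i : Fin (n + 1)) (F : OneParticle D m)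
    (ψ : Lp ℂ 2 (nMeasure D m n)) :
    kernelAt hk (n + 1) i ((slot m n i).attach F ψ) = (slot m n i).attach (oneKernel hk F) ψ := by
  refine Lp.ext ?_
  filter_upwards [kernelAt_ae hk i (attach_slot_ae i (EventuallyEq.refl _ F)
    (EventuallyEq.refl _ ψ)), attach_slot_ae i (oneKernel_ae hk (EventuallyEq.refl _ F))
    (EventuallyEq.refl _ ψ)] with p h1 h2
  rw [h1, h2, ← integral_mul_const]
  refine integral_congr_ae (ae_of_all _ fun q => ?_)
  simp only [Function.update_self, Fin.removeNth_update, mul_assoc]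

theorem kernelAt_attach_succAbove {n : ℕ} (i : Fin (n + 1)) (j : Fin n) (F : OneParticle D m)
    (ψ : Lp ℂ 2 (nMeasure D m n)) :
    kernelAt hk (n + 1) (i.succAbove j) ((slot m n i).attach F ψ) =
      (slot m n i).attach F (kernelAt hk n j ψ) := by
  refine Lp.ext ?_
  filter_upwards [kernelAt_ae hk (i.succAbove j) (attach_slot_ae i (EventuallyEq.refl _ F)
    (EventuallyEq.refl _ ψ)), attach_slot_ae i (EventuallyEq.refl _ F)
    (kernelAt_ae hk j (EventuallyEq.refl _ ψ))] with p h1 h2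
  rw [h1, h2, ← integral_const_mul]
  refine integral_congr_ae (ae_of_all _ fun q => ?_)
  simp only [Fin.removeNth_update_succAbove, Fin.removeNth_apply,
    Function.update_of_ne (Fin.succAbove_ne i j).symm]
  ring

/-- Leibniz rule: of the n + 1 kernel operators, the one at the slot of F acts on F and the others
act on ψ. -/
theorem scatSector_comp_cre (F : OneParticle D m) (n : ℕ) (ψ : nParticle D m n) :
    scatSector hk (n + 1) ((annSector F n).adjoint ψ) =
      (annSector (oneKernel hk F) n).adjoint ψ + (annSector F n).adjoint (scatSector hk n ψ) := by
  have hadd : ∀ v w : nParticle D m (n + 1), ((v + w : nParticle D m (n + 1)) :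
      Lp ℂ 2 (nMeasure D m (n + 1))) = v + w := fun _ _ => rfl
  have e1 := coe_adjoint_annSector F n ψ
  have e2 := coe_adjoint_annSector (oneKernel hk F) n ψ
  have e3 := coe_adjoint_annSector F n (scatSector hk n ψ)
  have e4 := coe_scatSector hk n ψ
  -- The identity in the ambient L² space, free of the symmetric subspaces.
  have e5 : ∑ i, kernelAt hk (n + 1) i
        ((√(n + 1 : ℝ) : ℂ)⁻¹ • ∑ i, (slot m n i).attach F (ψ : Lp ℂ 2 (nMeasure D m n))) =
      (√(n + 1 : ℝ) : ℂ)⁻¹ • ∑ i, (slot m n i).attach (oneKernel hk F) (ψ : Lp ℂ 2 _) +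
      (√(n + 1 : ℝ) : ℂ)⁻¹ • ∑ i, (slot m n i).attach F
        (∑ j, kernelAt hk n j (ψ : Lp ℂ 2 _)) := by
    rw [← smul_add]
    simp only [map_smul, ← Finset.smul_sum, map_sum]
    congr 1
    rw [Finset.sum_comm, ← Finset.sum_add_distrib]
    refine Finset.sum_congr rfl fun i _ => ?_
    rw [Fin.sum_univ_succAbove _ i, kernelAt_attach_self]
    simp only [kernelAt_attach_succAbove]
  refine Subtype.ext (Eq.trans ?_ (hadd _ _).symm)
  refine (coe_scatSector hk (n + 1) _).trans
    ((congrArg (fun v => ∑ i, kernelAt hk (n + 1) i v) e1).trans (e5.trans ?_))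
  exact congrArg₂ (· + ·) e2.symm ((congrArg (fun v => (√(n + 1 : ℝ) : ℂ)⁻¹ •
    ∑ i, (slot m n i).attach F v) e4.symm).trans e3.symm)

/-- This three-cycle identifies F(p₀) G(p₁, p₂) with G(p₀, p₁) F(p₂) after renaming the variables.
-/
theorem exists_perm_rotate (n : ℕ) : ∃ σ : Equiv.Perm (Fin (n + 3)), σ 0 = Fin.succ 0 ∧
    σ (Fin.succ 0) = Fin.succ (Fin.succ 0) ∧ σ (Fin.succ (Fin.succ 0)) = 0 ∧
    ∀ l : Fin n, σ l.succ.succ.succ = l.succ.succ.succ :=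
  ⟨(Fin.succ (Fin.succ 0)).cycleRange, by
      have h := (Fin.succ (Fin.succ 0) : Fin (n + 3)).cycleRange_succAbove 0
      simpa only [Fin.succ_succAbove_succ, Fin.succ_succAbove_zero, Fin.zero_succAbove] using h, by
      have h := (Fin.succ (Fin.succ 0) : Fin (n + 3)).cycleRange_succAbove (Fin.succ 0)
      simpa only [Fin.succ_succAbove_succ, Fin.succ_succAbove_zero, Fin.zero_succAbove] using h,
    Fin.cycleRange_self _, fun l => by
      have h := (Fin.succ (Fin.succ 0) : Fin (n + 3)).cycleRange_succAbove l.succ.succ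
      simpa only [Fin.succ_succAbove_succ, Fin.succ_succAbove_zero, Fin.zero_succAbove] using h⟩

theorem attach_slot_pairSlot_eq_permOp {n : ℕ} (F : OneParticle D m)
    (G : Lp ℂ 2 ((shellMeasure D m).prod (shellMeasure D m))) (ψ : Lp ℂ 2 (nMeasure D m n)) :
    ∃ σ, (slot m (n + 2) 0).attach F ((pairSlot m n 0 0).attach G ψ) =
      permOp σ ((pairSlot m (n + 1) 0 0).attach G ((slot m n 0).attach F ψ)) := by
  obtain ⟨σ, h0, h1, h2, h3⟩ := exists_perm_rotate n
  refine ⟨σ, Lp.ext ?_⟩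
  filter_upwards [attach_slot_ae 0 (EventuallyEq.refl _ F) (attach_pairSlot_ae 0 0
    (EventuallyEq.refl _ G) (EventuallyEq.refl _ ψ)), permOp_ae σ (attach_pairSlot_ae 0 0
    (EventuallyEq.refl _ G) (attach_slot_ae 0
    (EventuallyEq.refl _ F) (EventuallyEq.refl _ ψ)))] with p h4 h5
  rw [h4, h5]
  simp only [Fin.removeNth_apply, Fin.removeNth_zero, Fin.tail_def, Function.comp_apply,
    h0, h1, h2, h3, Fin.zero_succAbove]
  ring

/-- In adjoint form: attaching F and G in either order gives the same function up to a permutation,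
which the symmetric χ does not see. Both normalizations are √((n + 1)(n + 2)(n + 3)). -/
theorem pairAnnSector_comp_ann (F : OneParticle D m)
    (G : Lp ℂ 2 ((shellMeasure D m).prod (shellMeasure D m))) (n : ℕ)
    (χ : nParticle D m (n + 3)) :
    pairAnnSector G n (annSector F (n + 2) χ) = annSector F n (pairAnnSector G (n + 1) χ) := by
  refine Subtype.ext ?_
  rw [coe_pairAnnSector, coe_annSector, coe_annSector, coe_pairAnnSector, map_smul, map_smul,
    smul_smul, smul_smul]
  congr 1
  · rw [← Complex.ofReal_mul, ← Complex.ofReal_mul]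
    congr 1
    rw [← Real.sqrt_mul (by positivity), ← Real.sqrt_mul (by positivity)]
    congr 1
    push_cast
    ring
  · refine ext_inner_right ℂ fun ψ => ?_
    rw [ContinuousLinearMap.adjoint_inner_left, ContinuousLinearMap.adjoint_inner_left,
      ContinuousLinearMap.adjoint_inner_left, ContinuousLinearMap.adjoint_inner_left]
    obtain ⟨σ, hσ⟩ := attach_slot_pairSlot_eq_permOp F G ψ
    rw [hσ, inner_permOp]

/-- The contraction of a two-particle wave function with a one-particle vector. -/
def contract (F : OneParticle D m) (G : Lp ℂ 2 ((shellMeasure D m).prod (shellMeasure D m))) :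
    OneParticle D m :=
  (tensor (shellMeasure D m) (shellMeasure D m) F).adjoint G

theorem contract_ae {F : OneParticle D m}
    {G : Lp ℂ 2 ((shellMeasure D m).prod (shellMeasure D m))} {f : Momentum D → ℂ}
    {g : Momentum D × Momentum D → ℂ} (hf : F =ᵐ[shellMeasure D m] f)
    (hg : G =ᵐ[(shellMeasure D m).prod (shellMeasure D m)] g) :
    contract F G =ᵐ[shellMeasure D m] fun y => ∫ x, star (f x) * g (x, y) ∂shellMeasure D m :=
  contraction_ae hf hg

variable {G : Lp ℂ 2 ((shellMeasure D m).prod (shellMeasure D m))}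

theorem adjoint_attach_slot_zero_pairSlot {n : ℕ} (F : OneParticle D m)
    (φ : Lp ℂ 2 (nMeasure D m n)) :
    ((slot m (n + 1) 0).attach F).adjoint ((pairSlot m n 0 0).attach G φ) =
      (slot m n 0).attach (contract F G) φ := by
  refine Lp.ext ?_
  filter_upwards [adjoint_attach_slot_ae (EventuallyEq.refl _ F)
    (attach_pairSlot_ae 0 0 (EventuallyEq.refl _ G) (EventuallyEq.refl _ φ)),
    attach_slot_ae 0 (contract_ae (EventuallyEq.refl _ F) (EventuallyEq.refl _ G))
      (EventuallyEq.refl _ φ)] with p h1 h2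
  rw [h1, h2, ← integral_mul_const]
  refine integral_congr_ae (ae_of_all _ fun q => ?_)
  simp only [Fin.removeNth_zero, Fin.tail_cons, Fin.cons_zero, mul_assoc]

/-- By symmetry of G the second variable of the pair may be integrated out as if it were the first.
-/
theorem adjoint_attach_slot_one_pairSlot
    (hG : G =ᵐ[(shellMeasure D m).prod (shellMeasure D m)] fun z => G (z.2, z.1)) {n : ℕ}
    (F : OneParticle D m) (φ : Lp ℂ 2 (nMeasure D m n)) :
    ((slot m (n + 1) (Fin.succ 0)).attach F).adjoint ((pairSlot m n 0 0).attach G φ) =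
      (slot m n 0).attach (contract F G) φ := by
  refine Lp.ext ?_
  have h1 := (slot m (n + 1) (Fin.succ 0)).adjoint_attach_ae (EventuallyEq.refl _ F)
    (attach_pairSlot_ae 0 0 hG (EventuallyEq.refl _ φ))
  filter_upwards [h1,
    attach_slot_ae 0 (contract_ae (EventuallyEq.refl _ F) (EventuallyEq.refl _ G))
      (EventuallyEq.refl _ φ)] with p h1 h2
  rw [h1, h2, ← integral_mul_const]
  refine integral_congr_ae (ae_of_all _ fun q => ?_)
  have e1 : Fin.insertNth (α := fun _ => Momentum D) (Fin.succ 0 : Fin (n + 2)) q p 0 = p 0 := by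
    have := Fin.insertNth_apply_succAbove (α := fun _ => Momentum D) (Fin.succ 0 : Fin (n + 2)) q p 0
    rwa [Fin.succ_succAbove_zero] at this
  have e2 : Fin.insertNth (α := fun _ => Momentum D) (Fin.succ 0 : Fin (n + 2)) q p (Fin.succ 0) = q :=
    Fin.insertNth_apply_same (α := fun _ => Momentum D) _ _ _
  have e3 : ∀ l : Fin n, Fin.insertNth (α := fun _ => Momentum D) (Fin.succ 0 : Fin (n + 2)) q p l.succ.succ = p l.succ := by
    intro l
    have := Fin.insertNth_apply_succAbove (α := fun _ => Momentum D) (Fin.succ 0 : Fin (n + 2))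
      q p l.succ
    rwa [Fin.succ_succAbove_succ, Fin.zero_succAbove] at this
  simp only [slot_equiv_symm, Fin.removeNth_apply, Fin.removeNth_zero, Fin.tail_def, e1, e2, e3,
    Fin.zero_succAbove, mul_assoc]

theorem removeNth_succ_cons {M : Type*} {n : ℕ} (l : Fin (n + 1)) (q : M) (p : Fin (n + 1) → M) :
    l.succ.removeNth (Fin.cons q p : Fin (n + 2) → M) = Fin.cons q (l.removeNth p) := by
  ext j
  refine Fin.cases ?_ (fun j => ?_) j <;> simp [Fin.removeNth]

theorem adjoint_attach_pairSlot_slot {n : ℕ} (l : Fin (n + 1)) (F : OneParticle D m)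
    (ψ : Lp ℂ 2 (nMeasure D m (n + 2))) :
    ((pairSlot m (n + 1) 0 0).attach G).adjoint ((slot m (n + 2) l.succ.succ).attach F ψ) =
      (slot m n l).attach F (((pairSlot m n 0 0).attach G).adjoint ψ) := by
  refine Lp.ext ?_
  filter_upwards [adjoint_attach_pairSlot_ae (EventuallyEq.refl _ G)
    (attach_slot_ae l.succ.succ (EventuallyEq.refl _ F) (EventuallyEq.refl _ ψ)),
    attach_slot_ae l (EventuallyEq.refl _ F) (adjoint_attach_pairSlot_ae (EventuallyEq.refl _ G)
      (EventuallyEq.refl _ ψ))] with p h1 h2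
  rw [h1, h2, ← integral_const_mul]
  refine integral_congr_ae (ae_of_all _ fun q => ?_)
  simp only [removeNth_succ_cons, Fin.cons_succ]
  ring

/-- The adjoint of T* S = R. It converts contractions of a pair function into annihilation
operators. -/
theorem adjoint_comp_eq_of_adjoint_comp {E₁ E₂ E₃ : Type*} [NormedAddCommGroup E₁]
    [InnerProductSpace ℂ E₁] [CompleteSpace E₁] [NormedAddCommGroup E₂] [InnerProductSpace ℂ E₂]
    [CompleteSpace E₂] [NormedAddCommGroup E₃] [InnerProductSpace ℂ E₃] [CompleteSpace E₃]
    {S : E₁ →L[ℂ] E₃} {T : E₂ →L[ℂ] E₃} {R : E₁ →L[ℂ] E₂} (h : ∀ x, T.adjoint (S x) = R x)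
    (y : E₂) : S.adjoint (T y) = R.adjoint y := by
  refine ext_inner_left ℂ fun x => ?_
  rw [ContinuousLinearMap.adjoint_inner_right, ContinuousLinearMap.adjoint_inner_right, ← h,
    ContinuousLinearMap.adjoint_inner_left]

/-- Of the n + 2 slots for the created F, the first two are those absorbed by the pair, and each
leaves an annihilator of the contraction of F with G; hence the factor 2. In the other n slots F is
a spectator. -/
theorem coe_pairAnnSector_cre (n : ℕ) (F : OneParticle D m)
    (hG : G =ᵐ[(shellMeasure D m).prod (shellMeasure D m)] fun z => G (z.2, z.1))
    (ψ : nParticle D m (n + 1)) :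
    (pairAnnSector G n ((annSector F (n + 1)).adjoint ψ) : Lp ℂ 2 (nMeasure D m n)) =
      (2 : ℂ) • (annSector (contract F G) n ψ : Lp ℂ 2 (nMeasure D m n)) + (√(n + 1 : ℝ) : ℂ) •
        ∑ l : Fin n, ((pairSlot m n 0 0).attach G).adjoint
          ((slot m (n + 1) l.succ.succ).attach F (ψ : Lp ℂ 2 _)) := by
  have e0 := adjoint_comp_eq_of_adjoint_comp
    (adjoint_attach_slot_zero_pairSlot (n := n) (G := G) F) (ψ : Lp ℂ 2 (nMeasure D m (n + 1)))
  have e1 := adjoint_comp_eq_of_adjoint_comp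
    (adjoint_attach_slot_one_pairSlot (n := n) hG F) (ψ : Lp ℂ 2 (nMeasure D m (n + 1)))
  have h1 : (√((n + 1 : ℝ) * (n + 2)) : ℂ) * (√((n + 1 : ℕ) + 1 : ℝ) : ℂ)⁻¹ =
      (√(n + 1 : ℝ) : ℂ) := by
    have h3 : (√(n + 2 : ℝ) : ℂ) ≠ 0 := by
      exact_mod_cast (Real.sqrt_pos.2 (by positivity)).ne'
    have h4 : ((n + 1 : ℕ) + 1 : ℝ) = n + 2 := by push_cast; ring
    rw [Real.sqrt_mul (by positivity), h4, Complex.ofReal_mul, mul_assoc, mul_inv_cancel₀ h3,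
      mul_one]
  refine (coe_pairAnnSector G n _).trans ((congrArg (fun v => (√((n + 1 : ℝ) * (n + 2)) : ℂ) •
    ((pairSlot m n 0 0).attach G).adjoint v) (coe_adjoint_annSector F (n + 1) ψ)).trans ?_)
  refine Eq.trans ?_ (congrArg (fun v => (2 : ℂ) • v + _)
    (coe_annSector (contract F G) n ψ).symm)
  simp only [map_smul, map_sum]
  have h2 : ∀ x s : Lp ℂ 2 (nMeasure D m n), (√((n + 1 : ℝ) * (n + 2)) : ℂ) •
      (√((n + 1 : ℕ) + 1 : ℝ) : ℂ)⁻¹ • (x + (x + s)) =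
      (2 : ℂ) • (√(n + 1 : ℝ) : ℂ) • x + (√(n + 1 : ℝ) : ℂ) • s := fun x s => by
    rw [smul_smul, h1, ← add_assoc, ← two_smul ℂ, smul_add, smul_comm]
  rw [Fin.sum_univ_succ, Fin.sum_univ_succ, e0]
  refine Eq.trans ?_ (h2 _ _)
  exact congrArg (fun v => (√((n + 1 : ℝ) * (n + 2)) : ℂ) •
    (√((n + 1 : ℕ) + 1 : ℝ) : ℂ)⁻¹ • (_ + (v + _))) e1

theorem pairAnnSector_zero_cre (F : OneParticle D m)
    (hG : G =ᵐ[(shellMeasure D m).prod (shellMeasure D m)] fun z => G (z.2, z.1))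
    (ψ : nParticle D m 1) :
    pairAnnSector G 0 ((annSector F 1).adjoint ψ) = (2 : ℂ) • annSector (contract F G) 0 ψ := by
  refine Subtype.ext ?_
  rw [coe_pairAnnSector_cre 0 F hG]
  simp

/-- The spectator terms are, slot by slot, creation after pair annihilation. A single initial
particle is a separate case because it leaves no spectator slot. -/
theorem pairAnnSector_succ_cre (n : ℕ) (F : OneParticle D m)
    (hG : G =ᵐ[(shellMeasure D m).prod (shellMeasure D m)] fun z => G (z.2, z.1))
    (ψ : nParticle D m (n + 2)) :
    pairAnnSector G (n + 1) ((annSector F (n + 2)).adjoint ψ) =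
      (2 : ℂ) • annSector (contract F G) (n + 1) ψ +
        (annSector F n).adjoint (pairAnnSector G n ψ) := by
  have hadd : ∀ v w : nParticle D m (n + 1), (((2 : ℂ) • v + w : nParticle D m (n + 1)) :
      Lp ℂ 2 (nMeasure D m (n + 1))) = (2 : ℂ) • (v : Lp ℂ 2 (nMeasure D m (n + 1))) + w :=
    fun _ _ => rfl
  refine Subtype.ext ((coe_pairAnnSector_cre (n + 1) F hG ψ).trans
    (Eq.trans ?_ (hadd _ _).symm))
  rw [coe_adjoint_annSector, coe_pairAnnSector]
  congr 1
  simp only [adjoint_attach_pairSlot_slot, map_smul, ← Finset.smul_sum]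
  rw [smul_smul]
  congr 1
  have h3 : (√(n + 1 : ℝ) : ℂ) ≠ 0 := by
    exact_mod_cast (Real.sqrt_pos.2 (by positivity)).ne'
  have h4 : ((n + 1 : ℕ) + 1 : ℝ) = n + 2 := by push_cast; ring
  rw [Real.sqrt_mul (by positivity), h4, Complex.ofReal_mul, ← mul_assoc, inv_mul_cancel₀ h3,
    one_mul]

end Creation

end LocalSqueezing
end

noncomputable section

namespace LocalSqueezing

/-! ### Operators on the finite-particle subspace -/

section FiniteParticle

variable {D : ℕ} {m : ℝ}

theorem Fock.ext {ψ φ : Fock D m} (h : ∀ n, component ψ n = component φ n) : ψ = φ :=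
  lp.ext (funext h)

theorem hasSum_inner_component (ψ φ : Fock D m) :
    HasSum (fun n => inner ℂ (component ψ n) (component φ n)) (inner ℂ ψ φ) :=
  lp.hasSum_inner (𝕜 := ℂ) (G := fun n => nParticle D m n) ψ φ

theorem hasSum_norm_component (ψ : Fock D m) :
    HasSum (fun n => ‖component ψ n‖ ^ 2) (‖ψ‖ ^ 2) := by
  have h := Complex.hasSum_re (hasSum_inner_component ψ ψ)
  have h1 : ∀ n, (inner ℂ (component ψ n) (component ψ n)).re = ‖component ψ n‖ ^ 2 := fun n => by
    have h0 := inner_self_eq_norm_sq_to_K (𝕜 := ℂ) (component ψ n)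
    refine (congrArg Complex.re h0).trans ?_
    exact_mod_cast Complex.ofReal_re _
  have h2 : (inner ℂ ψ ψ).re = ‖ψ‖ ^ 2 := by
    rw [inner_self_eq_norm_sq_to_K]
    exact_mod_cast Complex.ofReal_re _
  simpa only [h1, h2] using h

@[simp] theorem component_add (ψ φ : Fock D m) (n : ℕ) :
    component (ψ + φ) n = component ψ n + component φ n := rfl

@[simp] theorem component_smul (c : ℂ) (ψ : Fock D m) (n : ℕ) :
    component (c • ψ) n = c • component ψ n := rfl

/-- The vector has at most `N` particles. -/
def UpTo (N : ℕ) (x : finiteParticle D m) : Prop :=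
  ∀ n, N < n → component (x : Fock D m) n = 0

theorem exists_upTo (x : finiteParticle D m) : ∃ N, UpTo N x := x.2

theorem UpTo.mono {N M : ℕ} {x : finiteParticle D m} (h : UpTo N x) (hNM : N ≤ M) : UpTo M x :=
  fun n hn => h n (hNM.trans_lt hn)

theorem UpTo.add {N : ℕ} {x y : finiteParticle D m} (hx : UpTo N x) (hy : UpTo N y) :
    UpTo N (x + y) := fun n hn => by
  rw [Submodule.coe_add, component_add, hx n hn, hy n hn, add_zero]

theorem UpTo.smul {N : ℕ} {x : finiteParticle D m} (hx : UpTo N x) (c : ℂ) :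
    UpTo N (c • x) := fun n hn => by
  rw [Submodule.coe_smul, component_smul, hx n hn, smul_zero]

/-- The finite-particle vector with given components. -/
def ofComponents (c : (n : ℕ) → nParticle D m n) (hc : ∃ N, ∀ n, N < n → c n = 0) :
    finiteParticle D m :=
  ⟨(⟨c, (memℓp_zero (by
      obtain ⟨N, hN⟩ := hc
      refine (Set.finite_Iic N).subset fun n hn => ?_
      by_contra h
      exact hn (hN n (not_le.1 h)))).of_exponent_ge zero_le⟩ : lp (fun n => nParticle D m n) 2),
    hc⟩

theorem dense_finiteParticle : Dense (finiteParticle D m : Set (Fock D m)) := by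
  intro ψ
  have h := lp.hasSum_single (p := 2) (by norm_num) (show lp (fun n => nParticle D m n) 2 from ψ)
  refine mem_closure_of_tendsto (b := atTop) h (Eventually.of_forall fun s => ?_)
  refine Submodule.sum_mem _ fun i _ => ?_
  refine ⟨i, fun n hn => ?_⟩
  exact lp.single_apply_ne (E := fun n => nParticle D m n) 2 i _ hn.ne'

/-- The operator on finite-particle vectors given by a linear map on components. -/
def mkEnd (f : ((n : ℕ) → nParticle D m n) →ₗ[ℂ] ((n : ℕ) → nParticle D m n)) (d : ℕ)
    (hf : ∀ N c, (∀ n, N < n → c n = 0) → ∀ n, N + d < n → f c n = 0) :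
    Module.End ℂ (finiteParticle D m) where
  toFun x := ofComponents (f (component (x : Fock D m))) (by
    obtain ⟨N, hN⟩ := x.2
    exact ⟨N + d, hf N _ hN⟩)
  map_add' x y := by
    refine Subtype.ext (Fock.ext fun n => ?_)
    exact congrFun (map_add f (component (x : Fock D m)) (component (y : Fock D m))) n
  map_smul' a x := by
    refine Subtype.ext (Fock.ext fun n => ?_)
    exact congrFun (map_smul f a (component (x : Fock D m))) n

/-- The operator on finite-particle vectors lowering the particle number by `j`. -/
def lower (j : ℕ) (T : (n : ℕ) → nParticle D m (n + j) →L[ℂ] nParticle D m n) :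
    Module.End ℂ (finiteParticle D m) :=
  mkEnd (LinearMap.pi fun n => (T n).toLinearMap ∘ₗ LinearMap.proj (n + j)) 0 fun N c hc n hn => by
    simp [hc (n + j) (by omega)]

theorem component_lower {j : ℕ} (T : (n : ℕ) → nParticle D m (n + j) →L[ℂ] nParticle D m n)
    (x : finiteParticle D m) (n : ℕ) :
    component (lower j T x : Fock D m) n = T n (component (x : Fock D m) (n + j)) := rfl

theorem upTo_lower {j : ℕ} (T : (n : ℕ) → nParticle D m (n + j) →L[ℂ] nParticle D m n)
    {x : finiteParticle D m} {N : ℕ} (hx : UpTo N x) : UpTo N (lower j T x) := fun n hn => by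
  rw [component_lower, hx _ (by omega), map_zero]

/-- The component map of an operator raising the particle number by one. -/
def raiseOneAux (T : (n : ℕ) → nParticle D m n →L[ℂ] nParticle D m (n + 1)) :
    (n : ℕ) → ((n : ℕ) → nParticle D m n) →ₗ[ℂ] nParticle D m n
  | 0 => 0
  | n + 1 => (T n).toLinearMap ∘ₗ LinearMap.proj n

/-- The component map of an operator raising the particle number by two. -/
def raiseTwoAux (T : (n : ℕ) → nParticle D m n →L[ℂ] nParticle D m (n + 2)) :
    (n : ℕ) → ((n : ℕ) → nParticle D m n) →ₗ[ℂ] nParticle D m n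
  | 0 => 0
  | 1 => 0
  | n + 2 => (T n).toLinearMap ∘ₗ LinearMap.proj n

/-- The operator on finite-particle vectors raising the particle number by one. -/
def raiseOne (T : (n : ℕ) → nParticle D m n →L[ℂ] nParticle D m (n + 1)) :
    Module.End ℂ (finiteParticle D m) :=
  mkEnd (LinearMap.pi (raiseOneAux T)) 1 fun N c hc n hn => by
    match n, hn with
    | n + 1, hn => simp [raiseOneAux, hc n (by omega)]

/-- The operator on finite-particle vectors raising the particle number by two. -/
def raiseTwo (T : (n : ℕ) → nParticle D m n →L[ℂ] nParticle D m (n + 2)) :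
    Module.End ℂ (finiteParticle D m) :=
  mkEnd (LinearMap.pi (raiseTwoAux T)) 2 fun N c hc n hn => by
    match n, hn with
    | n + 2, hn => simp [raiseTwoAux, hc n (by omega)]

theorem component_raiseOne_succ (T : (n : ℕ) → nParticle D m n →L[ℂ] nParticle D m (n + 1))
    (x : finiteParticle D m) (n : ℕ) :
    component (raiseOne T x : Fock D m) (n + 1) = T n (component (x : Fock D m) n) := rfl

theorem component_raiseTwo_add_two (T : (n : ℕ) → nParticle D m n →L[ℂ] nParticle D m (n + 2))
    (x : finiteParticle D m) (n : ℕ) :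
    component (raiseTwo T x : Fock D m) (n + 2) = T n (component (x : Fock D m) n) := rfl

theorem upTo_raiseOne (T : (n : ℕ) → nParticle D m n →L[ℂ] nParticle D m (n + 1))
    {x : finiteParticle D m} {N : ℕ} (hx : UpTo N x) : UpTo (N + 1) (raiseOne T x) := fun n hn => by
  match n, hn with
  | n + 1, hn => rw [component_raiseOne_succ, hx n (by omega), map_zero]

theorem upTo_raiseTwo (T : (n : ℕ) → nParticle D m n →L[ℂ] nParticle D m (n + 2))
    {x : finiteParticle D m} {N : ℕ} (hx : UpTo N x) : UpTo (N + 2) (raiseTwo T x) := fun n hn => by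
  match n, hn with
  | n + 2, hn => rw [component_raiseTwo_add_two, hx n (by omega), map_zero]

/-! #### Formal adjoints -/

/-- `Y` is a formal adjoint of `X` on finite-particle vectors. -/
def FormalAdjoint (X Y : Module.End ℂ (finiteParticle D m)) : Prop :=
  ∀ x y : finiteParticle D m, inner ℂ (X x : Fock D m) (y : Fock D m) =
    inner ℂ (x : Fock D m) (Y y : Fock D m)

namespace FormalAdjoint

variable {X Y X' Y' : Module.End ℂ (finiteParticle D m)}

theorem symm (h : FormalAdjoint X Y) : FormalAdjoint Y X := fun x y => by
  rw [← inner_conj_symm, ← h y x, inner_conj_symm]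

theorem add (h : FormalAdjoint X Y) (h' : FormalAdjoint X' Y') :
    FormalAdjoint (X + X') (Y + Y') := fun x y => by
  rw [LinearMap.add_apply, LinearMap.add_apply, Submodule.coe_add, Submodule.coe_add,
    inner_add_left, inner_add_right, h, h']

theorem sub (h : FormalAdjoint X Y) (h' : FormalAdjoint X' Y') :
    FormalAdjoint (X - X') (Y - Y') := fun x y => by
  rw [LinearMap.sub_apply, LinearMap.sub_apply, AddSubgroupClass.coe_sub,
    AddSubgroupClass.coe_sub, inner_sub_left, inner_sub_right, h, h']

theorem smul (h : FormalAdjoint X Y) (c : ℂ) : FormalAdjoint (c • X) (star c • Y) := fun x y => by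
  rw [LinearMap.smul_apply, LinearMap.smul_apply, Submodule.coe_smul, Submodule.coe_smul,
    inner_smul_left, inner_smul_right, h]
  rfl

theorem mul (h : FormalAdjoint X Y) (h' : FormalAdjoint X' Y') :
    FormalAdjoint (X * X') (Y' * Y) := fun x y => by
  rw [Module.End.mul_apply, Module.End.mul_apply, h, h']

/-- Density of the finite-particle space determines the adjoint, so algebraic relations for
annihilators transfer to creators without computation. -/
theorem unique (h : FormalAdjoint X Y) (h' : FormalAdjoint X Y') : Y = Y' := by
  refine LinearMap.ext fun y => Subtype.ext ?_
  refine dense_finiteParticle.eq_of_inner_right (𝕜 := ℂ) fun x hx => ?_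
  rw [← h ⟨x, hx⟩ y, ← h' ⟨x, hx⟩ y]

/-- From ‖Y y‖² = ⟨X Y y, y⟩, a bound on an annihilator gives the same bound on its adjoint, and
creators need no direct estimate. -/
theorem norm_apply_le (h : FormalAdjoint X Y) {y : finiteParticle D m} {N : ℕ} {c : ℝ} (hc : 0 ≤ c)
    (hX : ∀ x, UpTo N x → ‖(X x : Fock D m)‖ ≤ c * ‖(x : Fock D m)‖) (hy : UpTo N (Y y)) :
    ‖(Y y : Fock D m)‖ ≤ c * ‖(y : Fock D m)‖ := by
  have h1 : ‖(Y y : Fock D m)‖ * ‖(Y y : Fock D m)‖ ≤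
      ‖(Y y : Fock D m)‖ * (c * ‖(y : Fock D m)‖) := by
    have h2 : ‖inner ℂ (Y y : Fock D m) (Y y : Fock D m)‖ =
        ‖(Y y : Fock D m)‖ * ‖(Y y : Fock D m)‖ := by
      rw [inner_self_eq_norm_sq_to_K, norm_pow, RCLike.norm_ofReal, abs_norm, pow_two]
    rw [← h2, ← h]
    refine (norm_inner_le_norm _ _).trans ?_
    rw [← mul_assoc, mul_comm _ c]
    gcongr
    exact hX _ hy
  rcases eq_or_lt_of_le (norm_nonneg (Y y : Fock D m)) with h0 | h0
  · rw [← h0]; positivity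
  · exact le_of_mul_le_mul_left h1 h0

end FormalAdjoint

/-- Inner products are sums over sectors; shifting the index by j matches them, as the first j
components of the raised vector vanish. -/
theorem formalAdjoint_of_component {X Y : Module.End ℂ (finiteParticle D m)} (j : ℕ)
    (T : (n : ℕ) → nParticle D m (n + j) →L[ℂ] nParticle D m n)
    (hX : ∀ x n, component (X x : Fock D m) n = T n (component (x : Fock D m) (n + j)))
    (hY : ∀ x n, component (Y x : Fock D m) (n + j) = (T n).adjoint (component (x : Fock D m) n))
    (hY0 : ∀ x n, n < j → component (Y x : Fock D m) n = 0) : FormalAdjoint X Y := fun x y => by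
  have h1 := hasSum_inner_component (X x : Fock D m) (y : Fock D m)
  have h2 := (hasSum_nat_add_iff' j).2
    (hasSum_inner_component (x : Fock D m) (Y y : Fock D m))
  rw [Finset.sum_eq_zero fun n hn => by rw [hY0 y n (Finset.mem_range.1 hn), inner_zero_right],
    sub_zero] at h2
  have h3 : (fun n => inner ℂ (component (X x : Fock D m) n) (component (y : Fock D m) n)) =
      fun n => inner ℂ (component (x : Fock D m) (n + j)) (component (Y y : Fock D m) (n + j)) := by
    ext n
    rw [hX, hY, ContinuousLinearMap.adjoint_inner_right]
  rw [h3] at h1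
  exact h1.unique h2

theorem norm_le_of_component {x z : finiteParticle D m} {j N : ℕ} {c : ℝ} (hc : 0 ≤ c)
    (T : (n : ℕ) → nParticle D m (n + j) →L[ℂ] nParticle D m n)
    (hz : ∀ n, component (z : Fock D m) n = T n (component (x : Fock D m) (n + j)))
    (hx : UpTo N x) (hT : ∀ n, n + j ≤ N → ‖T n‖ ≤ c) :
    ‖(z : Fock D m)‖ ≤ c * ‖(x : Fock D m)‖ := by
  have h1 := hasSum_norm_component (z : Fock D m)
  have h2 := (hasSum_norm_component (x : Fock D m)).mul_left (c ^ 2)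
  have h3 : ‖(z : Fock D m)‖ ^ 2 ≤ c ^ 2 * ‖(x : Fock D m)‖ ^ 2 := by
    refine hasSum_le_inj (fun n => n + j) (add_left_injective j) (fun n _ => by positivity)
      (fun n => ?_) h1 h2
    rw [hz n, ← mul_pow]
    rcases le_or_gt (n + j) N with h | h
    · have := (T n).le_opNorm (component (x : Fock D m) (n + j))
      have h5 := hT n h
      gcongr
      exact this.trans (by gcongr)
    · rw [hx _ h]
      simp
  rw [← mul_pow] at h3
  exact (sq_le_sq₀ (norm_nonneg _) (by positivity)).1 h3

-- Every application raises the particle number by at most two, so the norms multiply to b^k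
-- (N+3)(N+5)⋯. Bounding N + 3 + 2k by 2(N + 3 + k) gives a rising factorial, which is k! times a
-- binomial coefficient of size at most 2^(N+2+k). The radius depends on b alone; N enters only the
-- constant.
open scoped Nat in
theorem norm_pow_apply_le {T : Module.End ℂ (finiteParticle D m)} {b : ℝ} (hb : 0 ≤ b)
    (hT : ∀ N x, UpTo N x → UpTo (N + 2) (T x) ∧
      ‖(T x : Fock D m)‖ ≤ b * (N + 3) * ‖(x : Fock D m)‖)
    {N : ℕ} {x : finiteParticle D m} (hx : UpTo N x) (k : ℕ) :
    ‖((T ^ k) x : Fock D m)‖ ≤ 2 ^ (N + 2) * ‖(x : Fock D m)‖ * (4 * b) ^ k * k ! := by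
  have h1 : ∀ k, UpTo (N + 2 * k) ((T ^ k) x) ∧ ‖((T ^ k) x : Fock D m)‖ ≤
      (2 * b) ^ k * ((N + 3).ascFactorial k : ℕ) * ‖(x : Fock D m)‖ := by
    intro k
    induction k with
    | zero => simpa using hx
    | succ k ih =>
      obtain ⟨ih1, ih2⟩ := ih
      have h := hT _ _ ih1
      rw [pow_succ', Module.End.mul_apply]
      refine ⟨h.1, h.2.trans ?_⟩
      rw [Nat.ascFactorial_succ]
      have h3 : b * ((N + 2 * k : ℕ) + 3) ≤ 2 * b * ((N + 3 + k : ℕ) : ℝ) := by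
        push_cast
        have hN : (0 : ℝ) ≤ N := by positivity
        nlinarith
      calc b * ((N + 2 * k : ℕ) + 3) * ‖((T ^ k) x : Fock D m)‖
          ≤ 2 * b * ((N + 3 + k : ℕ) : ℝ) * ((2 * b) ^ k * ((N + 3).ascFactorial k : ℕ) *
            ‖(x : Fock D m)‖) := by gcongr
        _ = _ := by push_cast; ring
  refine (h1 k).2.trans ?_
  rw [show N + 3 = (N + 2) + 1 from rfl, Nat.ascFactorial_eq_factorial_mul_choose]
  have h2 : (((N + 2 + k).choose k : ℕ) : ℝ) ≤ 2 ^ (N + 2 + k) := by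
    exact_mod_cast Nat.choose_le_two_pow _ _
  calc (2 * b) ^ k * ((k ! * (N + 2 + k).choose k : ℕ) : ℝ) * ‖(x : Fock D m)‖
      = (2 * b) ^ k * (k ! * ((N + 2 + k).choose k : ℕ)) * ‖(x : Fock D m)‖ := by push_cast; rfl
    _ ≤ (2 * b) ^ k * (k ! * 2 ^ (N + 2 + k)) * ‖(x : Fock D m)‖ := by gcongr
    _ = _ := by rw [show (4 : ℝ) * b = 2 * b * 2 by ring, mul_pow _ (2 : ℝ), pow_add]; ring

end FiniteParticle

end LocalSqueezing
end

noncomputable section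

namespace LocalSqueezing

section FockOperators

open scoped NNReal

variable {D : ℕ} {m : ℝ} {k : Momentum D → Momentum D → ℂ} {C : ℝ≥0}

/-! ### Fields and quadratic operators on finite-particle vectors -/

theorem annSector_add (F F' : OneParticle D m) (n : ℕ) :
    annSector (F + F') n = annSector F n + annSector F' n := by
  refine ContinuousLinearMap.ext fun χ => Subtype.ext ?_
  have h : ∀ v w : nParticle D m n, ((v + w : nParticle D m n) : Lp ℂ 2 (nMeasure D m n)) =
    v + w := fun _ _ => rfl
  refine Eq.trans ?_ (h _ _).symm
  refine (coe_annSector _ n χ).trans (Eq.trans ?_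
    (congrArg₂ (· + ·) (coe_annSector F n χ).symm (coe_annSector F' n χ).symm))
  rw [Splitting.attach_add, map_add]
  exact smul_add _ _ _

theorem annSector_smul (c : ℂ) (F : OneParticle D m) (n : ℕ) :
    annSector (c • F) n = star c • annSector F n := by
  refine ContinuousLinearMap.ext fun χ => Subtype.ext ?_
  have h : ∀ v : nParticle D m n, ((star c • v : nParticle D m n) : Lp ℂ 2 (nMeasure D m n)) =
    star c • (v : Lp ℂ 2 (nMeasure D m n)) := fun _ => rfl
  refine Eq.trans ?_ (h _).symm
  refine (coe_annSector _ n χ).trans (Eq.trans ?_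
    (congrArg (star c • ·) (coe_annSector F n χ).symm))
  rw [Splitting.attach_smul, map_smulₛₗ]
  exact smul_comm (√(n + 1 : ℝ) : ℂ) (star c) (_ : Lp ℂ 2 (nMeasure D m n))

/-- The annihilation operator `a(F)`. -/
def annEnd (F : OneParticle D m) : Module.End ℂ (finiteParticle D m) := lower 1 (annSector F)

/-- The creation operator `a†(F)`. -/
def creEnd (F : OneParticle D m) : Module.End ℂ (finiteParticle D m) :=
  raiseOne fun n => (annSector F n).adjoint

/-- The annihilation operator of a pair with wave function `G`. -/
def pairAnnEnd (G : Lp ℂ 2 ((shellMeasure D m).prod (shellMeasure D m))) :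
    Module.End ℂ (finiteParticle D m) := lower 2 (pairAnnSector G)

/-- The creation operator of a pair with wave function `G`. -/
def pairCreEnd (G : Lp ℂ 2 ((shellMeasure D m).prod (shellMeasure D m))) :
    Module.End ℂ (finiteParticle D m) := raiseTwo fun n => (pairAnnSector G n).adjoint

/-- The second quantization of a kernel operator. -/
def scatEnd (hk : IsSchurKernel (shellMeasure D m) k C) : Module.End ℂ (finiteParticle D m) :=
  lower 0 (scatSector hk)

theorem formalAdjoint_annEnd (F : OneParticle D m) : FormalAdjoint (annEnd F) (creEnd F) :=
  formalAdjoint_of_component 1 (annSector F) (fun _ _ => rfl) (fun _ _ => rfl) fun x n hn => by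
    obtain rfl : n = 0 := by omega
    rfl

theorem formalAdjoint_pairAnnEnd (G : Lp ℂ 2 ((shellMeasure D m).prod (shellMeasure D m))) :
    FormalAdjoint (pairAnnEnd G) (pairCreEnd G) :=
  formalAdjoint_of_component 2 (pairAnnSector G) (fun _ _ => rfl) (fun _ _ => rfl)
    fun x n hn => by
      interval_cases n <;> rfl

theorem formalAdjoint_scatEnd (hk : IsSchurKernel (shellMeasure D m) k C)
    (hherm : ∀ x q, k q x = star (k x q)) : FormalAdjoint (scatEnd hk) (scatEnd hk) := by
  have h : ∀ n, scatSector hk n = (scatSector hk n).adjoint := fun n =>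
    (ContinuousLinearMap.eq_adjoint_iff _ _).2 fun v w => scatSector_symm hk hherm n v w
  refine formalAdjoint_of_component 0 (scatSector hk) (fun _ _ => rfl) (fun x n => ?_)
    fun x n hn => by omega
  have h1 := h n
  rw [← h1]
  rfl

theorem annEnd_add (F F' : OneParticle D m) : annEnd (F + F') = annEnd F + annEnd F' := by
  refine LinearMap.ext fun x => Subtype.ext (Fock.ext fun n => ?_)
  have h : component (annEnd (F + F') x : Fock D m) n =
    annSector (F + F') n (component (x : Fock D m) (n + 1)) := rfl
  rw [h, annSector_add]
  rfl

theorem annEnd_smul (c : ℂ) (F : OneParticle D m) : annEnd (c • F) = star c • annEnd F := by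
  refine LinearMap.ext fun x => Subtype.ext (Fock.ext fun n => ?_)
  have h : component (annEnd (c • F) x : Fock D m) n =
    annSector (c • F) n (component (x : Fock D m) (n + 1)) := rfl
  rw [h, annSector_smul]
  rfl

theorem creEnd_add (F F' : OneParticle D m) : creEnd (F + F') = creEnd F + creEnd F' :=
  (formalAdjoint_annEnd (F + F')).unique (by
    rw [annEnd_add]; exact (formalAdjoint_annEnd F).add (formalAdjoint_annEnd F'))

theorem creEnd_smul (c : ℂ) (F : OneParticle D m) : creEnd (c • F) = c • creEnd F :=
  (formalAdjoint_annEnd (c • F)).unique (by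
    rw [annEnd_smul]
    have h := (formalAdjoint_annEnd F).smul (star c)
    rwa [star_star] at h)

/-- The field operator `Φ(F) = a(F) + a†(F)`. -/
def fieldEnd (F : OneParticle D m) : Module.End ℂ (finiteParticle D m) := annEnd F + creEnd F

theorem fieldEnd_add (F F' : OneParticle D m) : fieldEnd (F + F') = fieldEnd F + fieldEnd F' := by
  rw [fieldEnd, annEnd_add, creEnd_add, fieldEnd, fieldEnd]
  abel

theorem fieldEnd_real_smul (r : ℝ) (F : OneParticle D m) :
    fieldEnd (r • F) = (r : ℂ) • fieldEnd F := by
  have h : r • F = (r : ℂ) • F := by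
    exact (Complex.coe_smul r F).symm
  rw [h, fieldEnd, annEnd_smul, creEnd_smul, fieldEnd, smul_add, RCLike.star_def,
    Complex.conj_ofReal]

variable (hk : IsSchurKernel (shellMeasure D m) k C)
  (G : Lp ℂ 2 ((shellMeasure D m).prod (shellMeasure D m)))

/-- The quadratic operator with kernels `k` and `G`. -/
def wickEnd : Module.End ℂ (finiteParticle D m) :=
  pairAnnEnd G + (2 : ℂ) • scatEnd hk + pairCreEnd G

/-! #### Commutation relations -/

theorem scatEnd_creEnd (F : OneParticle D m) :
    scatEnd hk * creEnd F - creEnd F * scatEnd hk = creEnd (oneKernel hk F) := by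
  rw [sub_eq_iff_eq_add]
  refine LinearMap.ext fun x => Subtype.ext (Fock.ext fun n => ?_)
  cases n with
  | zero => 
    refine (map_zero (scatSector hk 0)).trans ?_
    exact (add_zero (0 : nParticle D m 0)).symm
  | succ n => exact scatSector_comp_cre hk F n (component (x : Fock D m) n)

theorem pairAnnEnd_annEnd (F : OneParticle D m) :
    pairAnnEnd G * annEnd F - annEnd F * pairAnnEnd G = 0 := by
  rw [sub_eq_zero]
  refine LinearMap.ext fun x => Subtype.ext (Fock.ext fun n => ?_)
  exact pairAnnSector_comp_ann F G n (component (x : Fock D m) (n + 3))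

theorem pairAnnEnd_creEnd (F : OneParticle D m)
    (hG : G =ᵐ[(shellMeasure D m).prod (shellMeasure D m)] fun z => G (z.2, z.1)) :
    pairAnnEnd G * creEnd F - creEnd F * pairAnnEnd G = (2 : ℂ) • annEnd (contract F G) := by
  rw [sub_eq_iff_eq_add]
  refine LinearMap.ext fun x => Subtype.ext (Fock.ext fun n => ?_)
  cases n with
  | zero =>
    refine (pairAnnSector_zero_cre F hG (component (x : Fock D m) 1)).trans ?_
    exact (add_zero _).symm
  | succ n => exact pairAnnSector_succ_cre n F hG (component (x : Fock D m) (n + 2))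

-- Three commutators are computed, and the other three are their formal adjoints. Adjunction
-- reverses the commutator, so creators and annihilators of the same one-particle vector appear with
-- opposite signs.
variable {G} in
theorem wickEnd_fieldEnd (hherm : ∀ x q, k q x = star (k x q))
    (hG : G =ᵐ[(shellMeasure D m).prod (shellMeasure D m)] fun z => G (z.2, z.1))
    (F : OneParticle D m) :
    wickEnd hk G * fieldEnd F - fieldEnd F * wickEnd hk G =
      (2 : ℂ) • (creEnd (oneKernel hk F - contract F G) - annEnd (oneKernel hk F - contract F G)) := by
  have ha := formalAdjoint_annEnd F
  have hs := formalAdjoint_scatEnd hk hherm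
  have hp := formalAdjoint_pairAnnEnd G
  have c1 := scatEnd_creEnd hk F
  have c2 := pairAnnEnd_creEnd G F hG
  have c3 := pairAnnEnd_annEnd G F
  -- The formal adjoint of `c1`, with the products reversed.
  have c1' : annEnd F * scatEnd hk - scatEnd hk * annEnd F = annEnd (oneKernel hk F) := by
    have h := (hs.mul ha.symm).sub (ha.symm.mul hs)
    rw [c1] at h
    exact h.unique (formalAdjoint_annEnd _).symm
  have c2' : annEnd F * pairCreEnd G - pairCreEnd G * annEnd F =
      (2 : ℂ) • creEnd (contract F G) := by
    have h := (hp.mul ha.symm).sub (ha.symm.mul hp)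
    rw [c2] at h
    have h2 := (formalAdjoint_annEnd (contract F G)).smul 2
    rw [show star (2 : ℂ) = 2 from by simp] at h2
    exact h.unique h2
  have c3' : creEnd F * pairCreEnd G - pairCreEnd G * creEnd F = 0 := by
    have h := (hp.mul ha).sub (ha.mul hp)
    rw [c3] at h
    exact h.unique fun x y => by simp
  have hsub : ∀ A B : OneParticle D m, creEnd (A - B) - annEnd (A - B) =
      (creEnd A - annEnd A) - (creEnd B - annEnd B) := fun A B => by
    have h1 := creEnd_add (A - B) B
    have h2 := annEnd_add (A - B) B
    rw [sub_add_cancel] at h1 h2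
    rw [h1, h2]
    abel
  rw [hsub, ← c1, ← c1', smul_sub, smul_sub (2 : ℂ) (creEnd (contract F G)), ← c2, ← c2']
  simp only [wickEnd, fieldEnd, mul_add, add_mul, smul_mul_assoc, mul_smul_comm, smul_sub]
  rw [sub_eq_zero] at c3 c3'
  rw [c3, c3']
  module

/-! #### Bounds -/

theorem upTo_fieldEnd {N : ℕ} {x : finiteParticle D m} (hx : UpTo N x) (F : OneParticle D m) :
    UpTo (N + 1) (fieldEnd F x) :=
  UpTo.add ((upTo_lower _ hx).mono (by omega)) (upTo_raiseOne _ hx)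

theorem upTo_wickEnd {N : ℕ} {x : finiteParticle D m} (hx : UpTo N x) :
    UpTo (N + 2) (wickEnd hk G x) :=
  UpTo.add (UpTo.add ((upTo_lower _ hx).mono (by omega))
    (((upTo_lower _ hx).mono (by omega)).smul 2)) (upTo_raiseTwo _ hx)

theorem norm_annEnd_le (F : OneParticle D m) {N : ℕ} {x : finiteParticle D m} (hx : UpTo N x) :
    ‖(annEnd F x : Fock D m)‖ ≤ N * ‖F‖ * ‖(x : Fock D m)‖ := by
  refine norm_le_of_component (by positivity) (annSector F) (fun _ => rfl) hx fun n hn => ?_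
  refine (norm_annSector_le F n).trans ?_
  gcongr
  have h : (n : ℝ) + 1 ≤ N := by exact_mod_cast hn
  refine (Real.sqrt_le_iff.2 ⟨by positivity, ?_⟩).trans h
  nlinarith [(by positivity : (0 : ℝ) ≤ n)]

theorem norm_pairAnnEnd_le {N : ℕ} {x : finiteParticle D m} (hx : UpTo N x) :
    ‖(pairAnnEnd G x : Fock D m)‖ ≤ N * ‖G‖ * ‖(x : Fock D m)‖ := by
  refine norm_le_of_component (by positivity) (pairAnnSector G) (fun _ => rfl) hx fun n hn => ?_
  refine (norm_pairAnnSector_le G n).trans ?_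
  gcongr
  have h : (n : ℝ) + 2 ≤ N := by exact_mod_cast hn
  refine (Real.sqrt_le_iff.2 ⟨by positivity, ?_⟩).trans h
  nlinarith [(by positivity : (0 : ℝ) ≤ n)]

theorem norm_scatEnd_le {N : ℕ} {x : finiteParticle D m} (hx : UpTo N x) :
    ‖(scatEnd hk x : Fock D m)‖ ≤ N * (2 * C) * ‖(x : Fock D m)‖ := by
  refine norm_le_of_component (j := 0) (by positivity) (scatSector hk) (fun _ => rfl) hx fun n hn => ?_
  refine (norm_scatSector_le hk n).trans ?_
  gcongr
  omega

theorem norm_fieldEnd_le (F : OneParticle D m) {N : ℕ} {x : finiteParticle D m} (hx : UpTo N x) :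
    ‖(fieldEnd F x : Fock D m)‖ ≤ 2 * ‖F‖ * (N + 3) * ‖(x : Fock D m)‖ := by
  have h1 := norm_annEnd_le F hx
  have h2 : ‖(creEnd F x : Fock D m)‖ ≤ (N + 1 : ℕ) * ‖F‖ * ‖(x : Fock D m)‖ :=
    (formalAdjoint_annEnd F).norm_apply_le (by positivity) (fun y hy => norm_annEnd_le F hy)
      (upTo_raiseOne _ hx)
  have h3 : ‖(fieldEnd F x : Fock D m)‖ ≤ ‖(annEnd F x : Fock D m)‖ + ‖(creEnd F x : Fock D m)‖ :=
    norm_add_le _ _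
  push_cast at h2
  have h4 : 0 ≤ ‖F‖ * ‖(x : Fock D m)‖ := by positivity
  nlinarith

theorem norm_wickEnd_le {N : ℕ} {x : finiteParticle D m} (hx : UpTo N x) :
    ‖(wickEnd hk G x : Fock D m)‖ ≤ (2 * ‖G‖ + 4 * C) * (N + 3) * ‖(x : Fock D m)‖ := by
  have h1 := norm_pairAnnEnd_le G hx
  have h2 : ‖(pairCreEnd G x : Fock D m)‖ ≤ (N + 2 : ℕ) * ‖G‖ * ‖(x : Fock D m)‖ :=
    (formalAdjoint_pairAnnEnd G).norm_apply_le (by positivity) (fun y hy => norm_pairAnnEnd_le G hy)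
      (upTo_raiseTwo _ hx)
  have h3 : ‖(wickEnd hk G x : Fock D m)‖ ≤ ‖(pairAnnEnd G x : Fock D m)‖ +
      ‖(2 : ℂ) • (scatEnd hk x : Fock D m)‖ + ‖(pairCreEnd G x : Fock D m)‖ :=
    norm_add₃_le
  rw [norm_smul, RCLike.norm_ofNat] at h3
  have h5 := norm_scatEnd_le hk hx
  push_cast at h2
  have h4 : 0 ≤ ‖G‖ * ‖(x : Fock D m)‖ := by positivity
  have h6 : 0 ≤ C * ‖(x : Fock D m)‖ := by positivity
  nlinarith

theorem isUniformlyAnalytic_fieldEnd (F : OneParticle D m) :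
    IsUniformlyAnalytic (fieldEnd F) (4 * (2 * ‖F‖ + 1)) where
  dense := dense_finiteParticle
  symm := by
    have h := (formalAdjoint_annEnd F).add (formalAdjoint_annEnd F).symm
    rw [add_comm (creEnd F)] at h
    exact h
  -- The radius must be positive even for `F = 0`, hence the `+ 1` in it.
  pos := by positivity
  bound x := by
    obtain ⟨N, hN⟩ := exists_upTo x
    refine ⟨_, norm_pow_apply_le (by positivity) (fun N x hx => ⟨(upTo_fieldEnd hx F).mono
      (by omega), (norm_fieldEnd_le F hx).trans ?_⟩) hN⟩
    gcongr
    linarith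

/-- Half of the quadratic operator. -/
def halfWickEnd : Module.End ℂ (finiteParticle D m) := (1 / 2 : ℂ) • wickEnd hk G

theorem formalAdjoint_wickEnd (hherm : ∀ x q, k q x = star (k x q)) :
    FormalAdjoint (wickEnd hk G) (wickEnd hk G) := by
  have h2 := (formalAdjoint_scatEnd hk hherm).smul 2
  rw [show star (2 : ℂ) = 2 from by simp] at h2
  have h := ((formalAdjoint_pairAnnEnd G).add h2).add (formalAdjoint_pairAnnEnd G).symm
  have e : pairCreEnd G + (2 : ℂ) • scatEnd hk + pairAnnEnd G = wickEnd hk G := by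
    rw [wickEnd]; abel
  rwa [e] at h

theorem isUniformlyAnalytic_wickEnd (hherm : ∀ x q, k q x = star (k x q)) :
    IsUniformlyAnalytic (wickEnd hk G) (4 * (2 * ‖G‖ + 4 * C + 1)) where
  dense := dense_finiteParticle
  symm := formalAdjoint_wickEnd hk G hherm
  pos := by positivity
  bound x := by
    obtain ⟨N, hN⟩ := exists_upTo x
    refine ⟨_, norm_pow_apply_le (by positivity) (fun N x hx => ⟨upTo_wickEnd hk G hx,
      (norm_wickEnd_le hk G hx).trans ?_⟩) hN⟩
    gcongr ?_ * _ * _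
    linarith

theorem norm_halfWickEnd_le {N : ℕ} {x : finiteParticle D m} (hx : UpTo N x) :
    ‖(halfWickEnd hk G x : Fock D m)‖ ≤ (2 * ‖G‖ + 4 * C + 1) * (N + 3) * ‖(x : Fock D m)‖ := by
  have h1 := norm_wickEnd_le hk G hx
  have h2 : ‖(halfWickEnd hk G x : Fock D m)‖ = 1 / 2 * ‖(wickEnd hk G x : Fock D m)‖ := by
    have : ‖((1 / 2 : ℂ) • (wickEnd hk G x : Fock D m))‖ =
        1 / 2 * ‖(wickEnd hk G x : Fock D m)‖ := by
      rw [norm_smul]; simp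
    exact this
  have h3 : 0 ≤ (2 * ‖G‖ + 4 * C) * ((N : ℝ) + 3) * ‖(x : Fock D m)‖ := by positivity
  have h4 : 0 ≤ ((N : ℝ) + 3) * ‖(x : Fock D m)‖ := by positivity
  rw [h2]
  linarith

theorem norm_halfWickEnd_pow_le {N : ℕ} {x : finiteParticle D m} (hx : UpTo N x) (j : ℕ) :
    ‖((halfWickEnd hk G ^ j) x : Fock D m)‖ ≤
      2 ^ (N + 2) * ‖(x : Fock D m)‖ * (4 * (2 * ‖G‖ + 4 * C + 1)) ^ j * j.factorial :=
  norm_pow_apply_le (by positivity) (fun _ _ hx => ⟨(upTo_wickEnd hk G hx).smul _,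
    norm_halfWickEnd_le hk G hx⟩) hx j

theorem isUniformlyAnalytic_halfWickEnd (hherm : ∀ x q, k q x = star (k x q)) :
    IsUniformlyAnalytic (halfWickEnd hk G) (4 * (2 * ‖G‖ + 4 * C + 1)) where
  dense := dense_finiteParticle
  symm := by
    have h := (formalAdjoint_wickEnd hk G hherm).smul (1 / 2)
    rw [show star (1 / 2 : ℂ) = 1 / 2 from by simp] at h
    exact h
  pos := by positivity
  bound x := by
    obtain ⟨N, hN⟩ := exists_upTo x
    exact ⟨_, norm_halfWickEnd_pow_le hk G hN⟩

/-- The generator of the one-particle transformation, `F ↦ -i (K F - L F̄)`. -/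
def oneGenerator : OneParticle D m →L[ℝ] OneParticle D m :=
  LinearMap.mkContinuous
    { toFun := fun F => -Complex.I • (oneKernel hk F - contract F G)
      map_add' := fun F F' => by
        simp only [contract, map_add, add_apply]
        module
      map_smul' := fun r F => by
        have h1 : r • F = (r : ℂ) • F := (Complex.coe_smul r F).symm
        have h2 : contract ((r : ℂ) • F) G = (r : ℂ) • contract F G := by
          rw [contract, map_smul, map_smulₛₗ, Complex.conj_ofReal]
          rfl
        rw [h1, map_smul, h2, RingHom.id_apply, ← smul_sub, smul_comm, Complex.coe_smul]
        rfl }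
    (‖oneKernel hk‖ + ‖G‖) fun F => by
      change ‖-Complex.I • (oneKernel hk F - contract F G)‖ ≤ _
      rw [norm_smul, norm_neg, Complex.norm_I, one_mul, add_mul]
      refine (norm_sub_le _ _).trans (add_le_add (ContinuousLinearMap.le_opNorm _ _) ?_)
      refine (ContinuousLinearMap.le_opNorm _ _).trans ?_
      rw [LinearIsometryEquiv.norm_map, mul_comm]
      gcongr
      exact norm_tensor_le F

theorem oneGenerator_apply (F : OneParticle D m) :
    oneGenerator hk G F = -Complex.I • (oneKernel hk F - contract F G) := rfl

variable {G} in
theorem star_group_mul_group_mul_group_wick (hherm : ∀ x q, k q x = star (k x q))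
    (hG : G =ᵐ[(shellMeasure D m).prod (shellMeasure D m)] fun z => G (z.2, z.1))
    (F : OneParticle D m) :
    star ((isUniformlyAnalytic_halfWickEnd hk G hherm).group 1) *
      (isUniformlyAnalytic_fieldEnd F).group 1 *
      (isUniformlyAnalytic_halfWickEnd hk G hherm).group 1 =
    (isUniformlyAnalytic_fieldEnd (NormedSpace.exp (oneGenerator hk G) F)).group 1 := by
  refine IsUniformlyAnalytic.star_group_mul_group_mul_group _ fieldEnd fieldEnd_add
    fieldEnd_real_smul (oneGenerator hk G) (fun F => ?_) (fun x => ?_)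
    (fun F => isUniformlyAnalytic_fieldEnd F) F
  · have h := wickEnd_fieldEnd hk hherm hG F
    have e : halfWickEnd hk G * fieldEnd F - fieldEnd F * halfWickEnd hk G =
        (1 / 2 : ℂ) • (wickEnd hk G * fieldEnd F - fieldEnd F * wickEnd hk G) := by
      rw [halfWickEnd, smul_mul_assoc, mul_smul_comm]
      exact (smul_sub _ _ _).symm
    -- The scalar -i leaves the creator unchanged and the annihilator conjugated; multiplied by i
    -- this gives the signs +1 and -1.
    rw [e, h, smul_smul, oneGenerator_apply,
      fieldEnd, annEnd_smul, creEnd_smul, smul_add, smul_smul, smul_smul]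
    simp [sub_eq_add_neg, add_comm]
  · obtain ⟨N, hN⟩ := exists_upTo x
    -- The vector Φ(F) x has at most N + 1 particles whatever F is, and its norm is bounded linearly
    -- in ‖F‖.
    refine ⟨2 ^ (N + 1 + 2) * (2 * (N + 3) * ‖(x : Fock D m)‖), fun F j => ?_⟩
    refine (norm_halfWickEnd_pow_le hk G (upTo_fieldEnd hN F) j).trans ?_
    have h := norm_fieldEnd_le F hN
    calc 2 ^ (N + 1 + 2) * ‖(fieldEnd F x : Fock D m)‖ * (4 * (2 * ‖G‖ + 4 * C + 1)) ^ j *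
          j.factorial
        ≤ 2 ^ (N + 1 + 2) * (2 * ‖F‖ * (N + 3) * ‖(x : Fock D m)‖) *
          (4 * (2 * ‖G‖ + 4 * C + 1)) ^ j * j.factorial := by gcongr
      _ = _ := by ring

end FockOperators

end LocalSqueezing
end

noncomputable section

namespace LocalSqueezing

/-! ### The field and the Wick square -/

section Identification

open scoped NNReal

variable {D : ℕ} {m : ℝ}

/-- A generator agreeing with B on the domain is symmetric and extends B, so it is contained in the
adjoint of B, which generates the group of B. -/
theorem IsUniformlyAnalytic.eq_group {E : Type*} [NormedAddCommGroup E] [InnerProductSpace ℂ E]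
    [CompleteSpace E] {S : Submodule ℂ E} {B : Module.End ℂ S} {R : ℝ}
    (hB : IsUniformlyAnalytic B R) {V : ℝ → E →L[ℂ] E} (hVu : ∀ s, V s ∈ unitary (E →L[ℂ] E))
    (hVadd : ∀ s t, V (s + t) = V s * V t) (hgen : ∀ x : S, Generates V x (B x)) (s : ℝ) :
    V s = hB.group s := by
  refine (eq_of_generates hB.group_mem_unitary hB.group_add hVu hVadd (fun ψ χ hψ => ?_) ?_ s).symm
  · refine hB.generates_of_adjoint fun x => ?_
    exact (hψ.symm hVu hVadd (hgen x)).symm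
  · exact hB.dense.mono fun x hx => ⟨_, hgen ⟨x, hx⟩⟩

theorem wave_ext {ψ φ : Fock D m} (h : ∀ n, wave ψ n =ᵐ[nMeasure D m n] wave φ n) : ψ = φ :=
  Fock.ext fun n => Subtype.ext (Lp.ext (h n))

theorem wave_add_ae (ψ φ : Fock D m) (n : ℕ) :
    wave (ψ + φ) n =ᵐ[nMeasure D m n] fun p => wave ψ n p + wave φ n p :=
  Lp.coeFn_add (component ψ n : Lp ℂ 2 (nMeasure D m n)) (component φ n : Lp ℂ 2 (nMeasure D m n))

theorem wave_smul_ae (c : ℂ) (ψ : Fock D m) (n : ℕ) :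
    wave (c • ψ) n =ᵐ[nMeasure D m n] fun p => c * wave ψ n p :=
  Lp.coeFn_smul c (component ψ n : Lp ℂ 2 (nMeasure D m n))

theorem wave_annEnd_ae (F : OneParticle D m) (x : finiteParticle D m) (n : ℕ) :
    wave (annEnd F x : Fock D m) n =ᵐ[nMeasure D m n] annihilation F (x : Fock D m) n := by
  have h1 : wave (annEnd F x : Fock D m) n =
    (annSector F n (component (x : Fock D m) (n + 1)) : Lp ℂ 2 (nMeasure D m n)) := rfl
  rw [h1, coe_annSector]
  filter_upwards [Lp.coeFn_smul (√(n + 1 : ℝ) : ℂ) (((slot m n 0).attach F).adjoint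
    (component (x : Fock D m) (n + 1) : Lp ℂ 2 _)), adjoint_attach_slot_ae (EventuallyEq.refl _ F)
    (EventuallyEq.refl _ (component (x : Fock D m) (n + 1) : Lp ℂ 2 (nMeasure D m (n + 1))))]
    with p h2 h3
  rw [h2, Pi.smul_apply, h3]
  rfl

theorem wave_zero_ae (ψ : Fock D m) {n : ℕ} (h : component ψ n = 0) :
    wave ψ n =ᵐ[nMeasure D m n] fun _ => 0 := by
  rw [wave, h]
  exact Lp.coeFn_zero ℂ 2 (nMeasure D m n)

theorem wave_creEnd_ae (F : OneParticle D m) (x : finiteParticle D m) (n : ℕ) :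
    wave (creEnd F x : Fock D m) n =ᵐ[nMeasure D m n] creation F (x : Fock D m) n := by
  cases n with
  | zero => exact wave_zero_ae _ rfl
  | succ n =>
    have h1 : wave (creEnd F x : Fock D m) (n + 1) = ((annSector F n).adjoint
      (component (x : Fock D m) n) : Lp ℂ 2 (nMeasure D m (n + 1))) := rfl
    rw [h1, coe_adjoint_annSector]
    filter_upwards [Lp.coeFn_smul (√(n + 1 : ℝ) : ℂ)⁻¹ (∑ i, (slot m n i).attach F
      (component (x : Fock D m) n : Lp ℂ 2 _)), coeFn_sum_ae Finset.univ fun i =>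
      attach_slot_ae i (EventuallyEq.refl _ F)
        (EventuallyEq.refl _ (component (x : Fock D m) n : Lp ℂ 2 (nMeasure D m n)))]
      with p h2 h3
    rw [h2, Pi.smul_apply, h3]
    rfl

theorem isField_fieldEnd (F : OneParticle D m) :
    IsField F ((finiteParticle D m).subtype ∘ₗ fieldEnd F) := fun x n => by
  filter_upwards [wave_add_ae (annEnd F x : Fock D m) (creEnd F x) n, wave_annEnd_ae F x n,
    wave_creEnd_ae F x n] with p h1 h2 h3
  rw [← h2, ← h3, ← h1]
  rfl

/-- A Fock vector is determined by its wave functions almost everywhere, so the operator chosen in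
`field` is the constructed one. -/
theorem IsField.unique {F : OneParticle D m} {T T' : finiteParticle D m →ₗ[ℂ] Fock D m}
    (h : IsField F T) (h' : IsField F T') : T = T' :=
  LinearMap.ext fun x => wave_ext fun n => (h x n).trans (h' x n).symm

theorem isField_field (F : OneParticle D m) : IsField F (field F).toFun := by
  have h : ∃ T, IsField F T := ⟨_, isField_fieldEnd F⟩
  unfold field
  dsimp only
  rw [dif_pos h]
  exact h.choose_spec

theorem field_eq (F : OneParticle D m) : field F = endPMap (fieldEnd F) := by
  have h := (isField_field F).unique (isField_fieldEnd F)
  rw [endPMap, ← h]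
  rfl

theorem weyl_eq (F : OneParticle D m) :
    weyl F = (isUniformlyAnalytic_fieldEnd F).group 1 := by
  rw [weyl, field_eq, (isUniformlyAnalytic_fieldEnd F).expI_closure]

/-! ### The Wick square as the constructed quadratic operator -/

variable {h : Spacetime D → ℝ} {C : ℝ≥0}
  {hk : IsSchurKernel (shellMeasure D m) (fun p q => fourier h (shell m p - shell m q)) C}
  {G : Lp ℂ 2 ((shellMeasure D m).prod (shellMeasure D m))}

/-- Annihilation pairs with the conjugate of G, so `hstar`, the reality of h, is what turns h̃(p+q)
into the kernel h̃(-p-q). -/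
theorem isWickSquare_wickEnd (hG : G =ᵐ[(shellMeasure D m).prod (shellMeasure D m)]
      fun z => fourier h (shell m z.1 + shell m z.2))
    (hstar : ∀ u v, star (fourier h (shell m u + shell m v)) =
      fourier h (-shell m u - shell m v)) :
    IsWickSquare h ((finiteParticle D m).subtype ∘ₗ wickEnd hk G) := fun x n => by
  have hP : wave (pairAnnEnd G x : Fock D m) n =ᵐ[nMeasure D m n]
      pairAnnihilation h (x : Fock D m) n := by
    have h1 : wave (pairAnnEnd G x : Fock D m) n =
      (pairAnnSector G n (component (x : Fock D m) (n + 2)) : Lp ℂ 2 (nMeasure D m n)) := rfl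
    rw [h1, coe_pairAnnSector]
    filter_upwards [Lp.coeFn_smul (√((n + 1 : ℝ) * (n + 2)) : ℂ)
      (((pairSlot m n 0 0).attach G).adjoint (component (x : Fock D m) (n + 2) : Lp ℂ 2 _)),
      adjoint_attach_pairSlot_ae hG (EventuallyEq.refl _
        (component (x : Fock D m) (n + 2) : Lp ℂ 2 (nMeasure D m (n + 2))))] with p h2 h3
    rw [h2, Pi.smul_apply, h3]
    simp only [hstar]
    rfl
  have hS : wave (scatEnd hk x : Fock D m) n =ᵐ[nMeasure D m n]
      scattering h (x : Fock D m) n := by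
    have h1 : wave (scatEnd hk x : Fock D m) n =
      (scatSector hk n (component (x : Fock D m) n) : Lp ℂ 2 (nMeasure D m n)) := rfl
    rw [h1, coe_scatSector]
    exact coeFn_sum_ae Finset.univ fun i => kernelAt_ae hk i
      (EventuallyEq.refl _ (component (x : Fock D m) n : Lp ℂ 2 (nMeasure D m n)))
  have hC : wave (pairCreEnd G x : Fock D m) n =ᵐ[nMeasure D m n]
      pairCreation h (x : Fock D m) n := by
    match n with
    | 0 => exact wave_zero_ae _ rfl
    | 1 => exact wave_zero_ae _ rfl
    | n + 2 =>
      have h1 : wave (pairCreEnd G x : Fock D m) (n + 2) = ((pairAnnSector G n).adjoint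
        (component (x : Fock D m) n) : Lp ℂ 2 (nMeasure D m (n + 2))) := rfl
      rw [h1, coe_adjoint_pairAnnSector]
      filter_upwards [Lp.coeFn_smul (√((n + 1 : ℝ) * (n + 2)) : ℂ)⁻¹ (∑ i, ∑ j,
        (pairSlot m n i j).attach G (component (x : Fock D m) n : Lp ℂ 2 _)),
        coeFn_sum_ae Finset.univ fun i => coeFn_sum_ae Finset.univ fun j =>
        attach_pairSlot_ae i j hG
          (EventuallyEq.refl _ (component (x : Fock D m) n : Lp ℂ 2 (nMeasure D m n)))]
        with p h2 h3
      rw [h2, Pi.smul_apply, h3]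
      rfl
  filter_upwards [wave_add_ae ((pairAnnEnd G x : Fock D m) + (2 : ℂ) • (scatEnd hk x : Fock D m))
    (pairCreEnd G x) n, wave_add_ae (pairAnnEnd G x : Fock D m)
    ((2 : ℂ) • (scatEnd hk x : Fock D m)) n, wave_smul_ae 2 (scatEnd hk x : Fock D m) n,
    hP, hS, hC] with p h1 h2 h3 h4 h5 h6
  rw [← h4, ← h5, ← h6, ← h3, ← h2, ← h1]
  rfl

theorem IsWickSquare.unique {T T' : finiteParticle D m →ₗ[ℂ] Fock D m}
    (hT : IsWickSquare h T) (hT' : IsWickSquare h T') : T = T' :=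
  LinearMap.ext fun x => wave_ext fun n => (hT x n).trans (hT' x n).symm

theorem IsWickSquare.toFun_wickSquare {T : finiteParticle D m →ₗ[ℂ] Fock D m}
    (hT : IsWickSquare h T) : IsWickSquare h (wickSquare m h).toFun := by
  have h : ∃ T, IsWickSquare h T := ⟨_, hT⟩
  unfold wickSquare
  dsimp only
  rw [dif_pos h]
  exact h.choose_spec

theorem wickSquare_eq {B : Module.End ℂ (finiteParticle D m)}
    (hB : IsWickSquare h ((finiteParticle D m).subtype ∘ₗ B)) : wickSquare m h = endPMap B := by
  have h := hB.toFun_wickSquare.unique hB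
  rw [endPMap, ← h]
  rfl

/-- The half may be taken before or after closing the operator: the group of the scaled closure has
a generator extending the half operator on finite-particle vectors, and this determines the group.
-/
theorem group_half_wickEnd {k : Momentum D → Momentum D → ℂ}
    (hk : IsSchurKernel (shellMeasure D m) k C) (hherm : ∀ x q, k q x = star (k x q)) :
    expI ((1 / 2 : ℂ) • (endPMap (wickEnd hk G)).closure) =
      (isUniformlyAnalytic_halfWickEnd hk G hherm).group 1 := by
  have hW := isUniformlyAnalytic_wickEnd hk G hherm
  have hU := hW.isUnitaryGroup.real_smul (c := 1 / 2) (by norm_num)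
  rw [show (((1 / 2 : ℝ) : ℝ) : ℂ) = 1 / 2 by push_cast; rfl] at hU
  have hle := LinearPMap.le_closure (endPMap (wickEnd hk G))
  rw [hU.expI_eq (hW.dense.mono hle.1)]
  refine (isUniformlyAnalytic_halfWickEnd hk G hherm).eq_group hU.unitary hU.add (fun x => ?_) 1
  refine (hU.generator _ _).1 ?_
  have hx : (x : Fock D m) ∈ (endPMap (wickEnd hk G)).closure.domain := hle.1 x.2
  rw [LinearPMap.mem_graph_iff]
  refine ⟨⟨x, hx⟩, rfl, ?_⟩
  have h2 : (endPMap (wickEnd hk G)).closure ⟨x, hx⟩ = (wickEnd hk G x : Fock D m) :=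
    (hle.2 (x := x) (y := ⟨x, hx⟩) rfl).symm
  rw [LinearPMap.smul_apply]
  exact congrArg ((1 / 2 : ℂ) • ·) h2

end Identification

end LocalSqueezing
end

noncomputable section

namespace LocalSqueezing

/-! ### Fourier transforms on the mass shell -/

section Fourier

open scoped NNReal

variable {D : ℕ} {m : ℝ}

theorem minkowski_add_left (k l x : Spacetime D) :
    minkowski (k + l) x = minkowski k x + minkowski l x := by
  simp only [minkowski, PiLp.add_apply, add_mul, Finset.sum_add_distrib]
  ring

theorem minkowski_neg_left (k x : Spacetime D) : minkowski (-k) x = -minkowski k x := by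
  simp only [minkowski, PiLp.neg_apply, neg_mul, Finset.sum_neg_distrib]
  ring

theorem star_fourier (f : Spacetime D → ℝ) (k : Spacetime D) :
    star (fourier f k) = fourier f (-k) := by
  rw [fourier, fourier, RCLike.star_def, ← integral_conj]
  refine integral_congr_ae (ae_of_all _ fun x => ?_)
  simp only [map_mul, Complex.conj_ofReal, ← Complex.exp_conj, map_neg, Complex.conj_I,
    minkowski_neg_left]
  congr 2
  push_cast
  ring

/-- The reflection of the time axis, as a point of Minkowski space. -/
def timeReflect (k : Spacetime D) : Spacetime D :=
  WithLp.toLp 2 (Fin.cons (-k 0) (fun i : Fin D => k i.succ))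

theorem norm_timeReflect (k : Spacetime D) : ‖timeReflect k‖ = ‖k‖ := by
  rw [EuclideanSpace.norm_eq, EuclideanSpace.norm_eq, Fin.sum_univ_succ, Fin.sum_univ_succ]
  simp [timeReflect]

theorem continuous_timeReflect : Continuous (timeReflect : Spacetime D → Spacetime D) := by
  refine (PiLp.continuous_toLp 2 _).comp (continuous_pi fun i => ?_)
  refine Fin.cases ?_ (fun i => ?_) i
  · simp only [Fin.cons_zero]; fun_prop
  · simp only [Fin.cons_succ]; fun_prop

theorem continuous_fourier (f : 𝓢(Spacetime D, ℝ)) : Continuous (fourier f) := by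
  have h : fourier f = fun k => FourierTransform.fourier (f.postcompCLM Complex.ofRealCLM)
      ((2 * Real.pi)⁻¹ • timeReflect k) := funext fun k => fourier_eq f k
  rw [h]
  exact (SchwartzMap.continuous _).comp (continuous_timeReflect.fun_const_smul _)

/-- The seminorms of the standard Fourier transform give the decay. Its argument is scaled by
(2π)⁻¹, which costs (2π)^N, and reflected in time, which preserves the norm. -/
theorem exists_fourier_decay (f : 𝓢(Spacetime D, ℝ)) (N : ℕ) :
    ∃ C : ℝ, 0 ≤ C ∧ ∀ k, (1 + ‖k‖) ^ N * ‖fourier f k‖ ≤ C := by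
  set g := FourierTransform.fourier (f.postcompCLM Complex.ofRealCLM) with hg
  set C := 2 ^ N * (Finset.Iic ((N, 0) : ℕ × ℕ)).sup
    (fun k => SchwartzMap.seminorm ℝ k.1 k.2) g with hC
  have hdec : ∀ x : Spacetime D, (1 + ‖x‖) ^ N * ‖g x‖ ≤ C := fun x => by
    simpa using SchwartzMap.one_add_le_sup_seminorm_apply (𝕜 := ℝ) (m := (N, 0))
      (k := N) (n := 0) le_rfl le_rfl g x
  have hC0 : 0 ≤ C := le_trans (by positivity) (hdec 0)
  have hp1 : (1 : ℝ) ≤ 2 * Real.pi := by linarith [Real.pi_gt_three]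
  refine ⟨C * (2 * Real.pi) ^ N, by positivity, fun k => ?_⟩
  have h1 := hdec ((2 * Real.pi)⁻¹ • timeReflect k)
  have h2 : fourier f k = g ((2 * Real.pi)⁻¹ • timeReflect k) := fourier_eq f k
  rw [← h2] at h1
  have h3 : (2 * Real.pi)⁻¹ * (1 + ‖k‖) ≤ 1 + ‖(2 * Real.pi)⁻¹ • timeReflect k‖ := by
    rw [norm_smul, mul_add, mul_one, Real.norm_of_nonneg (by positivity), norm_timeReflect]
    have := inv_le_one_of_one_le₀ hp1
    gcongr
  have h5 : ((2 * Real.pi)⁻¹ * (1 + ‖k‖)) ^ N * ‖fourier f k‖ ≤ C :=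
    le_trans (by gcongr) h1
  rw [mul_pow, inv_pow, mul_assoc, inv_mul_le_iff₀ (by positivity)] at h5
  linarith

theorem continuous_shell : Continuous (shell m : Momentum D → Spacetime D) := by
  refine (PiLp.continuous_toLp 2 _).comp (continuous_pi fun i => ?_)
  refine Fin.cases ?_ (fun i => ?_) i
  · simp only [Fin.cons_zero]; exact continuous_energy m
  · simp only [Fin.cons_succ]; fun_prop

theorem norm_le_energy (p : Momentum D) : ‖p‖ ≤ energy m p :=
  Real.le_sqrt_of_sq_le (by nlinarith [sq_nonneg m])

theorem abs_zero_le_norm (k : Spacetime D) : |k 0| ≤ ‖k‖ := by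
  simpa using PiLp.norm_apply_le k 0

theorem norm_sub_le_norm_shell_sub (p q : Momentum D) : ‖p - q‖ ≤ ‖shell m p - shell m q‖ := by
  have h : shell m p - shell m q = WithLp.toLp 2
      (Fin.cons (energy m p - energy m q) (fun i => (p - q) i)) := by
    ext i
    refine Fin.cases ?_ (fun i => ?_) i <;> simp [shell]
  rw [h]
  exact norm_le_norm_cons _ _

/-- On one shell the energies add without cancellation and dominate the momenta. Decay in p + q is
thus decay in both momenta. -/
theorem one_add_mul_one_add_le (p q : Momentum D) :
    (1 + ‖p‖) * (1 + ‖q‖) ≤ (1 + ‖shell m p + shell m q‖) ^ 2 := by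
  have h := abs_zero_le_norm (shell m p + shell m q)
  have h0 : (shell m p + shell m q) 0 = energy m p + energy m q := rfl
  rw [h0] at h
  have hp := norm_le_energy (m := m) p
  have hq := norm_le_energy (m := m) q
  have h1 := le_abs_self (energy m p + energy m q)
  have hp0 := norm_nonneg p
  have hq0 := norm_nonneg q
  nlinarith

theorem exists_shellMeasure_le (hm : 0 < m) : ∃ c : ℝ≥0, shellMeasure D m ≤
    (c : ℝ≥0∞) • (volume : Measure (Momentum D)) := by
  refine ⟨(1 / ((2 * Real.pi) ^ D * (2 * m))).toNNReal, ?_⟩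
  rw [← withDensity_const]
  refine withDensity_mono (ae_of_all _ fun p => ENNReal.ofReal_le_ofReal ?_)
  have := le_energy (m := m) p
  gcongr

/-- An integrable weight on momentum space. -/
def weight (p : Momentum D) : ℝ := ((1 + ‖p‖) ^ (D + 1))⁻¹

theorem weight_nonneg (p : Momentum D) : 0 ≤ weight p := by unfold weight; positivity

theorem weight_le_one (p : Momentum D) : weight p ≤ 1 :=
  inv_le_one_of_one_le₀ (one_le_pow₀ (by linarith [norm_nonneg p]))

theorem integrable_weight_volume : Integrable (weight : Momentum D → ℝ) := by
  refine (integrable_one_add_norm (E := Momentum D) (μ := volume)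
    (r := (D : ℝ) + 1) (by simp)).congr (ae_of_all _ fun p => ?_)
  dsimp only
  rw [Real.rpow_neg (by positivity), weight]
  congr 1
  exact_mod_cast Real.rpow_natCast (1 + ‖p‖) (D + 1)

theorem integrable_weight (hm : 0 < m) :
    Integrable (weight : Momentum D → ℝ) (shellMeasure D m) := by
  obtain ⟨c, hc⟩ := exists_shellMeasure_le (D := D) hm
  exact (integrable_weight_volume.smul_measure ENNReal.coe_ne_top).mono_measure hc

theorem exists_fourier_sub_le (f : 𝓢(Spacetime D, ℝ)) (m : ℝ) : ∃ C : ℝ, 0 ≤ C ∧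
    ∀ p q, ‖fourier f (shell m p - shell m q)‖ ≤ C * weight (p - q) := by
  obtain ⟨C, hC0, hC⟩ := exists_fourier_decay f (D + 1)
  refine ⟨C, hC0, fun p q => ?_⟩
  rw [weight, ← div_eq_mul_inv, le_div_iff₀ (by positivity), mul_comm]
  refine le_trans ?_ (hC (shell m p - shell m q))
  gcongr
  exact norm_sub_le_norm_shell_sub p q

theorem exists_fourier_add_le (f : 𝓢(Spacetime D, ℝ)) (m : ℝ) : ∃ C : ℝ, 0 ≤ C ∧
    ∀ p q, ‖fourier f (shell m p + shell m q)‖ ≤ C * (weight p * weight q) := by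
  obtain ⟨C, hC0, hC⟩ := exists_fourier_decay f (2 * (D + 1))
  refine ⟨C, hC0, fun p q => ?_⟩
  rw [weight, weight, ← mul_inv, ← mul_pow, ← div_eq_mul_inv, le_div_iff₀ (by positivity), mul_comm]
  refine le_trans ?_ (hC (shell m p + shell m q))
  rw [pow_mul]
  gcongr
  exact one_add_mul_one_add_le p q

/-- The kernel is dominated by an integrable function of the difference of the momenta. The shell
measure is at most a multiple of Lebesgue measure, whose translation invariance gives one finite
bound for both variables. -/
theorem exists_isSchurKernel (hm : 0 < m) (h : 𝓢(Spacetime D, ℝ)) :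
    ∃ C, IsSchurKernel (shellMeasure D m) (fun p q => fourier h (shell m p - shell m q)) C := by
  obtain ⟨C, hC0, hC⟩ := exists_fourier_sub_le h m
  obtain ⟨c, hc⟩ := exists_shellMeasure_le (D := D) hm
  have hw : ∫⁻ p : Momentum D, ENNReal.ofReal (weight p) < ∞ := by
    rw [← ofReal_integral_eq_lintegral_ofReal integrable_weight_volume
      (ae_of_all _ weight_nonneg)]
    exact ENNReal.ofReal_lt_top
  set B : ℝ≥0∞ := c * (ENNReal.ofReal C * ∫⁻ p : Momentum D, ENNReal.ofReal (weight p)) with hB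
  have hBt : B ≠ ∞ := (ENNReal.mul_lt_top ENNReal.coe_lt_top
    (ENNReal.mul_lt_top ENNReal.ofReal_lt_top hw)).ne
  have hbd : ∀ p q, ‖fourier h (shell m p - shell m q)‖ₑ ≤
      ENNReal.ofReal C * ENNReal.ofReal (weight (p - q)) := fun p q => by
    rw [← ofReal_norm, ← ENNReal.ofReal_mul hC0]
    exact ENNReal.ofReal_le_ofReal (hC p q)
  have hle : ∀ u : Momentum D → ℝ≥0∞, ∫⁻ q, u q ∂shellMeasure D m ≤ c * ∫⁻ q, u q := fun u => by
    refine (lintegral_mono' hc le_rfl).trans ?_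
    rw [lintegral_smul_measure]
    rfl
  refine ⟨B.toNNReal, ?_, fun p => ?_, fun q => ?_⟩
  · exact ((continuous_fourier h).comp ((continuous_shell.comp continuous_fst).sub
      (continuous_shell.comp continuous_snd))).measurable
  · rw [ENNReal.coe_toNNReal hBt]
    refine (hle _).trans ?_
    rw [hB]
    gcongr
    refine (lintegral_mono (hbd p)).trans ?_
    rw [lintegral_const_mul' _ _ ENNReal.ofReal_ne_top,
      lintegral_sub_left_eq_self (fun q => ENNReal.ofReal (weight q)) p]
  · rw [ENNReal.coe_toNNReal hBt]
    refine (hle _).trans ?_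
    rw [hB]
    gcongr
    refine (lintegral_mono fun p => hbd p q).trans ?_
    rw [lintegral_const_mul' _ _ ENNReal.ofReal_ne_top,
      lintegral_sub_right_eq_self (fun q => ENNReal.ofReal (weight q)) q]

/-- The product weight is at most 1, so its square is dominated by the weight itself, which is
integrable. -/
theorem memLp_pairKernel (hm : 0 < m) (h : 𝓢(Spacetime D, ℝ)) :
    MemLp (fun z : Momentum D × Momentum D => fourier h (shell m z.1 + shell m z.2)) 2
      ((shellMeasure D m).prod (shellMeasure D m)) := by
  obtain ⟨C, hC0, hC⟩ := exists_fourier_add_le h m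
  have hcont : Continuous fun z : Momentum D × Momentum D =>
      fourier h (shell m z.1 + shell m z.2) :=
    (continuous_fourier h).comp ((continuous_shell.comp continuous_fst).add
      (continuous_shell.comp continuous_snd))
  rw [memLp_two_iff_integrable_sq_norm hcont.aestronglyMeasurable]
  refine Integrable.mono' (((integrable_weight hm).mul_prod (integrable_weight hm)).const_mul
    (C ^ 2)) (hcont.norm.pow 2).aestronglyMeasurable (ae_of_all _ fun z => ?_)
  rw [Real.norm_of_nonneg (by positivity)]
  have h1 := hC z.1 z.2
  have hp := weight_nonneg z.1
  have hq := weight_nonneg z.2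
  have h2 : weight z.1 * weight z.2 ≤ 1 := mul_le_one₀ (weight_le_one _) hq (weight_le_one _)
  calc ‖fourier h (shell m z.1 + shell m z.2)‖ ^ 2
      ≤ (C * (weight z.1 * weight z.2)) ^ 2 := by gcongr
    _ = C ^ 2 * (weight z.1 * weight z.2) * (weight z.1 * weight z.2) := by ring
    _ ≤ C ^ 2 * (weight z.1 * weight z.2) * 1 := by gcongr
    _ = _ := mul_one _

end Fourier

end LocalSqueezing
end

noncomputable section

namespace LocalSqueezing

/-! ### Density of the one-particle vectors -/

section Density

open scoped ContDiff

variable {D : ℕ} {m : ℝ}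

/-- The reflection of the time axis as a continuous linear map. -/
def timeReflectL : Spacetime D →L[ℝ] Spacetime D :=
  LinearMap.toContinuousLinearMap
    { toFun := timeReflect
      map_add' := fun k l => by
        ext i
        refine Fin.cases ?_ (fun i => ?_) i
        · simp [timeReflect]; ring
        · simp [timeReflect]
      map_smul' := fun c k => by
        ext i
        refine Fin.cases ?_ (fun i => ?_) i <;> simp [timeReflect] }

theorem timeReflectL_apply (k : Spacetime D) : timeReflectL k = timeReflect k := rfl

theorem timeReflect_timeReflect (k : Spacetime D) : timeReflect (timeReflect k) = k := by
  ext i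
  refine Fin.cases ?_ (fun i => ?_) i <;> simp [timeReflect]

theorem inner_timeReflect (k x : Spacetime D) : inner ℝ (timeReflect k) x = minkowski k x := by
  rw [PiLp.inner_apply, Fin.sum_univ_succ, minkowski]
  simp [timeReflect, mul_comm]

/-- The spatial part of a point of Minkowski space. -/
def spatial (k : Spacetime D) : Momentum D := WithLp.toLp 2 fun i => k i.succ

theorem spatial_shell (p : Momentum D) : spatial (shell m p) = p := rfl

theorem contDiff_spatial : ContDiff ℝ ∞ (spatial : Spacetime D → Momentum D) := by
  rw [contDiff_euclidean]
  intro i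
  exact (contDiff_euclidean.1 contDiff_id) i.succ

theorem contDiff_energy (hm : 0 < m) : ContDiff ℝ ∞ (energy m : Momentum D → ℝ) := by
  unfold energy
  exact ContDiff.sqrt (contDiff_const.add (contDiff_norm_sq ℝ)) fun p => by positivity

theorem integral_schwartz_eq (f : 𝓢(Spacetime D, ℂ)) (k : Spacetime D) :
    ∫ x, f x * Complex.exp (-(Complex.I * (minkowski k x : ℂ))) =
      FourierTransform.fourier f ((2 * Real.pi)⁻¹ • timeReflect k) := by
  rw [SchwartzMap.fourier_coe, Real.fourier_eq']
  congr 1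
  ext x
  rw [smul_eq_mul, mul_comm, real_inner_comm, inner_smul_left, inner_timeReflect]
  congr 2
  have hp : (Real.pi : ℂ) ≠ 0 := by exact_mod_cast Real.pi_ne_zero
  simp only [RCLike.conj_to_real]
  push_cast
  field_simp

theorem norm_exp_minkowski (k x : Spacetime D) :
    ‖Complex.exp (-(Complex.I * (minkowski k x : ℂ)))‖ = 1 := by
  simp [Complex.norm_exp]

theorem continuous_minkowski : Continuous fun z : Spacetime D × Spacetime D =>
    minkowski z.1 z.2 := by
  unfold minkowski; fun_prop

theorem integrable_mul_exp {f : Spacetime D → ℂ} (hf : Integrable f) (k : Spacetime D) :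
    Integrable fun x => f x * Complex.exp (-(Complex.I * (minkowski k x : ℂ))) := by
  have hc : Continuous fun x : Spacetime D => Complex.exp (-(Complex.I * (minkowski k x : ℂ))) := by
    unfold minkowski; fun_prop
  exact hf.mul_bdd (c := 1) hc.aestronglyMeasurable
    (ae_of_all _ fun x => (norm_exp_minkowski k x).le)

/-- Conjugating a function conjugates and reflects its transform, so the real part mixes the values
at k and -k with weight 1/2 each. -/
theorem fourier_re (f : 𝓢(Spacetime D, ℂ)) (k : Spacetime D) :
    fourier (f.postcompCLM Complex.reCLM) k =
      (1 / 2 : ℂ) * (FourierTransform.fourier f ((2 * Real.pi)⁻¹ • timeReflect k) +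
        star (FourierTransform.fourier f ((2 * Real.pi)⁻¹ • timeReflect (-k)))) := by
  rw [← integral_schwartz_eq, ← integral_schwartz_eq, RCLike.star_def, ← integral_conj,
    ← integral_add (integrable_mul_exp f.integrable k), ← integral_const_mul]
  · refine integral_congr_ae (ae_of_all _ fun x => ?_)
    simp only [SchwartzMap.postcompCLM_apply, map_mul, ← Complex.exp_conj, map_neg, Complex.conj_I,
      Complex.conj_ofReal, minkowski_neg_left]
    have h1 : ((Complex.reCLM (f x) : ℝ) : ℂ) = (1 / 2) * (f x + (starRingEnd ℂ) (f x)) := by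
      rw [Complex.add_conj]
      simp
    rw [h1]
    push_cast
    ring_nf
  · exact (Complex.conjLIE : ℂ ≃ₗᵢ[ℝ] ℂ).integrable_comp_iff.2 (integrable_mul_exp f.integrable _)

/-- The function g is extended off the mass shell to a smooth, compactly supported function
concentrated near the upper shell; its inverse transform is replaced by the real part. Vanishing on
the lower shell removes the conjugate term. -/
theorem exists_schwartz_onShell (hm : 0 < m) {g : Momentum D → ℂ} (hg : HasCompactSupport g)
    (hg' : ContDiff ℝ ∞ g) : ∃ f : 𝓢(Spacetime D, ℝ), onShell m f = g := by
  -- In the cut-off variable the lower shell is at distance at least 2m from 0, so outer radius m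
  -- excludes it.
  let χ : ContDiffBump (0 : ℝ) := ⟨m / 2, m, by positivity, by linarith⟩
  -- The factor 2 compensates the weight 1/2 from the real part.
  set Φ : Spacetime D → ℂ := fun k => 2 * (g (spatial k) * (χ (k 0 - energy m (spatial k)) : ℝ))
    with hΦ
  have hΦs : ContDiff ℝ ∞ Φ := by
    refine contDiff_const.mul ((hg'.comp contDiff_spatial).mul ?_)
    refine Complex.ofRealCLM.contDiff.comp (χ.contDiff.comp ?_)
    exact ((contDiff_euclidean.1 contDiff_id) 0).sub ((contDiff_energy hm).comp contDiff_spatial)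
  have hΦc : HasCompactSupport Φ := by
    have hj : Continuous fun z : Momentum D × ℝ =>
        (WithLp.toLp 2 (Fin.cons (z.2 + energy m z.1) fun i => z.1 i) : Spacetime D) := by
      refine (PiLp.continuous_toLp 2 _).comp (continuous_pi fun i => ?_)
      refine Fin.cases ?_ (fun i => ?_) i
      · simp only [Fin.cons_zero]
        exact continuous_snd.add ((continuous_energy m).comp continuous_fst)
      · simp only [Fin.cons_succ]; fun_prop
    refine HasCompactSupport.intro ((hg.isCompact.prod (isCompact_closedBall (0 : ℝ) m)).image hj)
      fun k hk => ?_
    by_contra h0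
    refine hk ⟨(spatial k, k 0 - energy m (spatial k)), ⟨?_, ?_⟩, ?_⟩
    · refine subset_tsupport g fun h => h0 ?_
      simp [hΦ, h]
    · by_contra hs
      refine h0 ?_
      have hz : χ (k 0 - energy m (spatial k)) = 0 := by
        refine χ.zero_of_le_dist ?_
        rw [Metric.mem_closedBall, not_le] at hs
        exact hs.le
      simp [hΦ, hz]
    · ext i
      refine Fin.cases ?_ (fun i => ?_) i <;> simp [spatial]
  let e : Spacetime D ≃ₜ Spacetime D :=
    { toFun := fun ξ => timeReflectL ((2 * Real.pi) • ξ)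
      invFun := fun k => (2 * Real.pi)⁻¹ • timeReflectL k
      left_inv := fun ξ => by
        have : (2 * Real.pi) ≠ 0 := by positivity
        simp only [map_smul, timeReflectL_apply, timeReflect_timeReflect, smul_smul,
          inv_mul_cancel₀ this, one_smul]
      right_inv := fun k => by
        have : (2 * Real.pi) ≠ 0 := by positivity
        dsimp only
        rw [smul_smul, mul_inv_cancel₀ this, one_smul, timeReflectL_apply, timeReflectL_apply,
          timeReflect_timeReflect]
      continuous_toFun := by fun_prop
      continuous_invFun := by fun_prop }
  have hes : ContDiff ℝ ∞ e := timeReflectL.contDiff.comp (contDiff_const_smul _)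
  let φ : 𝓢(Spacetime D, ℂ) := (hΦc.comp_homeomorph e).toSchwartzMap (hΦs.comp hes)
  have hφ : ∀ k, φ ((2 * Real.pi)⁻¹ • timeReflect k) = Φ k := fun k =>
    congrArg Φ (e.apply_symm_apply k)
  refine ⟨(FourierTransformInv.fourierInv φ).postcompCLM Complex.reCLM, funext fun p => ?_⟩
  rw [onShell, fourier_re, FourierTransform.fourier_fourierInv_eq, hφ, hφ]
  have h1 : Φ (shell m p) = 2 * g p := by
    have : shell m p 0 - energy m (spatial (shell m p)) = 0 := sub_self _
    rw [hΦ]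
    dsimp only
    rw [this, spatial_shell, χ.one_of_mem_closedBall (by simp [χ]; positivity)]
    simp
  have h2 : Φ (-shell m p) = 0 := by
    have h3 : χ ((-shell m p) 0 - energy m (spatial (-shell m p))) = 0 := by
      refine χ.zero_of_le_dist ?_
      have h4 : (-shell m p) 0 = -energy m p := rfl
      rw [h4, Real.dist_eq, sub_zero, ← abs_neg]
      refine le_trans ?_ (le_abs_self _)
      have h5 := le_energy (m := m) p
      have h6 := energy_pos hm (spatial (-shell m p))
      change m ≤ _
      linarith
    rw [hΦ]
    dsimp only
    rw [h3]
    simp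
  rw [h1, h2]
  simp

/-- The shell measure is finite on compact sets, so smooth compactly supported functions are dense
in L², and each of them is attained exactly. -/
theorem denseRange_oneParticle (hm : 0 < m) : DenseRange (oneParticle (D := D) hm) := by
  obtain ⟨c, hc⟩ := exists_shellMeasure_le (D := D) hm
  have : IsFiniteMeasureOnCompacts (shellMeasure D m) := ⟨fun K hK => by
    refine (hc K).trans_lt ?_
    rw [Measure.smul_apply, smul_eq_mul]
    exact ENNReal.mul_lt_top ENNReal.coe_lt_top hK.measure_lt_top⟩
  refine (Lp.dense_hasCompactSupport_contDiff (F := ℂ) (μ := shellMeasure D m) (p := 2)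
    (by norm_num)).mono ?_
  rintro F ⟨g, hFg, hg, hg'⟩
  obtain ⟨f, hf⟩ := exists_schwartz_onShell hm hg hg'
  refine ⟨f, Lp.ext ?_⟩
  filter_upwards [(memLp_onShell hm f).coeFn_toLp, hFg] with p h1 h2
  rw [oneParticle, h1, h2, hf]

end Density

end LocalSqueezing
end

noncomputable section

namespace LocalSqueezing

/-! ### The commutator function and the one-particle generator -/

section PauliJordan

open scoped ContDiff NNReal

variable {D : ℕ} {m : ℝ}

/-- The positive frequency part of `Δ ∗ g`, up to a factor. -/
def positiveFrequency (m : ℝ) (g : Spacetime D → ℝ) (x : Spacetime D) : ℂ :=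
  ∫ k, fourier g (shell m k) * Complex.exp (Complex.I * (minkowski (shell m k) x : ℂ))
    ∂shellMeasure D m

theorem norm_le_norm_shell (p : Momentum D) : ‖p‖ ≤ ‖shell m p‖ := norm_le_norm_cons _ _

theorem exists_norm_pow_mul_onShell_le (g : 𝓢(Spacetime D, ℝ)) (m : ℝ) (n : ℕ) :
    ∃ C : ℝ, 0 ≤ C ∧ ∀ p, ‖shell m p‖ ^ n * ‖fourier g (shell m p)‖ ≤ C * weight p := by
  obtain ⟨C, hC0, hC⟩ := exists_fourier_decay g (n + (D + 1))
  refine ⟨C, hC0, fun p => ?_⟩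
  rw [weight, ← div_eq_mul_inv, le_div_iff₀ (by positivity)]
  refine le_trans ?_ (hC (shell m p))
  rw [pow_add _ n (D + 1), mul_right_comm]
  have h := norm_le_norm_shell (m := m) p
  gcongr
  linarith

theorem continuous_onShell (g : 𝓢(Spacetime D, ℝ)) : Continuous (onShell m g) :=
  (continuous_fourier g).comp continuous_shell

theorem integrable_norm_pow_mul_onShell (hm : 0 < m) (g : 𝓢(Spacetime D, ℝ)) (n : ℕ) :
    Integrable (fun p => ‖shell m p‖ ^ n * ‖fourier g (shell m p)‖) (shellMeasure D m) := by
  obtain ⟨C, hC0, hC⟩ := exists_norm_pow_mul_onShell_le g m n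
  refine ((integrable_weight hm).const_mul C).mono' ?_ (ae_of_all _ fun p => ?_)
  · exact ((continuous_shell.norm.pow n).mul (continuous_onShell g).norm).aestronglyMeasurable
  · rw [Real.norm_of_nonneg (by positivity)]
    exact hC p

theorem integrable_onShell (hm : 0 < m) (g : 𝓢(Spacetime D, ℝ)) :
    Integrable (onShell m g) (shellMeasure D m) := by
  have h := integrable_norm_pow_mul_onShell hm g 0
  simp only [pow_zero, one_mul] at h
  exact (integrable_norm_iff (continuous_onShell g).aestronglyMeasurable).1 h

/-- The pairing in the exponent of the Fourier transform. -/
def pairingL : Spacetime D →L[ℝ] Spacetime D →L[ℝ] ℝ :=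
  -(2 * Real.pi)⁻¹ • (innerSL ℝ).comp timeReflectL

theorem pairingL_apply (k x : Spacetime D) :
    pairingL k x = -(2 * Real.pi)⁻¹ * minkowski k x := by
  rw [← inner_timeReflect]
  rfl

/-- Pushing the measure forward to the shell in spacetime displays a Fourier integral, whose
derivatives are controlled by moments. -/
theorem positiveFrequency_eq (g : 𝓢(Spacetime D, ℝ)) :
    positiveFrequency m g = VectorFourier.fourierIntegral Real.fourierChar
      ((shellMeasure D m).map (shell m)) pairingL.toLinearMap₁₂ (fourier g) := by
  ext x
  have hL : ∀ v, pairingL.toLinearMap₁₂ v x = -(2 * Real.pi)⁻¹ * minkowski v x :=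
    fun v => pairingL_apply v x
  rw [VectorFourier.fourierIntegral, positiveFrequency,
    integral_map continuous_shell.aemeasurable]
  · refine integral_congr_ae (ae_of_all _ fun k => ?_)
    simp only [hL, Circle.smul_def,
      Real.fourierChar_apply, smul_eq_mul]
    rw [mul_comm]
    congr 2
    have hp : (Real.pi : ℂ) ≠ 0 := by exact_mod_cast Real.pi_ne_zero
    push_cast
    field_simp
  · refine Continuous.aestronglyMeasurable ?_
    have hc : Continuous fun v : Spacetime D => -pairingL.toLinearMap₁₂ v x := by
      simp only [hL]
      exact (continuous_const.mul
        (continuous_minkowski.comp (continuous_id.prodMk continuous_const))).neg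
    exact (Real.continuous_fourierChar.comp hc).smul (continuous_fourier g)

/-- All moments of g̃ on the mass shell are integrable, so every derivative is bounded and growth
exponent 0 serves. -/
theorem hasTemperateGrowth_positiveFrequency (hm : 0 < m) (g : 𝓢(Spacetime D, ℝ)) :
    (positiveFrequency m g).HasTemperateGrowth := by
  have hint : ∀ n : ℕ, (n : ℕ∞) ≤ (⊤ : ℕ∞) → Integrable (fun v => ‖v‖ ^ n * ‖fourier g v‖)
      ((shellMeasure D m).map (shell m)) := fun n _ => by
    rw [integrable_map_measure _ continuous_shell.aemeasurable]
    · exact integrable_norm_pow_mul_onShell hm g n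
    · exact ((continuous_norm.pow n).mul (continuous_fourier g).norm).aestronglyMeasurable
  have hmeas : AEStronglyMeasurable (fourier g) ((shellMeasure D m).map (shell m)) :=
    (continuous_fourier g).aestronglyMeasurable
  rw [positiveFrequency_eq]
  refine ⟨VectorFourier.contDiff_fourierIntegral pairingL hint, fun n => ⟨0,
    ∫ v, ‖VectorFourier.fourierPowSMulRight pairingL (fourier g) v n‖
      ∂(shellMeasure D m).map (shell m), fun x => ?_⟩⟩
  rw [VectorFourier.iteratedFDeriv_fourierIntegral pairingL hint hmeas (n := n) le_top, pow_zero,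
    mul_one]
  exact VectorFourier.norm_fourierIntegral_le_integral_norm _ _ _ _ _

theorem norm_exp_minkowski' (k x : Spacetime D) :
    ‖Complex.exp (Complex.I * (minkowski k x : ℂ))‖ = 1 := by
  simp [Complex.norm_exp]

theorem integrable_positiveFrequency (hm : 0 < m) (g : 𝓢(Spacetime D, ℝ)) (x : Spacetime D) :
    Integrable (fun k => fourier g (shell m k) *
      Complex.exp (Complex.I * (minkowski (shell m k) x : ℂ))) (shellMeasure D m) := by
  have hc : Continuous fun k : Momentum D =>
      Complex.exp (Complex.I * (minkowski (shell m k) x : ℂ)) := by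
    have h1 : Continuous fun k : Momentum D => minkowski (shell m k) x :=
      continuous_minkowski.comp (continuous_shell.prodMk continuous_const)
    fun_prop
  exact (integrable_onShell hm g).mul_bdd (c := 1) hc.aestronglyMeasurable
    (ae_of_all _ fun k => (norm_exp_minkowski' _ x).le)

/-- For real g the lower-shell contribution is the conjugate of the upper one. Hence Δ ∗ g is real,
and h · (Δ ∗ g) is again a real test function. -/
theorem pauliJordan_eq (hm : 0 < m) (g : 𝓢(Spacetime D, ℝ)) (x : Spacetime D) :
    pauliJordan m g x = ((2 * (positiveFrequency m g x).im : ℝ) : ℂ) := by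
  have h1 : ∀ z : ℂ, ((2 * z.im : ℝ) : ℂ) = -Complex.I * (z - (starRingEnd ℂ) z) := fun z => by
    rw [Complex.sub_conj]
    push_cast
    linear_combination (2 * (z.im : ℂ)) * Complex.I_mul_I
  rw [h1, positiveFrequency, ← integral_conj, ← integral_sub (integrable_positiveFrequency hm g x),
    ← integral_const_mul, pauliJordan]
  · refine integral_congr_ae (ae_of_all _ fun k => ?_)
    simp only [map_mul, ← Complex.exp_conj, Complex.conj_I, Complex.conj_ofReal,
      minkowski_neg_left, ← star_fourier, RCLike.star_def]
    push_cast
    ring_nf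
  · exact (Complex.conjLIE : ℂ ≃ₗᵢ[ℝ] ℂ).integrable_comp_iff.2
      (integrable_positiveFrequency hm g x)

/-- The Schwartz function `h · (Δ ∗ g)`. -/
def squeezeSchwartz (m : ℝ) (h g : 𝓢(Spacetime D, ℝ)) : 𝓢(Spacetime D, ℝ) :=
  (SchwartzMap.smulLeftCLM ℂ (positiveFrequency m g)
    ((2 : ℝ) • h.postcompCLM Complex.ofRealCLM)).postcompCLM Complex.imCLM

theorem squeezeSchwartz_apply (hm : 0 < m) (h g : 𝓢(Spacetime D, ℝ)) (x : Spacetime D) :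
    (squeezeSchwartz m h g x : ℂ) = h x * pauliJordan m g x := by
  rw [pauliJordan_eq hm, ← Complex.ofReal_mul]
  congr 1
  rw [squeezeSchwartz, SchwartzMap.postcompCLM_apply, SchwartzMap.smulLeftCLM_apply_apply
    (hasTemperateGrowth_positiveFrequency hm g)]
  simp
  ring

theorem exists_norm_fourier_le (h : 𝓢(Spacetime D, ℝ)) : ∃ C, ∀ k, ‖fourier h k‖ ≤ C := by
  obtain ⟨C, _, hC⟩ := exists_fourier_decay h 0
  exact ⟨C, fun k => by simpa using hC k⟩

/-- After Fubini, the phase of the upper shell combines with that of p to h̃(p-q) and the phase of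
the lower shell to h̃(q+p), while reality of g turns g̃(-q) into a conjugate. These are the two
kernels of the Wick square. -/
theorem onShell_squeezeSchwartz (hm : 0 < m) (h g : 𝓢(Spacetime D, ℝ)) (p : Momentum D) :
    onShell m (squeezeSchwartz m h g) p = -Complex.I *
      (∫ q, fourier h (shell m p - shell m q) * onShell m g q ∂shellMeasure D m -
        ∫ q, star (onShell m g q) * fourier h (shell m q + shell m p) ∂shellMeasure D m) := by
  set H : Spacetime D → Momentum D → ℂ := fun x q =>
    h x * (-Complex.I * (fourier g (shell m q) * Complex.exp (Complex.I *
      (minkowski (shell m q) x : ℂ)) - fourier g (-shell m q) * Complex.exp (Complex.I *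
      (minkowski (-shell m q) x : ℂ)))) *
      Complex.exp (-(Complex.I * (minkowski (shell m p) x : ℂ))) with hH
  have hHc : Continuous (Function.uncurry H) := by
    have e1 : Continuous fun z : Spacetime D × Momentum D => minkowski (shell m z.2) z.1 :=
      continuous_minkowski.comp ((continuous_shell.comp continuous_snd).prodMk continuous_fst)
    have e2 : Continuous fun z : Spacetime D × Momentum D => minkowski (-shell m z.2) z.1 :=
      continuous_minkowski.comp ((continuous_shell.comp continuous_snd).neg.prodMk continuous_fst)
    have e3 : Continuous fun z : Spacetime D × Momentum D => minkowski (shell m p) z.1 :=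
      continuous_minkowski.comp (continuous_const.prodMk continuous_fst)
    have e4 : Continuous fun z : Spacetime D × Momentum D => fourier g (shell m z.2) :=
      (continuous_fourier g).comp (continuous_shell.comp continuous_snd)
    have e5 : Continuous fun z : Spacetime D × Momentum D => fourier g (-shell m z.2) :=
      (continuous_fourier g).comp (continuous_shell.comp continuous_snd).neg
    have e6 : Continuous fun z : Spacetime D × Momentum D => (h z.1 : ℂ) :=
      Complex.continuous_ofReal.comp (h.continuous.comp continuous_fst)
    simp only [hH, Function.uncurry_def]
    fun_prop
  have hHi : Integrable (Function.uncurry H) (volume.prod (shellMeasure D m)) := by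
    have hi := (h.integrable (μ := volume)).norm.mul_prod
      ((integrable_onShell hm g).norm.const_mul 2)
    refine hi.mono' hHc.aestronglyMeasurable (ae_of_all _ fun z => ?_)
    simp only [hH, Function.uncurry_def, norm_mul, norm_exp_minkowski, mul_one, norm_neg,
      Complex.norm_I, one_mul, Complex.norm_real]
    gcongr
    refine (norm_sub_le _ _).trans ?_
    rw [norm_mul, norm_mul, norm_exp_minkowski', norm_exp_minkowski', ← star_fourier, norm_star,
      onShell]
    linarith
  have h1 : onShell m (squeezeSchwartz m h g) p = ∫ x, ∫ q, H x q ∂shellMeasure D m := by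
    rw [onShell, fourier]
    refine integral_congr_ae (ae_of_all _ fun x => ?_)
    simp only [hH]
    rw [squeezeSchwartz_apply hm, pauliJordan, integral_mul_const,
      integral_const_mul (h x : ℂ)]
  obtain ⟨C, hC⟩ := exists_norm_fourier_le h
  rw [h1, integral_integral_swap hHi, ← integral_sub, ← integral_const_mul]
  · refine integral_congr_ae (ae_of_all _ fun q => ?_)
    have h2 : ∀ x, H x q = -Complex.I * fourier g (shell m q) *
        (h x * Complex.exp (-(Complex.I * (minkowski (shell m p - shell m q) x : ℂ)))) -
        (-Complex.I * fourier g (-shell m q)) *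
        (h x * Complex.exp (-(Complex.I * (minkowski (shell m q + shell m p) x : ℂ)))) := by
      intro x
      have e1 : Complex.exp (-(Complex.I * (minkowski (shell m p - shell m q) x : ℂ))) =
          Complex.exp (Complex.I * (minkowski (shell m q) x : ℂ)) *
          Complex.exp (-(Complex.I * (minkowski (shell m p) x : ℂ))) := by
        rw [← Complex.exp_add, sub_eq_add_neg, minkowski_add_left, minkowski_neg_left]
        congr 1
        push_cast
        ring
      have e2 : Complex.exp (-(Complex.I * (minkowski (shell m q + shell m p) x : ℂ))) =
          Complex.exp (Complex.I * (minkowski (-shell m q) x : ℂ)) *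
          Complex.exp (-(Complex.I * (minkowski (shell m p) x : ℂ))) := by
        rw [← Complex.exp_add, minkowski_add_left, minkowski_neg_left]
        congr 1
        push_cast
        ring
      rw [e1, e2, hH]
      ring
    have hi : Integrable fun x => (h x : ℂ) := h.integrable.ofReal
    simp only [h2]
    rw [integral_sub ((integrable_mul_exp hi _).const_mul _)
      ((integrable_mul_exp hi _).const_mul _), integral_const_mul, integral_const_mul, onShell,
      star_fourier]
    have e : ∀ l, ∫ x, (h x : ℂ) * Complex.exp (-(Complex.I * (minkowski l x : ℂ))) =
      fourier h l := fun _ => rfl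
    rw [e, e]
    ring
  · have hc : Continuous fun q : Momentum D => fourier h (shell m p - shell m q) :=
      (continuous_fourier h).comp (continuous_const.sub continuous_shell)
    exact (integrable_onShell hm g).bdd_mul (c := C) hc.aestronglyMeasurable
      (ae_of_all _ fun q => hC _)
  · have hc : Continuous fun q : Momentum D => fourier h (shell m q + shell m p) :=
      (continuous_fourier h).comp (continuous_shell.add continuous_const)
    have hs : Integrable (fun q => star (onShell m g q)) (shellMeasure D m) :=
      (Complex.conjLIE : ℂ ≃ₗᵢ[ℝ] ℂ).integrable_comp_iff.2 (integrable_onShell hm g)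
    exact hs.mul_bdd (c := C) hc.aestronglyMeasurable (ae_of_all _ fun q => hC _)

/-- The two-particle wave function `h̃(p + q)`. -/
def pairKernel (hm : 0 < m) (h : 𝓢(Spacetime D, ℝ)) :
    Lp ℂ 2 ((shellMeasure D m).prod (shellMeasure D m)) := (memLp_pairKernel hm h).toLp

theorem pairKernel_ae (hm : 0 < m) (h : 𝓢(Spacetime D, ℝ)) :
    pairKernel hm h =ᵐ[(shellMeasure D m).prod (shellMeasure D m)]
      fun z => fourier h (shell m z.1 + shell m z.2) := (memLp_pairKernel hm h).coeFn_toLp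

theorem pairKernel_symm (hm : 0 < m) (h : 𝓢(Spacetime D, ℝ)) :
    pairKernel hm h =ᵐ[(shellMeasure D m).prod (shellMeasure D m)]
      fun z => pairKernel hm h (z.2, z.1) := by
  have h1 : ∀ᵐ z ∂(shellMeasure D m).prod (shellMeasure D m), pairKernel hm h (z.2, z.1) =
      fourier h (shell m z.2 + shell m z.1) :=
    Measure.measurePreserving_swap.quasiMeasurePreserving.ae (pairKernel_ae hm h)
  filter_upwards [pairKernel_ae hm h, h1] with z h2 h3
  rw [h2, h3, add_comm (shell m z.1)]

theorem fourier_hermitian (h : 𝓢(Spacetime D, ℝ)) (p q : Momentum D) :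
    fourier h (shell m q - shell m p) = star (fourier h (shell m p - shell m q)) := by
  rw [star_fourier, neg_sub]

theorem isSqueezingGenerator_oneGenerator (hm : 0 < m) (h : 𝓢(Spacetime D, ℝ)) {C : ℝ≥0}
    (hk : IsSchurKernel (shellMeasure D m) (fun p q => fourier h (shell m p - shell m q)) C) :
    IsSqueezingGenerator hm h (oneGenerator hk (pairKernel hm h)) := fun g => by
  refine ⟨squeezeSchwartz m h g, squeezeSchwartz_apply hm h g, ?_⟩
  have hg : oneParticle hm g =ᵐ[shellMeasure D m] onShell m g := (memLp_onShell hm g).coeFn_toLp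
  rw [oneGenerator_apply]
  refine Lp.ext ?_
  filter_upwards [Lp.coeFn_smul (-Complex.I) (oneKernel hk (oneParticle hm g) -
    contract (oneParticle hm g) (pairKernel hm h)), Lp.coeFn_sub (oneKernel hk (oneParticle hm g))
    (contract (oneParticle hm g) (pairKernel hm h)), oneKernel_ae hk hg,
    contract_ae hg (pairKernel_ae hm h), (memLp_onShell hm (squeezeSchwartz m h g)).coeFn_toLp]
    with p h1 h2 h3 h4 h5
  rw [h1, Pi.smul_apply, h2, Pi.sub_apply, h3, h4, oneParticle, h5, onShell_squeezeSchwartz hm,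
    smul_eq_mul]

/-- The values on test functions are prescribed, and test functions are dense; so the choice in
`squeezingGenerator` is immaterial. -/
theorem IsSqueezingGenerator.unique {hm : 0 < m} {h : 𝓢(Spacetime D, ℝ)}
    {t t' : OneParticle D m →L[ℝ] OneParticle D m} (ht : IsSqueezingGenerator hm h t)
    (ht' : IsSqueezingGenerator hm h t') : t = t' := by
  refine ContinuousLinearMap.ext fun F => ?_
  refine congrFun ((denseRange_oneParticle hm).equalizer t.continuous t'.continuous
    (funext fun g => ?_)) F
  obtain ⟨k, hk, h1⟩ := ht g
  obtain ⟨k', hk', h2⟩ := ht' g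
  have : k = k' := by
    ext x
    have := (hk x).trans (hk' x).symm
    exact_mod_cast this
  simp only [Function.comp, h1, h2, this]

theorem IsSqueezingGenerator.squeezingGenerator_eq {hm : 0 < m} {h : 𝓢(Spacetime D, ℝ)}
    {t : OneParticle D m →L[ℝ] OneParticle D m} (ht : IsSqueezingGenerator hm h t) :
    squeezingGenerator hm h = t := by
  have h1 : ∃ t, IsSqueezingGenerator hm h t := ⟨t, ht⟩
  rw [squeezingGenerator, dif_pos h1]
  exact h1.choose_spec.unique ht

end PauliJordan

end LocalSqueezing
end

noncomputable section

namespace LocalSqueezing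

section Algebra

variable {D : ℕ} {m : ℝ}

/-! ### Weyl operators of arbitrary one-particle vectors -/

theorem fourier_smul (s : ℝ) (f : 𝓢(Spacetime D, ℝ)) (k : Spacetime D) :
    fourier (s • f : 𝓢(Spacetime D, ℝ)) k = s * fourier f k := by
  rw [fourier, fourier, ← integral_const_mul]
  refine integral_congr_ae (ae_of_all _ fun x => ?_)
  simp only [_root_.smul_apply, smul_eq_mul, Complex.ofReal_mul]
  ring

theorem oneParticle_smul (hm : 0 < m) (s : ℝ) (f : 𝓢(Spacetime D, ℝ)) :
    oneParticle hm (s • f) = s • oneParticle hm f := by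
  refine Lp.ext ?_
  filter_upwards [(memLp_onShell hm (s • f)).coeFn_toLp, (memLp_onShell hm f).coeFn_toLp,
    Lp.coeFn_smul s (oneParticle hm f)] with p h1 h2 h3
  rw [h3, Pi.smul_apply, oneParticle, oneParticle, h1, h2, onShell, fourier_smul, onShell,
    Complex.real_smul]

/-- The rescaled group has generator s Φ(F) = Φ(sF). Thus Weyl operators of real multiples of a test
function exhaust a one-parameter group. -/
theorem group_fieldEnd_real_smul (s : ℝ) (F : OneParticle D m) :
    (isUniformlyAnalytic_fieldEnd (s • F)).group 1 = (isUniformlyAnalytic_fieldEnd F).group s := by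
  have hA := isUniformlyAnalytic_fieldEnd F
  have h := (isUniformlyAnalytic_fieldEnd (s • F)).eq_group (V := fun t => hA.group (s * t))
    (fun t => hA.group_mem_unitary _) (fun t u => by rw [mul_add s, hA.group_add]) (fun x => ?_) 1
  · rw [← h, mul_one]
  · rw [generates_iff_hasDerivAt (by rw [mul_zero s, hA.group_zero])]
    have h1 : HasDerivAt (fun t : ℝ => s * t) s 0 := by
      simpa using (hasDerivAt_id (0 : ℝ)).const_mul s
    have h2 := HasDerivAt.scomp (0 : ℝ) (hA.hasDerivAt_group x (s * 0)) h1
    refine h2.congr_deriv ?_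
    rw [mul_zero s, hA.group_zero, one_apply_eq_self, fieldEnd_real_smul, smul_comm,
      ← Complex.coe_smul s]
    rfl

theorem continuous_fieldEnd (x : finiteParticle D m) :
    Continuous fun F : OneParticle D m => (fieldEnd F x : Fock D m) := by
  obtain ⟨N, hN⟩ := exists_upTo x
  let l : OneParticle D m →ₗ[ℝ] Fock D m :=
    { toFun := fun F => (fieldEnd F x : Fock D m)
      map_add' := fun F G => by rw [fieldEnd_add]; rfl
      map_smul' := fun r F => by
        rw [fieldEnd_real_smul, RingHom.id_apply, ← Complex.coe_smul r]; rfl }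
  refine (l.mkContinuous (2 * (N + 3) * ‖(x : Fock D m)‖) fun F => ?_).continuous
  refine (norm_fieldEnd_le F hN).trans (le_of_eq (by ring))

/-- Commuting with the Weyl operators of all real multiples of f gives ⟨b x, Φ(F) y⟩ = ⟨b Φ(F) x, y⟩
for F = [f]. This relation is closed in F, hence holds for every F by density, and essential
self-adjointness turns it back into commutation with the group. -/
theorem commute_weyl (hm : 0 < m) {b : Fock D m →L[ℂ] Fock D m}
    (hb : b ∈ StarSubalgebra.centralizer ℂ (weylSet (D := D) hm)) (F : OneParticle D m) :
    b * weyl F = weyl F * b := by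
  rw [weyl_eq]
  refine (isUniformlyAnalytic_fieldEnd F).commute_of_generates (fun x => ?_) 1
  refine (isUniformlyAnalytic_fieldEnd F).generates_of_adjoint fun y => ?_
  have hcl : IsClosed {F : OneParticle D m | inner ℂ (b x) (fieldEnd F y : Fock D m) =
      inner ℂ (b (fieldEnd F x : Fock D m)) (y : Fock D m)} :=
    isClosed_eq (continuous_const.inner (continuous_fieldEnd y))
      ((b.continuous.comp (continuous_fieldEnd x)).inner continuous_const)
  refine (denseRange_oneParticle hm).induction_on F hcl fun f => ?_
  have hA := isUniformlyAnalytic_fieldEnd (oneParticle hm f)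
  have hs : ∀ s, b * hA.group s = hA.group s * b := fun s => by
    rw [← group_fieldEnd_real_smul, ← oneParticle_smul, ← weyl_eq]
    exact ((StarSubalgebra.mem_centralizer_iff ℂ).1 hb _ ⟨s • f, rfl⟩).1.symm
  exact ((hA.generates_of_commute hs x).symm hA.group_mem_unitary hA.group_add
    (hA.generates_group y)).symm

/-- Needed because T_h [f] is obtained only as a vector of the completion, not as the class of a
test function. -/
theorem weyl_mem_weylAlgebra (hm : 0 < m) (F : OneParticle D m) :
    weyl F ∈ weylAlgebra (D := D) hm := by
  rw [weylAlgebra, StarSubalgebra.mem_centralizer_iff]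
  exact fun b hb => ⟨commute_weyl hm hb F, commute_weyl hm (star_mem hb) F⟩

/-! ### Conjugation of a double commutant by a unitary -/

section Conj

variable {A : Type*} [Ring A] [StarRing A] [Algebra ℂ A] [StarModule ℂ A]

/-- Since V w V* lies in the double commutant for w in S, the map b ↦ V* b V preserves the commutant
of S; dually, a ↦ V a V* preserves the double commutant. -/
theorem conj_mem_bicommutant {S : Set A} {V : A} (hV : V ∈ unitary A)
    (hS : ∀ w ∈ S, V * w * star V ∈
      StarSubalgebra.centralizer ℂ (StarSubalgebra.centralizer ℂ S : Set A)) {a : A}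
    (ha : a ∈ StarSubalgebra.centralizer ℂ (StarSubalgebra.centralizer ℂ S : Set A)) :
    V * a * star V ∈ StarSubalgebra.centralizer ℂ (StarSubalgebra.centralizer ℂ S : Set A) := by
  have h1 := Unitary.star_mul_self_of_mem hV
  have h2 := Unitary.mul_star_self_of_mem hV
  have key : ∀ b ∈ StarSubalgebra.centralizer ℂ S,
      star V * b * V ∈ StarSubalgebra.centralizer ℂ S := by
    intro b hb
    have hw : ∀ w, V * w * star V ∈
        StarSubalgebra.centralizer ℂ (StarSubalgebra.centralizer ℂ S : Set A) →
        w * (star V * b * V) = star V * b * V * w := by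
      intro w hw
      have h3 := ((StarSubalgebra.mem_centralizer_iff ℂ).1 hw b hb).1
      calc w * (star V * b * V) = star V * V * w * (star V * b * V) := by rw [h1, one_mul]
        _ = star V * (V * w * star V * b) * V := by noncomm_ring
        _ = star V * b * V * w * (star V * V) := by rw [← h3]; noncomm_ring
        _ = _ := by rw [h1, mul_one]
    rw [StarSubalgebra.mem_centralizer_iff]
    refine fun w hwS => ⟨hw w (hS w hwS), hw _ ?_⟩
    have := star_mem (hS w hwS)
    rwa [star_mul, star_mul, star_star, ← mul_assoc] at this
  have h4 : ∀ b ∈ StarSubalgebra.centralizer ℂ S, b * (V * a * star V) = V * a * star V * b := by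
    intro b hb
    have h5 := ((StarSubalgebra.mem_centralizer_iff ℂ).1 ha _ (key b hb)).1
    calc b * (V * a * star V) = V * star V * b * (V * a * star V) := by rw [h2, one_mul]
      _ = V * (star V * b * V * a) * star V := by noncomm_ring
      _ = V * a * star V * b * (V * star V) := by rw [h5]; noncomm_ring
      _ = _ := by rw [h2, mul_one]
  rw [StarSubalgebra.mem_centralizer_iff]
  exact fun b hb => ⟨h4 b hb, h4 _ (star_mem hb)⟩

/-- Conjugation by a unitary as an automorphism of a star subalgebra which is invariant under it
and its inverse. -/
def conjEquiv (M : StarSubalgebra ℂ A) {V : A} (hV : V ∈ unitary A)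
    (h1 : ∀ a ∈ M, star V * a * V ∈ M) (h2 : ∀ a ∈ M, V * a * star V ∈ M) : M ≃⋆ₐ[ℂ] M where
  toFun a := ⟨star V * a * V, h1 a a.2⟩
  invFun a := ⟨V * a * star V, h2 a a.2⟩
  left_inv a := Subtype.ext <| by
    have h := Unitary.mul_star_self_of_mem hV
    calc V * (star V * a * V) * star V = (V * star V) * a * (V * star V) := by noncomm_ring
      _ = a := by rw [h, one_mul, mul_one]
  right_inv a := Subtype.ext <| by
    have h := Unitary.star_mul_self_of_mem hV
    calc star V * (V * a * star V) * V = (star V * V) * a * (star V * V) := by noncomm_ring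
      _ = a := by rw [h, one_mul, mul_one]
  map_mul' a b := Subtype.ext <| by
    have h := Unitary.mul_star_self_of_mem hV
    calc star V * (a * b) * V = star V * a * 1 * b * V := by noncomm_ring
      _ = star V * a * V * (star V * b * V) := by rw [← h]; noncomm_ring
  map_add' a b := Subtype.ext <| by
    change star V * (a + b) * V = star V * a * V + star V * b * V
    noncomm_ring
  map_star' a := Subtype.ext <| by
    change star V * star (a : A) * V = star (star V * a * V)
    rw [star_mul, star_mul, star_star, mul_assoc]
  map_smul' c a := Subtype.ext <| by
    change star V * (c • (a : A)) * V = c • (star V * a * V)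
    rw [mul_smul_comm, smul_mul_assoc]

end Conj

/-- The matrix coefficient of V* a V at (x, y) is that of a at (V x, y ∘ V*). -/
theorem continuous_conj_weakTopology (hm : 0 < m) {V : Fock D m →L[ℂ] Fock D m}
    {φ : weylAlgebra (D := D) hm → weylAlgebra (D := D) hm}
    (hφ : ∀ a, (φ a : Fock D m →L[ℂ] Fock D m) = star V * a * V) :
    Continuous[weakTopology hm, weakTopology hm] φ := by
  let _ := weakTopology (D := D) hm
  refine continuous_induced_rng.2 ?_
  refine ContinuousLinearMapWOT.continuous_of_dual_apply_continuous fun x y => ?_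
  have h : Continuous fun a : weylAlgebra (D := D) hm =>
      ContinuousLinearMapWOT.ofCLM (a : Fock D m →L[ℂ] Fock D m) := continuous_induced_dom
  have h1 := (ContinuousLinearMapWOT.continuous_dual_apply (σ := RingHom.id ℂ) (V x)
    (y ∘L star V)).comp h
  refine h1.congr fun a => ?_
  simp only [Function.comp, hφ]
  rfl

theorem adjoin_weylSet_le (hm : 0 < m) :
    StarAlgebra.adjoin ℂ (weylSet (D := D) hm) ≤ weylAlgebra hm := by
  rw [StarAlgebra.adjoin_le_iff]
  rintro _ ⟨f, rfl⟩
  exact weyl_mem hm f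

/-- Both maps agree on the *-algebra generated by the Weyl operators, which is weakly dense by the
double commutant theorem, and the weak topology is Hausdorff. -/
theorem eq_of_continuous_weakTopology (hm : 0 < m)
    {α β : weylAlgebra (D := D) hm ≃⋆ₐ[ℂ] weylAlgebra (D := D) hm}
    (hα : Continuous[weakTopology hm, weakTopology hm] α)
    (hβ : Continuous[weakTopology hm, weakTopology hm] β)
    (h : ∀ f : 𝓢(Spacetime D, ℝ), α ⟨weyl (oneParticle hm f), weyl_mem hm f⟩ =
      β ⟨weyl (oneParticle hm f), weyl_mem hm f⟩) : α = β := by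
  let τ := weakTopology (D := D) hm
  let e : weylAlgebra (D := D) hm → (Fock D m →WOT[ℂ] Fock D m) :=
    fun a => ContinuousLinearMapWOT.ofCLM (a : Fock D m →L[ℂ] Fock D m)
  have hind : IsInducing e := ⟨rfl⟩
  have hinj : Function.Injective e := fun a b hab => Subtype.ext (by
    have := congrArg ContinuousLinearMapWOT.toCLM hab
    exact this)
  have hT2 : T2Space (weylAlgebra (D := D) hm) := T2Space.of_injective_continuous hinj hind.continuous
  set S : Set (weylAlgebra (D := D) hm) :=
    {a | (a : Fock D m →L[ℂ] Fock D m) ∈ StarAlgebra.adjoin ℂ (weylSet (D := D) hm)} with hS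
  have hadj : Set.EqOn α β S := by
    rintro ⟨a, ha⟩ haS
    change a ∈ StarAlgebra.adjoin ℂ (weylSet (D := D) hm) at haS
    suffices h' : ∀ ha, α ⟨a, ha⟩ = β ⟨a, ha⟩ from h' ha
    clear ha
    induction haS using StarAlgebra.adjoin_induction with
    | mem x hx =>
      obtain ⟨f, rfl⟩ := hx
      exact fun _ => h f
    | algebraMap r =>
      intro ha
      have e1 : (⟨algebraMap ℂ _ r, ha⟩ : weylAlgebra (D := D) hm) = r • 1 :=
        Subtype.ext (Algebra.algebraMap_eq_smul_one r)
      rw [e1, map_smul, map_smul, map_one, map_one]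
    | add x y hx hy ihx ihy =>
      intro ha
      have e1 : (⟨x + y, ha⟩ : weylAlgebra (D := D) hm) =
        ⟨x, adjoin_weylSet_le hm hx⟩ + ⟨y, adjoin_weylSet_le hm hy⟩ := rfl
      rw [e1, map_add, map_add, ihx, ihy]
    | mul x y hx hy ihx ihy =>
      intro ha
      have e1 : (⟨x * y, ha⟩ : weylAlgebra (D := D) hm) =
        ⟨x, adjoin_weylSet_le hm hx⟩ * ⟨y, adjoin_weylSet_le hm hy⟩ := rfl
      rw [e1, map_mul, map_mul, ihx, ihy]
    | star x hx ihx =>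
      intro ha
      have e1 : (⟨star x, ha⟩ : weylAlgebra (D := D) hm) =
        star ⟨x, adjoin_weylSet_le hm hx⟩ := rfl
      rw [e1, map_star, map_star, ihx]
  refine StarAlgEquiv.ext fun a => hadj.closure hα hβ ?_
  rw [hind.closure_eq_preimage_closure_image]
  refine closure_mono ?_ (mem_closure_adjoin_wot (weylSet (D := D) hm) a.2)
  rintro _ ⟨b, hb, rfl⟩
  exact ⟨⟨b, adjoin_weylSet_le hm hb⟩, hb, rfl⟩

/-! ### Vector states -/

theorem norm_vacuum : ‖vacuum D m‖ = 1 := by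
  have h1 : ‖vacuum D m‖ = ‖zeroParticleOne D m‖ :=
    lp.norm_single (E := fun n => nParticle D m n) (by norm_num) 0 (zeroParticleOne D m)
  rw [h1]
  change ‖(memLp_const (1 : ℂ)).toLp _‖ = 1
  rw [Lp.norm_toLp, eLpNorm_const' _ (by norm_num) (by norm_num), nMeasure, Measure.pi_of_empty]
  simp

theorem vectorState_mem_vacuumFolium (hm : 0 < m) {ψ : Fock D m} (hψ : ‖ψ‖ = 1) :
    vectorState hm ψ ∈ vacuumFolium (D := D) hm := by
  refine ⟨fun i => if i = 0 then ψ else 0, ?_, fun a => ?_⟩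
  · convert hasSum_ite_eq (0 : ℕ) (1 : ℝ) using 2 with i
    beta_reduce
    rcases eq_or_ne i 0 with hi | hi
    · rw [if_pos hi, if_pos hi, hψ, one_pow]
    · rw [if_neg hi, if_neg hi, norm_zero, sq, zero_mul]
  · convert hasSum_ite_eq (0 : ℕ) (vectorState hm ψ a) using 2 with i
    beta_reduce
    rcases eq_or_ne i 0 with hi | hi
    · rw [if_pos hi, if_pos hi]
    · rw [if_neg hi, if_neg hi, vectorState, inner_zero_left]

theorem inner_star_mul_mul (V a : Fock D m →L[ℂ] Fock D m) (ψ : Fock D m) :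
    inner ℂ ψ ((star V * a * V) ψ) = inner ℂ (V ψ) (a (V ψ)) := by
  rw [mul_assoc, mul_apply_eq_comp, ContinuousLinearMap.star_eq_adjoint,
    ContinuousLinearMap.adjoint_inner_right]
  rfl

/-! ### Implementation of the squeezing transformation -/

theorem exp_neg_squeezingGenerator (hm : 0 < m) (h : 𝓢(Spacetime D, ℝ)) (F : OneParticle D m) :
    squeezing hm h (NormedSpace.exp (-squeezingGenerator hm h) F) = F := by
  let _ : NormedAlgebra ℚ (OneParticle D m →L[ℝ] OneParticle D m) :=
    NormedAlgebra.restrictScalars ℚ ℝ _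
  have h1 := NormedSpace.exp_add_of_commute (Commute.refl (squeezingGenerator hm h)).neg_right
  rw [add_neg_cancel, NormedSpace.exp_zero] at h1
  rw [squeezing, ← mul_apply_eq_comp, ← h1, one_apply_eq_self]

theorem isWickSquare_wickEnd_pairKernel (hm : 0 < m) (h : 𝓢(Spacetime D, ℝ)) {C : NNReal}
    (hk : IsSchurKernel (shellMeasure D m) (fun p q => fourier h (shell m p - shell m q)) C) :
    IsWickSquare h ((finiteParticle D m).subtype ∘ₗ wickEnd hk (pairKernel hm h)) :=
  isWickSquare_wickEnd (pairKernel_ae hm h) fun u v => by rw [star_fourier, neg_add']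

theorem weylTwo_eq (hm : 0 < m) (h : 𝓢(Spacetime D, ℝ)) {C : NNReal}
    (hk : IsSchurKernel (shellMeasure D m) (fun p q => fourier h (shell m p - shell m q)) C) :
    weylTwo m h = (isUniformlyAnalytic_halfWickEnd hk (pairKernel hm h)
      fun p q => fourier_hermitian h p q).group 1 := by
  rw [weylTwo, wickSquare_eq (isWickSquare_wickEnd_pairKernel hm h hk),
    group_half_wickEnd hk fun p q => fourier_hermitian h p q]

theorem weylTwo_mem_unitary (hm : 0 < m) (h : 𝓢(Spacetime D, ℝ)) :
    weylTwo m h ∈ unitary (Fock D m →L[ℂ] Fock D m) := by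
  obtain ⟨C, hk⟩ := exists_isSchurKernel hm h
  rw [weylTwo_eq hm h hk]
  exact IsUniformlyAnalytic.group_mem_unitary _ 1

theorem star_weylTwo_mul_weyl_mul_weylTwo (hm : 0 < m) (h : 𝓢(Spacetime D, ℝ))
    (F : OneParticle D m) :
    star (weylTwo m h) * weyl F * weylTwo m h = weyl (squeezing hm h F) := by
  obtain ⟨C, hk⟩ := exists_isSchurKernel hm h
  rw [weylTwo_eq hm h hk, weyl_eq, weyl_eq, squeezing,
    (isSqueezingGenerator_oneGenerator hm h hk).squeezingGenerator_eq]
  exact star_group_mul_group_mul_group_wick hk (fun p q => fourier_hermitian h p q)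
    (pairKernel_symm hm h) F

theorem star_weylTwo_mul_mem (hm : 0 < m) (h : 𝓢(Spacetime D, ℝ)) {a : Fock D m →L[ℂ] Fock D m}
    (ha : a ∈ weylAlgebra hm) : star (weylTwo m h) * a * weylTwo m h ∈ weylAlgebra hm := by
  have h1 := conj_mem_bicommutant (Unitary.star_mem (weylTwo_mem_unitary hm h))
    (S := weylSet hm) (fun w hw => ?_) ha
  · rwa [star_star] at h1
  · obtain ⟨f, rfl⟩ := hw
    rw [star_star, star_weylTwo_mul_weyl_mul_weylTwo hm]
    exact weyl_mem_weylAlgebra hm _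

/-- Covariance applied to exp(-t_h) F shows that the inverse conjugation sends W₁(F) to W₁(exp(-t_h)
F). -/
theorem weylTwo_mul_mem (hm : 0 < m) (h : 𝓢(Spacetime D, ℝ)) {a : Fock D m →L[ℂ] Fock D m}
    (ha : a ∈ weylAlgebra hm) : weylTwo m h * a * star (weylTwo m h) ∈ weylAlgebra hm := by
  refine conj_mem_bicommutant (weylTwo_mem_unitary hm h) (S := weylSet hm) (fun w hw => ?_) ha
  obtain ⟨f, rfl⟩ := hw
  have h1 := Unitary.mul_star_self_of_mem (weylTwo_mem_unitary hm h)
  have h2 := star_weylTwo_mul_weyl_mul_weylTwo hm h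
    (NormedSpace.exp (-squeezingGenerator hm h) (oneParticle hm f))
  rw [exp_neg_squeezingGenerator] at h2
  have h3 : weylTwo m h * weyl (oneParticle hm f) * star (weylTwo m h) =
      weyl (NormedSpace.exp (-squeezingGenerator hm h) (oneParticle hm f)) := by
    rw [← h2]
    set V := weylTwo m h
    set w := weyl (NormedSpace.exp (-squeezingGenerator hm h) (oneParticle hm f))
    calc V * (star V * w * V) * star V = V * star V * w * (V * star V) := by noncomm_ring
      _ = w := by rw [h1, one_mul, mul_one]
  simp only [h3]
  exact weyl_mem_weylAlgebra hm _

/-- Conjugation of the Weyl algebra by `W₂(h)`. -/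
def bogoliubov (hm : 0 < m) (h : 𝓢(Spacetime D, ℝ)) :
    weylAlgebra (D := D) hm ≃⋆ₐ[ℂ] weylAlgebra (D := D) hm :=
  conjEquiv (weylAlgebra hm) (weylTwo_mem_unitary hm h) (fun _ ha => star_weylTwo_mul_mem hm h ha)
    fun _ ha => weylTwo_mul_mem hm h ha

theorem coe_bogoliubov (hm : 0 < m) (h : 𝓢(Spacetime D, ℝ)) (a : weylAlgebra (D := D) hm) :
    (bogoliubov hm h a : Fock D m →L[ℂ] Fock D m) = star (weylTwo m h) * a * weylTwo m h := rfl

theorem isBogoliubov_bogoliubov (hm : 0 < m) (h : 𝓢(Spacetime D, ℝ)) :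
    IsBogoliubov hm h (bogoliubov hm h) :=
  ⟨continuous_conj_weakTopology hm (coe_bogoliubov hm h), fun f => by
    rw [coe_bogoliubov]
    exact star_weylTwo_mul_weyl_mul_weylTwo hm h (oneParticle hm f)⟩

theorem IsBogoliubov.eq_bogoliubov {hm : 0 < m} {h : 𝓢(Spacetime D, ℝ)}
    {α : weylAlgebra (D := D) hm ≃⋆ₐ[ℂ] weylAlgebra (D := D) hm} (hα : IsBogoliubov hm h α) :
    α = bogoliubov hm h :=
  eq_of_continuous_weakTopology hm hα.1 (isBogoliubov_bogoliubov hm h).1 fun f =>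
    Subtype.ext ((hα.2 f).trans ((isBogoliubov_bogoliubov hm h).2 f).symm)

theorem vacuumState_comp_bogoliubov (hm : 0 < m) (h : 𝓢(Spacetime D, ℝ)) :
    vacuumState hm ∘ bogoliubov hm h = vectorState hm (weylTwo m h (vacuum D m)) :=
  funext fun a => inner_star_mul_mul (weylTwo m h) a (vacuum D m)

theorem norm_weylTwo_vacuum (hm : 0 < m) (h : 𝓢(Spacetime D, ℝ)) :
    ‖weylTwo m h (vacuum D m)‖ = 1 := by
  have h1 := inner_star_mul_mul (weylTwo m h) 1 (vacuum D m)
  rw [mul_one, Unitary.star_mul_self_of_mem (weylTwo_mem_unitary hm h), one_apply_eq_self,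
    one_apply_eq_self, inner_self_eq_norm_sq_to_K, inner_self_eq_norm_sq_to_K, norm_vacuum] at h1
  have h2 : (1 : ℝ) ^ 2 = ‖weylTwo m h (vacuum D m)‖ ^ 2 := by exact_mod_cast h1
  exact ((sq_eq_sq₀ zero_le_one (norm_nonneg _)).1 h2).symm

end Algebra

end LocalSqueezing
end

open LocalSqueezing in
theorem mainTheorem1 (D : ℕ) (hD : 1 ≤ D) (m : ℝ) (hm : 0 < m) (h : 𝓢(Spacetime D, ℝ)) :
    -- the one-particle operators `t_h` and `T_h = exp(t_h)` are well defined
    DenseRange (oneParticle (D := D) hm) ∧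
    IsSqueezingGenerator hm h (squeezingGenerator hm h) ∧
    -- the fields and the Wick square are well defined and essentially self-adjoint
    (∀ F : OneParticle D m, IsField F (field F).toFun ∧ IsSelfAdjoint (field F).closure) ∧
    IsWickSquare h (wickSquare m h).toFun ∧ IsSelfAdjoint (wickSquare m h).closure ∧
    -- their exponentials are unitary
    (∀ F : OneParticle D m, weyl F ∈ unitary (Fock D m →L[ℂ] Fock D m)) ∧
    weylTwo m h ∈ unitary (Fock D m →L[ℂ] Fock D m) ∧
    -- unitary implementation
    (∀ F : OneParticle D m, star (weylTwo m h) * weyl F * weylTwo m h = weyl (squeezing hm h F)) ∧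
    -- the Bogoliubov transformation, and the locally squeezed state as a vector state
    (∃! α, IsBogoliubov hm h α) ∧
    ∀ α, IsBogoliubov hm h α →
      (∀ a, (α a : Fock D m →L[ℂ] Fock D m) = star (weylTwo m h) * a * weylTwo m h) ∧
      vacuumState hm ∘ α = vectorState hm (weylTwo m h (vacuum D m)) ∧
      vacuumState hm ∈ vacuumFolium (D := D) hm ∧
      vacuumState hm ∘ α ∈ vacuumFolium hm := by
  obtain ⟨C, hk⟩ := exists_isSchurKernel hm h
  have hB := isWickSquare_wickEnd_pairKernel hm h hk
  have ht := isSqueezingGenerator_oneGenerator hm h hk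
  refine ⟨denseRange_oneParticle hm, ht.squeezingGenerator_eq ▸ ht,
    fun F => ⟨isField_field F, ?_⟩, hB.toFun_wickSquare, ?_, fun F => ?_,
    weylTwo_mem_unitary hm h, star_weylTwo_mul_weyl_mul_weylTwo hm h,
    ⟨bogoliubov hm h, isBogoliubov_bogoliubov hm h, fun α hα => hα.eq_bogoliubov⟩, fun α hα => ?_⟩
  · rw [field_eq]
    exact (isUniformlyAnalytic_fieldEnd F).isSelfAdjoint_closure
  · rw [wickSquare_eq hB]
    exact (isUniformlyAnalytic_wickEnd hk _ fun p q =>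
      fourier_hermitian h p q).isSelfAdjoint_closure
  · rw [weyl_eq]
    exact (isUniformlyAnalytic_fieldEnd F).group_mem_unitary 1
  · rw [hα.eq_bogoliubov, vacuumState_comp_bogoliubov]
    exact ⟨coe_bogoliubov hm h, rfl, vectorState_mem_vacuumFolium hm norm_vacuum,
      vectorState_mem_vacuumFolium hm (norm_weylTwo_vacuum hm h)⟩
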